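/- Write $\mathbb S^1=\mathbb R/\mathbb Z$. For an integer $k\ge 1$ let $\mathrm{Diff}^k_+(\mathbb S^1)$ be the group of orientation-preserving $C^k$ diffeomorphisms of $\mathbb S^1$ with the uniform $C^k$ topology, and let $\mathrm{Diff}^{1+AC}_+(\mathbb S^1)$ be the group of orientation-preserving $C^1$ diffeomorphisms whose first derivative is absolutely continuous, with the topology of the metric $\sup|f-g|+\sup|f'-g'|+\int_{\mathbb S^1}|f''-g''|$. A pseudometric $d$ on a topological group $G$ is called maximal if it is continuous and right-invariant and if for every continuous right-invariant pseudometric $\rho$ on $G$ there are constants $A,B$ with $\rho\le A\,d+B$. An element $f\in G$ of infinite order is undistorted in $G$ if $G$ has a maximal pseudometric $d$ for which the inclusion $\langle f\rangle\hookrightarrow (G,d)$ is a quasi-isometric embedding, where $\langle f\rangle$ carries the word metric $(f^m,f^n)\mapsto|m-n|$ (this does not depend on the choice of $d$). A diffeomorphism is $C^k$-undistorted, respectively $C^{1+AC}$-undistorted, if it has infinite order and is undistorted in $\mathrm{Diff}^k_+(\mathbb S^1)$, respectively in $\mathrm{Diff}^{1+AC}_+(\mathbb S^1)$. **Theorem 3.**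 Let $0<K\le 2$, and let $U$ be a neighbourhood of the identity in $\mathrm{Diff}^{1+AC}_+(\mathbb S^1)$. There is a real-analytic orientation-preserving diffeomorphism $f$ of $\mathbb S^1$ that lies in $U$ and has the following properties: 1. $f$ has exactly one fixed point $x_0$, and $f'(x_0)=1$, $f''(x_0)=0$; 2. $\int_{\mathbb S^1}|f''|\le 2K$; 3. $f$ is $C^{1+AC}$-undistorted; 4. $f$ is $C^k$-undistorted for every integer $k\ge 2$; 5. the interval diffeomorphism obtained by cutting $\mathbb S^1$ at $x_0$ has non-zero asymptotic distortion: the limit $\lim_{n\to\infty}\frac1n V(\log (f^n)')$ exists and is positive, where $V$ is the total variation over the circle cut at $x_0$. -/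

import Mathlib

open Set Filter Topology MeasureTheory

/-! ### Lifts of circle maps

The circle is `UnitAddCircle = ℝ ⧸ ℤ`. -/

/-- `F : ℝ → ℝ` is a (continuous, degree one) lift of the circle map `f`. -/
structure IsLift (F : ℝ → ℝ) (f : Equiv.Perm UnitAddCircle) : Prop where
  continuous : Continuous F
  map_add_one : ∀ x, F (x + 1) = F x + 1
  coe_apply : ∀ x : ℝ, f (x : UnitAddCircle) = (F x : UnitAddCircle)

/-- A chosen lift of `f` (if there is one). Lifts are unique up to an additive integer constant, so
the derivatives of `circleLift f`, of any order `≥ 1`, do not depend on the choice: they are the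
derivatives of `f`. -/
noncomputable def circleLift (f : Equiv.Perm UnitAddCircle) : ℝ → ℝ :=
  Classical.epsilon fun F => IsLift F f

namespace IsLift

variable {F G : ℝ → ℝ} {f g : Equiv.Perm UnitAddCircle}

theorem one : IsLift id 1 := ⟨continuous_id, fun _ => rfl, fun _ => rfl⟩

theorem comp (hF : IsLift F f) (hG : IsLift G g) : IsLift (F ∘ G) (f * g) where
  continuous := hF.continuous.comp hG.continuous
  map_add_one x := by simp [hG.map_add_one, hF.map_add_one]
  coe_apply x := by simp [hG.coe_apply, hF.coe_apply]

/-- An increasing lift is a homeomorphism of the line. -/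
theorem exists_homeomorph (hF : IsLift F f) (hm : StrictMono F) :
    ∃ e : ℝ ≃ₜ ℝ, (e : ℝ → ℝ) = F ∧ IsLift e.symm f⁻¹ := by
  let c : CircleDeg1Lift := ⟨⟨F, hm.monotone⟩, hF.map_add_one⟩
  have hs : Function.Surjective F :=
    hF.continuous.surjective c.tendsto_atTop c.tendsto_atBot
  let o : ℝ ≃o ℝ := hm.orderIsoOfSurjective F hs
  have ho : ∀ x, o.toHomeomorph x = F x := fun _ => rfl
  refine ⟨o.toHomeomorph, rfl, o.toHomeomorph.symm.continuous, fun x => ?_, fun x => ?_⟩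
  · apply o.toHomeomorph.injective
    rw [Homeomorph.apply_symm_apply, ho, hF.map_add_one, ← ho, Homeomorph.apply_symm_apply]
  · rw [Equiv.Perm.inv_def, Equiv.symm_apply_eq, hF.coe_apply, ← ho, Homeomorph.apply_symm_apply]

end IsLift

theorem deriv_comp_pos {F G : ℝ → ℝ} (hF : ∀ x, 0 < deriv F x) (hG : ∀ x, 0 < deriv G x) (x : ℝ) :
    deriv (F ∘ G) x = deriv F (G x) * deriv G x ∧ 0 < deriv (F ∘ G) x := by
  have h : deriv (F ∘ G) x = deriv F (G x) * deriv G x :=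
    deriv_comp x (differentiableAt_of_deriv_ne_zero (hF _).ne')
      (differentiableAt_of_deriv_ne_zero (hG _).ne')
  exact ⟨h, h ▸ mul_pos (hF _) (hG _)⟩

theorem deriv_homeomorph_symm (e : ℝ ≃ₜ ℝ) (he : ∀ x, 0 < deriv e x) (x : ℝ) :
    deriv e.symm x = (deriv e (e.symm x))⁻¹ :=
  (HasDerivAt.of_local_left_inverse e.symm.continuous.continuousAt
    (differentiableAt_of_deriv_ne_zero (he _).ne').hasDerivAt (he _).ne'
    (Eventually.of_forall e.apply_symm_apply)).deriv

/-! ### The groups `Diff₊ᵏ(𝕊¹)` with the uniform `Cᵏ` topology -/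

/-- The group of orientation-preserving `C^k` diffeomorphisms of the circle (`k ≥ 1`), under
composition. -/
def DiffCk (k : ℕ) : Subgroup (Equiv.Perm UnitAddCircle) where
  carrier := {f | ∃ F, IsLift F f ∧ ContDiff ℝ k F ∧ ∀ x, 0 < deriv F x}
  one_mem' := ⟨id, IsLift.one, contDiff_id, fun x => by simp⟩
  mul_mem' := by
    rintro f g ⟨F, hF, hFk, hF'⟩ ⟨G, hG, hGk, hG'⟩
    exact ⟨F ∘ G, hF.comp hG, hFk.comp hGk, fun x => (deriv_comp_pos hF' hG' x).2⟩
  inv_mem' := by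
    rintro f ⟨F, hF, hFk, hF'⟩
    obtain ⟨e, rfl, he⟩ := hF.exists_homeomorph (strictMono_of_deriv_pos hF')
    refine ⟨e.symm, he, e.contDiff_symm_deriv (fun x => (hF' x).ne')
      (fun x => (differentiableAt_of_deriv_ne_zero (hF' x).ne').hasDerivAt) hFk, fun x => ?_⟩
    rw [deriv_homeomorph_symm e hF']
    exact inv_pos.2 (hF' _)

/-- The uniform `C^k` metric:
`sup |f - g| + ∑_{1 ≤ j ≤ k} sup |f⁽ʲ⁾ - g⁽ʲ⁾|`. -/
noncomputable instance DiffCk.instPseudoEMetricSpace (k : ℕ) : PseudoEMetricSpace (DiffCk k) where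
  edist f g := (⨆ x : UnitAddCircle, edist (f.1 x) (g.1 x)) +
    ∑ j ∈ Finset.Icc 1 k, ⨆ x : ℝ,
      edist (iteratedDeriv j (circleLift f.1) x) (iteratedDeriv j (circleLift g.1) x)
  edist_self f := by simp
  edist_comm f g := by simp only [edist_comm]
  edist_triangle f g h := by
    have key : ∀ {ι X : Type} [PseudoEMetricSpace X] (u v w : ι → X),
        (⨆ x, edist (u x) (w x)) ≤ (⨆ x, edist (u x) (v x)) + ⨆ x, edist (v x) (w x) :=
      fun u v w => iSup_le fun x => (edist_triangle _ (v x) _).trans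
        (add_le_add (le_iSup (fun x => edist (u x) (v x)) x)
          (le_iSup (fun x => edist (v x) (w x)) x))
    rw [add_add_add_comm, ← Finset.sum_add_distrib]
    exact add_le_add (key _ _ _) (Finset.sum_le_sum fun j _ => key _ _ _)

/-! ### The group `Diff₊^{1+AC}(𝕊¹)` -/

theorem AbsolutelyContinuousOnInterval.comp_strictMono {h g : ℝ → ℝ}
    (hh : ∀ a b, AbsolutelyContinuousOnInterval h a b) (hg : ContDiff ℝ 1 g) (hm : StrictMono g)
    (a b : ℝ) : AbsolutelyContinuousOnInterval (h ∘ g) a b := by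
  obtain ⟨K, hK⟩ := hg.contDiffOn.exists_lipschitzOnWith (s := uIcc a b) (by decide)
    (convex_Icc _ _) isCompact_Icc
  rw [absolutelyContinuousOnInterval_iff]
  intro ε hε
  obtain ⟨δ, hδ, H⟩ := (absolutelyContinuousOnInterval_iff h (g a) (g b)).1 (hh _ _) ε hε
  refine ⟨δ / (K + 1), by positivity, fun ⟨n, I⟩ hI hs => ?_⟩
  refine H (n, fun i => (g (I i).1, g (I i).2)) ⟨fun i hi => ?_, fun i hi j hj hij => ?_⟩ ?_
  · have := hI.1 i hi
    exact ⟨hm.monotone.mapsTo_uIcc this.1, hm.monotone.mapsTo_uIcc this.2⟩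
  · have := hI.2 hi hj hij
    simp only [Function.onFun, uIoc, Set.Ioc_disjoint_Ioc] at this ⊢
    simpa only [← hm.monotone.map_min, ← hm.monotone.map_max, hm.le_iff_le] using this
  · calc ∑ i ∈ Finset.range n, dist (g (I i).1) (g (I i).2)
        ≤ ∑ i ∈ Finset.range n, K * dist (I i).1 (I i).2 :=
          Finset.sum_le_sum fun i hi => hK.dist_le_mul _ (hI.1 i hi).1 _ (hI.1 i hi).2
      _ = K * ∑ i ∈ Finset.range n, dist (I i).1 (I i).2 := (Finset.mul_sum _ _ _).symm
      _ ≤ K * (δ / (K + 1)) := by gcongr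
      _ < (K + 1) * (δ / (K + 1)) := by gcongr; linarith
      _ = δ := by field_simp

theorem AbsolutelyContinuousOnInterval.inv_of_pos {h : ℝ → ℝ} {a b : ℝ}
    (hh : AbsolutelyContinuousOnInterval h a b) (hp : ∀ x, 0 < h x) :
    AbsolutelyContinuousOnInterval (fun x => (h x)⁻¹) a b := by
  obtain ⟨C, hC⟩ := isCompact_uIcc.exists_bound_of_continuousOn
    (hh.continuousOn.inv₀ fun x _ => (hp x).ne')
  refine squeeze_zero' (Eventually.of_forall fun _ => Finset.sum_nonneg fun _ _ => dist_nonneg) ?_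
    (by simpa using Tendsto.const_mul (C * C) hh)
  rw [eventually_inf_principal]
  refine Eventually.of_forall fun ⟨n, I⟩ hI => ?_
  rw [Finset.mul_sum]
  refine Finset.sum_le_sum fun i hi => ?_
  have h1 := hC _ (hI.1 i hi).1
  have h2 := hC _ (hI.1 i hi).2
  simp only at h1 h2 ⊢
  rw [dist_inv_inv₀ (hp _).ne' (hp _).ne', div_eq_mul_inv, mul_inv, mul_comm, ← norm_inv,
    ← norm_inv]
  have := (norm_nonneg _).trans h1
  gcongr <;> assumption

/-- The group of orientation-preserving `C^1` diffeomorphisms of the circle whose first derivative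
is absolutely continuous, under composition. -/
def DiffAC : Subgroup (Equiv.Perm UnitAddCircle) where
  carrier := {f | ∃ F, IsLift F f ∧ ContDiff ℝ 1 F ∧ (∀ x, 0 < deriv F x) ∧
    ∀ a b, AbsolutelyContinuousOnInterval (deriv F) a b}
  one_mem' := ⟨id, IsLift.one, contDiff_id, fun x => by simp, fun a b => by
    simpa using! (LipschitzWith.const (1 : ℝ)).lipschitzOnWith.absolutelyContinuousOnInterval⟩
  mul_mem' := by
    rintro f g ⟨F, hF, hFk, hF', hFa⟩ ⟨G, hG, hGk, hG', hGa⟩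
    refine ⟨F ∘ G, hF.comp hG, hFk.comp hGk, fun x => (deriv_comp_pos hF' hG' x).2, fun a b => ?_⟩
    have : deriv (F ∘ G) = (deriv F ∘ G) * deriv G := funext fun x => (deriv_comp_pos hF' hG' x).1
    rw [this]
    exact (AbsolutelyContinuousOnInterval.comp_strictMono hFa hGk
      (strictMono_of_deriv_pos hG') a b).mul (hGa a b)
  inv_mem' := by
    rintro f ⟨F, hF, hFk, hF', hFa⟩
    obtain ⟨e, rfl, he⟩ := hF.exists_homeomorph (strictMono_of_deriv_pos hF')
    have hd : ∀ x, 0 < deriv e.symm x := fun x => by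
      rw [deriv_homeomorph_symm e hF']
      exact inv_pos.2 (hF' _)
    have hc : ContDiff ℝ 1 e.symm := e.contDiff_symm_deriv (fun x => (hF' x).ne')
      (fun x => (differentiableAt_of_deriv_ne_zero (hF' x).ne').hasDerivAt) hFk
    refine ⟨e.symm, he, hc, hd, fun a b => ?_⟩
    rw [show deriv e.symm = fun x => ((deriv e ∘ e.symm) x)⁻¹ from
      funext (deriv_homeomorph_symm e hF')]
    exact (AbsolutelyContinuousOnInterval.comp_strictMono hFa hc
      (strictMono_of_deriv_pos hd) a b).inv_of_pos fun x => hF' _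

/-- The metric `sup |f - g| + sup |f' - g'| + ∫ |f'' - g''|`, which defines the topology of
`Diff₊^{1+AC}(𝕊¹)`; here `f''` is the almost everywhere defined derivative of `f'`. -/
noncomputable instance DiffAC.instPseudoEMetricSpace : PseudoEMetricSpace DiffAC where
  edist f g := (⨆ x : UnitAddCircle, edist (f.1 x) (g.1 x)) +
    (⨆ x : ℝ, edist (deriv (circleLift f.1) x) (deriv (circleLift g.1) x)) +
    ∫⁻ x in Icc (0 : ℝ) 1,
      edist (deriv (deriv (circleLift f.1)) x) (deriv (deriv (circleLift g.1)) x)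
  edist_self f := by simp
  edist_comm f g := by simp only [edist_comm]
  edist_triangle f g h := by
    have key : ∀ {ι X : Type} [PseudoEMetricSpace X] (u v w : ι → X),
        (⨆ x, edist (u x) (w x)) ≤ (⨆ x, edist (u x) (v x)) + ⨆ x, edist (v x) (w x) :=
      fun u v w => iSup_le fun x => (edist_triangle _ (v x) _).trans
        (add_le_add (le_iSup (fun x => edist (u x) (v x)) x)
          (le_iSup (fun x => edist (v x) (w x)) x))
    rw [add_add_add_comm, add_add_add_comm (⨆ x : UnitAddCircle, edist (f.1 x) (g.1 x))]
    refine add_le_add (add_le_add (key _ _ _) (key _ _ _)) ?_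
    rw [← lintegral_add_left ((measurable_deriv _).edist (measurable_deriv _))]
    exact lintegral_mono fun x => edist_triangle _ _ _

/-! ### Maximal pseudometrics and distortion -/

section Distortion

variable {G : Type*} [Group G] [TopologicalSpace G]

/-- A continuous right-invariant pseudometric on a topological group. -/
structure IsContRightInv (d : PseudoMetric G ℝ) : Prop where
  continuous : Continuous fun p : G × G => d p.1 p.2
  right_inv : ∀ x y z, d (x * z) (y * z) = d x y

/-- A pseudometric on a topological group is maximal if it is continuous, right-invariant, and
dominates, up to multiplicative and additive constants, every continuous right-invariant
pseudometric. -/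
structure IsMaximalPseudometric (d : PseudoMetric G ℝ) : Prop extends IsContRightInv d where
  maximal : ∀ ρ : PseudoMetric G ℝ, IsContRightInv ρ → ∃ K C : ℝ, ∀ x y, ρ x y ≤ K * d x y + C

/-- `f` is not torsion and the inclusion of `⟨f⟩` into `G` is a quasi-isometric embedding, for the
word metric `(f ^ m, f ^ n) ↦ |m - n|` on `⟨f⟩` and a maximal pseudometric on `G`. Any two maximal
pseudometrics are quasi-isometric, so it does not matter which one is used. Torsion elements count
as distorted. -/
def IsUndistorted (f : G) : Prop :=
  ¬ IsOfFinOrder f ∧ ∃ d : PseudoMetric G ℝ, IsMaximalPseudometric d ∧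
    ∃ A B : ℝ, 0 < A ∧ ∀ m n : ℤ,
      A⁻¹ * |(m : ℝ) - n| - B ≤ d (f ^ m) (f ^ n) ∧ d (f ^ m) (f ^ n) ≤ A * |(m : ℝ) - n| + B

end Distortion

/-- `F`, restricted to an interval `[a, b]` that it maps diffeomorphically onto itself, has positive
asymptotic distortion: `lim (1/n) V(log (Fⁿ)'; [a, b])` exists and is positive, where `V` is the
total variation. -/
def HasPosAsymptoticDistortion (F : ℝ → ℝ) (a b : ℝ) : Prop :=
  ∃ L : ℝ, 0 < L ∧ Tendsto
    (fun n : ℕ => (eVariationOn (fun x => Real.log (deriv (F^[n]) x)) (Icc a b)).toReal / n)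
    atTop (𝓝 L)

open scoped Pointwise ENNReal

/-! ### Length functions and maximal pseudometrics -/

/-! The chain rule `log (f ∘ g)' = log f' ∘ g + log g'` and the invariance of total variation under
reparametrisation make `logVar f = V(log f')` symmetric and subadditive. Hence `logVar (f g⁻¹)`,
which equals `V(log f' - log g')`, is a right-invariant pseudometric; it is continuous on `DiffAC`,
and on `DiffCk k` for `k ≥ 2` through the continuous inclusion. Any maximal pseudometric dominates
it, so linear growth of `logVar (fⁿ)` gives undistortedness (`IsMaximalPseudometric.isUndistorted`).
With Fekete's lemma, the same growth gives positive asymptotic distortion.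

Two things remain: maximal pseudometrics must exist, and one analytic map with linear growth is
needed.

Existence. By `exists_isMaximalPseudometric` it suffices to find a cost function such that products
of small total cost lie in a bounded power of every neighbourhood of `1`. Boundedness comes from the
path `x + t (F x - x)`: its increments are uniformly close to the identity as soon as `F` is
controlled. In `DiffAC` the cost is `logVar` itself. In `DiffCk k` it is a multiple of the truncated
distance to `1`, symmetrised; composing on the right with a map `δ`-close to the identity multiplies
derivative bounds by at most `1 + C δ`, so a chain multiplies them by at most the exponential of its
cost.

Linear growth. Let `F` move every point of `(0, 1)` to the right, and let `ψ = log F'` be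
`M`-Lipschitz, so that `log (Fⁿ)'` is a Birkhoff sum of `ψ`. Along the orbits of two points of one
fundamental domain `[b, F b]` the distortion telescopes: after `Fᵐ b` it is at most `M (1 - Fᵐ b)`,
and before `b` at most `M b`. If the distortion between times `0` and `m` exceeds the sum of these,
the excess survives in every longer segment, so `log (Fⁿ)'` oscillates by a fixed amount on each of
`n - m` consecutive fundamental domains (`IsLift.exists_mul_sub_le_logVar_pow`).

To produce an excess, compare two maps that agree outside part of one fundamental domain and also at
one point `y` inside, where their derivatives differ. Corresponding orbits through `y` coincide, but
their distortions differ by a fixed `κ > 0`, so one of the maps has distortion at least `κ / 2`;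
starting far back makes the error terms smaller (`exists_gap`). The excess is a strict inequality
about finitely many iterates, so it survives polynomial approximation inside the family `x + ε R(cos
2πx)`. This gives analyticity; the double zero of `R` at `1` gives the parabolic fixed point, and
small `ε` gives the smallness. -/

theorem PseudoMetric.apply_nonneg {X : Type*} (ρ : PseudoMetric X ℝ) (x y : X) : 0 ≤ ρ x y := by
  have := ρ.triangle x y x
  rw [ρ.refl, ρ.symm y] at this
  linarith

section Length

variable {G : Type*} [Group G]

/-- A symmetric subadditive function on a group, vanishing at `1`. -/
structure IsLength (ℓ : G → ℝ) : Prop where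
  one : ℓ 1 = 0
  inv : ∀ g, ℓ g⁻¹ = ℓ g
  mul_le : ∀ g h, ℓ (g * h) ≤ ℓ g + ℓ h

namespace IsLength

variable {ℓ : G → ℝ}

theorem nonneg (h : IsLength ℓ) (g : G) : 0 ≤ ℓ g := by
  have := h.mul_le g g⁻¹
  rw [mul_inv_cancel, h.one, h.inv] at this
  linarith

/-- The right-invariant pseudometric of a length function. -/
def pseudoMetric (h : IsLength ℓ) : PseudoMetric G ℝ where
  toFun x y := ℓ (x * y⁻¹)
  refl' x := by simp [h.one]
  symm' x y := by rw [← h.inv]; simp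
  triangle' x y z := by simpa using h.mul_le (x * y⁻¹) (y * z⁻¹)

theorem pseudoMetric_apply (h : IsLength ℓ) (x y : G) : h.pseudoMetric x y = ℓ (x * y⁻¹) := rfl

/-- No compatibility of the topology with the group law is assumed. Smallness of `ℓ (g * g₀⁻¹)` near
each `g₀` suffices, by the triangle inequality in both variables. -/
theorem isContRightInv [TopologicalSpace G] (h : IsLength ℓ)
    (hc : ∀ g₀, Tendsto (fun g => ℓ (g * g₀⁻¹)) (𝓝 g₀) (𝓝 0)) :
    IsContRightInv h.pseudoMetric where
  right_inv x y z := by simp [pseudoMetric_apply]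
  continuous := by
    rw [continuous_iff_continuousAt]
    rintro ⟨x₀, y₀⟩
    have hx : Tendsto (fun p : G × G => h.pseudoMetric p.1 x₀) (𝓝 (x₀, y₀)) (𝓝 0) :=
      (hc x₀).comp continuous_fst.continuousAt
    have hy : Tendsto (fun p : G × G => h.pseudoMetric p.2 y₀) (𝓝 (x₀, y₀)) (𝓝 0) :=
      (hc y₀).comp continuous_snd.continuousAt
    have hxy := hx.add hy
    rw [add_zero] at hxy
    refine tendsto_iff_dist_tendsto_zero.2 (squeeze_zero (fun _ => dist_nonneg) (fun p => ?_) hxy)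
    rw [Real.dist_eq, abs_sub_le_iff]
    constructor
    · have h1 := h.pseudoMetric.triangle p.1 x₀ p.2
      have h2 := h.pseudoMetric.triangle x₀ y₀ p.2
      rw [h.pseudoMetric.symm y₀] at h2
      linarith
    · have h1 := h.pseudoMetric.triangle x₀ p.1 y₀
      have h2 := h.pseudoMetric.triangle p.1 p.2 y₀
      rw [h.pseudoMetric.symm x₀ p.1] at h1
      linarith

end IsLength

namespace IsContRightInv

variable [TopologicalSpace G] {ρ : PseudoMetric G ℝ}

theorem mul_le (h : IsContRightInv ρ) (g k : G) : ρ (g * k) 1 ≤ ρ g 1 + ρ k 1 := by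
  have := ρ.triangle (g * k) (1 * k) 1
  rwa [h.right_inv, one_mul] at this

theorem inv (h : IsContRightInv ρ) (g : G) : ρ g⁻¹ 1 = ρ g 1 := by
  rw [← h.right_inv _ _ g, ρ.symm]
  simp

theorem apply_eq (h : IsContRightInv ρ) (x y : G) : ρ x y = ρ (x * y⁻¹) 1 := by
  rw [← h.right_inv x y y⁻¹, mul_inv_cancel]

theorem pow_le (h : IsContRightInv ρ) (g : G) (n : ℕ) : ρ (g ^ n) 1 ≤ n * ρ g 1 := by
  induction n with
  | zero => simp
  | succ n ih =>
    rw [pow_succ]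
    push_cast
    linarith [h.mul_le (g ^ n) g]

theorem ball_mem_nhds_one (h : IsContRightInv ρ) {r : ℝ} (hr : 0 < r) :
    {g | ρ g 1 < r} ∈ 𝓝 (1 : G) := by
  have hc : Continuous fun g : G => ρ g 1 :=
    h.continuous.comp (by fun_prop : Continuous fun g : G => (g, (1 : G)))
  exact hc.continuousAt.eventually_lt_const (by simpa using hr)

theorem le_of_mem_pow (h : IsContRightInv ρ) {n : ℕ} {g : G} (hg : g ∈ {g : G | ρ g 1 < 1} ^ n) :
    ρ g 1 ≤ n := by
  induction n generalizing g with
  | zero =>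
    rw [pow_zero, Set.mem_one] at hg
    simp [hg]
  | succ n ih =>
    rw [pow_succ] at hg
    obtain ⟨a, ha, b, hb, rfl⟩ := hg
    have hb' : ρ b 1 < 1 := hb
    push_cast
    linarith [h.mul_le a b, ih ha]

theorem zpow_eq (h : IsContRightInv ρ) (f : G) (m n : ℤ) :
    ρ (f ^ m) (f ^ n) = ρ (f ^ (m - n).natAbs) 1 := by
  rw [h.apply_eq, ← zpow_sub]
  rcases Int.natAbs_eq (m - n) with e | e
  · conv_lhs => rw [e]
    rw [zpow_natCast]
  · conv_lhs => rw [e]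
    rw [zpow_neg, zpow_natCast, h.inv]

end IsContRightInv

/-- An element along which some continuous right-invariant pseudometric grows linearly is
undistorted. -/
theorem IsMaximalPseudometric.isUndistorted [TopologicalSpace G] {d ρ : PseudoMetric G ℝ}
    (hd : IsMaximalPseudometric d) (hρ : IsContRightInv ρ) {f : G} {c C : ℝ} (hc : 0 < c)
    (hf : ∀ n : ℕ, c * n - C ≤ ρ (f ^ n) 1) : IsUndistorted f := by
  constructor
  · rw [isOfFinOrder_iff_pow_eq_one]
    rintro ⟨n, hn, h⟩
    -- If `f ^ n = 1`, then `ρ` vanishes at every `f ^ (n * k)`, against linear growth.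
    obtain ⟨k, hk⟩ := exists_nat_gt (C / c)
    have h1 := hf (n * k)
    rw [pow_mul, h, one_pow, ρ.refl] at h1
    rw [div_lt_iff₀ hc] at hk
    have : (1 : ℝ) ≤ n := by exact_mod_cast hn
    push_cast at h1
    have : c * k ≤ c * (n * k) := by
      have : (k : ℝ) ≤ n * k := by nlinarith [(Nat.cast_nonneg k : (0 : ℝ) ≤ k)]
      gcongr
    linarith
  · obtain ⟨K, B, hKB⟩ := hd.maximal ρ hρ
    -- One constant plays two roles: it is at least the upper slope `d f 1`, and its inverse is at
    -- most the lower slope `c / (|K| + 1)`. The `|K| + 1` covers a non-positive `K`.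
    refine ⟨d, hd, d f 1 + (|K| + 1) / c, (C + |B|) / (|K| + 1) + |C|, ?_, fun m n => ?_⟩
    · have := d.apply_nonneg f 1
      positivity
    · have habs : |(m : ℝ) - n| = ((m - n).natAbs : ℕ) := by
        rw [Nat.cast_natAbs]; push_cast; rfl
      rw [habs, hd.toIsContRightInv.zpow_eq]
      set N := (m - n).natAbs
      have hK : 0 < |K| + 1 := by positivity
      have hN : (0 : ℝ) ≤ N := Nat.cast_nonneg _
      have hd0 := d.apply_nonneg f 1
      have hdN := d.apply_nonneg (f ^ N) 1
      constructor
      · have h1 := hKB (f ^ N) 1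
        have h2 := hf N
        have h3 : c * N ≤ (|K| + 1) * d (f ^ N) 1 + (C + |B|) := by
          have : K * d (f ^ N) 1 ≤ (|K| + 1) * d (f ^ N) 1 := by
            gcongr; linarith [le_abs_self K]
          linarith [le_abs_self B]
        have h4 : (d f 1 + (|K| + 1) / c)⁻¹ * N ≤ ((|K| + 1) / c)⁻¹ * N := by
          gcongr; linarith
        have h5 : ((|K| + 1) / c)⁻¹ * N ≤ d (f ^ N) 1 + (C + |B|) / (|K| + 1) := by
          rw [inv_div, div_mul_eq_mul_div, div_le_iff₀ hK, add_mul, div_mul_cancel₀ _ hK.ne']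
          linarith
        linarith [abs_nonneg C]
      · have h1 := hd.toIsContRightInv.pow_le f N
        have h2 : 0 ≤ (|K| + 1) / c * N := by positivity
        have h3 : 0 ≤ (C + |B|) / (|K| + 1) + |C| := by
          have : -|C| ≤ (C + |B|) / (|K| + 1) := by
            rw [le_div_iff₀ hK]
            nlinarith [neg_abs_le C, abs_nonneg B, abs_nonneg C, abs_nonneg K,
              mul_nonneg (abs_nonneg C) (abs_nonneg K)]
          linarith
        linarith

/-- `CostChain w g s`: `g` is a product of elements of cost less than `1`, of total cost `s`. -/
inductive CostChain (w : G → ℝ) : G → ℝ → Prop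
  | one : CostChain w 1 0
  | mul {g h : G} {s : ℝ} : CostChain w g s → w h < 1 → CostChain w (g * h) (s + w h)

namespace CostChain

variable {w : G → ℝ}

theorem nonneg (hw : ∀ g, 0 ≤ w g) {g : G} {s : ℝ} (h : CostChain w g s) : 0 ≤ s := by
  induction h with
  | one => rfl
  | mul _ _ ih => exact add_nonneg ih (hw _)

theorem single {h : G} (hh : w h < 1) : CostChain w h (w h) := by
  simpa using CostChain.one.mul hh

theorem append {g g' : G} {s s' : ℝ} (h : CostChain w g s) (h' : CostChain w g' s') :
    CostChain w (g * g') (s + s') := by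
  induction h' with
  | one => simpa using h
  | mul _ hh ih =>
    rw [← mul_assoc, ← add_assoc]
    exact ih.mul hh

theorem inv (hwi : ∀ g, w g⁻¹ = w g) {g : G} {s : ℝ} (h : CostChain w g s) :
    CostChain w g⁻¹ s := by
  induction h with
  | one => simpa using CostChain.one
  | @mul g h s _ hh ih =>
    rw [mul_inv_rev, add_comm, ← hwi h]
    exact (single (by rwa [hwi])).append ih

theorem exists_of_mem_pow {n : ℕ} {g : G} (hg : g ∈ {g : G | w g < 1} ^ n) :
    ∃ s, CostChain w g s := by
  induction n generalizing g with
  | zero =>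
    rw [pow_zero, Set.mem_one] at hg
    exact ⟨0, hg ▸ .one⟩
  | succ n ih =>
    rw [pow_succ] at hg
    obtain ⟨a, ha, b, hb, rfl⟩ := hg
    obtain ⟨s, hs⟩ := ih ha
    exact ⟨_, hs.mul hb⟩

/-- A pseudometric bounded by `B` on products of total cost less than `1` is controlled by the
total cost. -/
theorem le_mul_add [TopologicalSpace G] (hw : ∀ g, 0 ≤ w g) {ρ : PseudoMetric G ℝ}
    (hρ : IsContRightInv ρ) {B : ℝ} (hB : ∀ g s, CostChain w g s → s < 1 → ρ g 1 ≤ B)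
    {g : G} {s : ℝ} (h : CostChain w g s) : ρ g 1 ≤ 2 * B * s + B := by
  have hB0 : 0 ≤ B := by simpa using hB 1 0 .one one_pos
  -- Greedy grouping: `p` is the product of the closed blocks and `q` the open block, of cost `s' <
  -- 1`. A block is closed when the next factor brings its cost to at least `1`; block and factor
  -- each have `ρ ≤ B`, and this `2 * B` is paid for by that cost.
  suffices ∃ p q s', g = p * q ∧ CostChain w q s' ∧ s' < 1 ∧ ρ p 1 ≤ 2 * B * (s - s') by
    obtain ⟨p, q, s', rfl, hq, hs', hp⟩ := this
    have h1 := hρ.mul_le p q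
    have h2 := hB q s' hq hs'
    have h3 := hq.nonneg hw
    nlinarith [mul_nonneg hB0 h3]
  induction h with
  | one => exact ⟨1, 1, 0, by simp, .one, one_pos, by simp⟩
  | @mul g h s _ hh ih =>
    obtain ⟨p, q, s', rfl, hq, hs', hp⟩ := ih
    by_cases hs : s' + w h < 1
    · exact ⟨p, q * h, s' + w h, mul_assoc _ _ _, hq.mul hh, hs, by linarith⟩
    · refine ⟨p * (q * h), 1, 0, by simp [mul_assoc], .one, one_pos, ?_⟩
      have h1 := hρ.mul_le p (q * h)
      have h2 := hρ.mul_le q h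
      have h3 := hB q s' hq hs'
      have h4 := hB h _ (single hh) hh
      push Not at hs
      nlinarith [mul_nonneg hB0 (sub_nonneg.2 hs)]

end CostChain

/-- A group has a maximal pseudometric as soon as it is generated by each neighbourhood of `1`,
and products of small total cost are coarsely bounded, for a cost function vanishing at `1`. -/
theorem exists_isMaximalPseudometric [TopologicalSpace G] (w : G → ℝ) (hw : ∀ g, 0 ≤ w g)
    (hwi : ∀ g, w g⁻¹ = w g)
    (hwc : ∀ g₀, Tendsto (fun g => w (g * g₀⁻¹)) (𝓝 g₀) (𝓝 0))
    (hgen : ∀ W ∈ 𝓝 (1 : G), ∀ g, ∃ n : ℕ, g ∈ W ^ n)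
    (hbdd : ∀ W ∈ 𝓝 (1 : G), ∃ n : ℕ, ∀ g s, CostChain w g s → s < 1 → g ∈ W ^ n) :
    ∃ d : PseudoMetric G ℝ, IsMaximalPseudometric d := by
  have hW : {g | w g < 1} ∈ 𝓝 (1 : G) := by
    have := hwc 1
    simp only [inv_one, mul_one] at this
    exact this.eventually_lt_const one_pos
  have hne : ∀ g, {s | CostChain w g s}.Nonempty := fun g =>
    CostChain.exists_of_mem_pow (hgen _ hW g).choose_spec
  have hbb : ∀ g, BddBelow {s | CostChain w g s} := fun g => ⟨0, fun s hs => hs.nonneg hw⟩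
  set ℓ : G → ℝ := fun g => sInf {s | CostChain w g s} with hℓ
  have hℓ0 : ∀ g, 0 ≤ ℓ g := fun g => le_csInf (hne g) fun s hs => hs.nonneg hw
  have hlen : IsLength ℓ := by
    refine ⟨le_antisymm (csInf_le (hbb 1) .one) (hℓ0 1), fun g => ?_, fun g h => ?_⟩
    · simp only [hℓ]
      congr 1
      ext s
      exact ⟨fun h => by simpa using h.inv hwi, fun h => h.inv hwi⟩
    · rw [← sub_le_iff_le_add]
      refine le_csInf (hne g) fun s hs => ?_
      rw [sub_le_comm]
      refine le_csInf (hne h) fun s' hs' => ?_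
      have := csInf_le (hbb _) (show s + s' ∈ {t | CostChain w (g * h) t} from hs.append hs')
      simp only [hℓ]
      linarith
  have hcont : IsContRightInv hlen.pseudoMetric := by
    refine hlen.isContRightInv fun g₀ => ?_
    refine tendsto_of_tendsto_of_tendsto_of_le_of_le' tendsto_const_nhds (hwc g₀)
      (Eventually.of_forall fun g => hℓ0 _) ?_
    -- Near `g₀` the increment is a chain with one factor, so `ℓ` is squeezed by `w`.
    filter_upwards [(hwc g₀).eventually_lt_const one_pos] with g hg
    exact csInf_le (hbb _) (CostChain.single hg)
  refine ⟨hlen.pseudoMetric, hcont, fun ρ hρ => ?_⟩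
  obtain ⟨n, hn⟩ := hbdd _ (hρ.ball_mem_nhds_one one_pos)
  refine ⟨2 * n, n, fun x y => ?_⟩
  rw [hρ.apply_eq, hlen.pseudoMetric_apply]
  have key : ∀ s, CostChain w (x * y⁻¹) s → ρ (x * y⁻¹) 1 ≤ 2 * n * s + n := fun s hs =>
    hs.le_mul_add hw hρ fun g s hg h1 => hρ.le_of_mem_pow (hn g s hg h1)
  -- The bound is divided by `2 * n` before passing to the infimum over chains, so `n = 0` is
  -- treated apart.
  rcases Nat.eq_zero_or_pos n with rfl | hn0
  · obtain ⟨s, hs⟩ := hne (x * y⁻¹)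
    simpa using key s hs
  · have hn1 : (0 : ℝ) < 2 * n := by positivity
    have : (ρ (x * y⁻¹) 1 - n) / (2 * n) ≤ ℓ (x * y⁻¹) :=
      le_csInf (hne _) fun s hs => by
        rw [div_le_iff₀ hn1]
        linarith [key s hs]
    rw [div_le_iff₀ hn1] at this
    linarith

end Length

/-! ### Total variation -/

section Variation

/-- Variation bounds for sums, products and Lipschitz images all come from summing one inequality
between increments over a partition. -/
theorem eVariationOn.le_mul_add_mul {f g h : ℝ → ℝ} {s : Set ℝ} {A B : ℝ≥0∞}
    (H : ∀ x ∈ s, ∀ y ∈ s, edist (h x) (h y) ≤ A * edist (f x) (f y) + B * edist (g x) (g y)) :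
    eVariationOn h s ≤ A * eVariationOn f s + B * eVariationOn g s := by
  refine iSup_le fun p => ?_
  calc ∑ i ∈ Finset.range p.1, edist (h (p.2.1 (i + 1))) (h (p.2.1 i))
      ≤ ∑ i ∈ Finset.range p.1, (A * edist (f (p.2.1 (i + 1))) (f (p.2.1 i)) +
          B * edist (g (p.2.1 (i + 1))) (g (p.2.1 i))) :=
        Finset.sum_le_sum fun i _ => H _ (p.2.2.2 _) _ (p.2.2.2 _)
    _ = A * ∑ i ∈ Finset.range p.1, edist (f (p.2.1 (i + 1))) (f (p.2.1 i)) +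
          B * ∑ i ∈ Finset.range p.1, edist (g (p.2.1 (i + 1))) (g (p.2.1 i)) := by
        rw [Finset.sum_add_distrib, Finset.mul_sum, Finset.mul_sum]
    _ ≤ _ := by
        gcongr
        · exact eVariationOn.sum_le p.2.2.1 p.2.2.2
        · exact eVariationOn.sum_le p.2.2.1 p.2.2.2

theorem eVariationOn.le_mul_of_edist_le {f h : ℝ → ℝ} {s : Set ℝ} {A : ℝ≥0∞}
    (H : ∀ x ∈ s, ∀ y ∈ s, edist (h x) (h y) ≤ A * edist (f x) (f y)) :
    eVariationOn h s ≤ A * eVariationOn f s := by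
  simpa using eVariationOn.le_mul_add_mul (g := f) (B := 0) (by simpa using H)

theorem eVariationOn.add_le (f g : ℝ → ℝ) (s : Set ℝ) :
    eVariationOn (fun x => f x + g x) s ≤ eVariationOn f s + eVariationOn g s := by
  simpa using eVariationOn.le_mul_add_mul (h := fun x => f x + g x) (f := f) (g := g) (s := s)
    (A := 1) (B := 1) fun x _ y _ => by simpa using edist_add_add_le _ _ _ _

theorem eVariationOn.neg_eq (f : ℝ → ℝ) (s : Set ℝ) :
    eVariationOn (fun x => -f x) s = eVariationOn f s := by
  simp only [eVariationOn, edist_neg_neg]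

theorem eVariationOn.mul_le {f g : ℝ → ℝ} {s : Set ℝ} {A B : ℝ} (hf : ∀ x ∈ s, |f x| ≤ A)
    (hg : ∀ x ∈ s, |g x| ≤ B) :
    eVariationOn (fun x => f x * g x) s ≤
      ENNReal.ofReal B * eVariationOn f s + ENNReal.ofReal A * eVariationOn g s := by
  refine eVariationOn.le_mul_add_mul fun x hx y hy => ?_
  have hA : 0 ≤ A := (abs_nonneg _).trans (hf x hx)
  have hB : 0 ≤ B := (abs_nonneg _).trans (hg x hx)
  simp only [edist_dist, Real.dist_eq]
  rw [← ENNReal.ofReal_mul hB, ← ENNReal.ofReal_mul hA, ← ENNReal.ofReal_add (by positivity)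
    (by positivity)]
  refine ENNReal.ofReal_le_ofReal ?_
  calc |f x * g x - f y * g y| = |g x * (f x - f y) + f y * (g x - g y)| := by congr 1; ring
    _ ≤ |g x| * |f x - f y| + |f y| * |g x - g y| := by
      simpa only [abs_mul] using abs_add_le (g x * (f x - f y)) (f y * (g x - g y))
    _ ≤ _ := by gcongr; exacts [hg x hx, hf y hy]

theorem eVariationOn.image_strictMono (g : ℝ → ℝ) {G : ℝ → ℝ} (hc : Continuous G)
    (hm : StrictMono G) {a b : ℝ} (hab : a ≤ b) :
    eVariationOn (g ∘ G) (Icc a b) = eVariationOn g (Icc (G a) (G b)) := by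
  rw [eVariationOn.comp_eq_of_monotoneOn g G (hm.monotone.monotoneOn _)]
  congr 1
  refine Subset.antisymm ?_ (intermediate_value_Icc hab hc.continuousOn)
  rintro _ ⟨x, hx, rfl⟩
  exact ⟨hm.monotone hx.1, hm.monotone hx.2⟩

/-- After an integer translation the period is `[r, r + 1]` with `0 ≤ r ≤ 1`; it is cut at `1`, and
the part beyond `1` is moved back to `[0, r]`. -/
theorem Function.Periodic.eVariationOn_Icc {g : ℝ → ℝ} (hg : Function.Periodic g 1) (a : ℝ) :
    eVariationOn g (Icc a (a + 1)) = eVariationOn g (Icc 0 1) := by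
  have shift : ∀ (n : ℤ) (x y : ℝ), x ≤ y →
      eVariationOn g (Icc (x + n) (y + n)) = eVariationOn g (Icc x y) := fun n x y hxy => by
    rw [← eVariationOn.image_strictMono g (G := fun x => x + n) (by fun_prop)
      (fun x y h => by simpa using h) hxy]
    congr 1
    funext x
    simpa using hg.int_mul n x
  have h1 := shift ⌊a⌋ (Int.fract a) (Int.fract a + 1) (by linarith)
  rw [show Int.fract a + 1 + (⌊a⌋ : ℝ) = Int.fract a + ⌊a⌋ + 1 by ring,
    Int.fract_add_floor] at h1
  rw [h1]
  have h0 := Int.fract_nonneg a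
  have h2 := (Int.fract_lt_one a).le
  have e1 := eVariationOn.Icc_add_Icc g (s := univ) h0 h2 (mem_univ _)
  have e2 := eVariationOn.Icc_add_Icc g (s := univ) h2
    (show (1 : ℝ) ≤ Int.fract a + 1 by linarith) (mem_univ _)
  simp only [univ_inter] at e1 e2
  have h3 := shift 1 0 (Int.fract a) h0
  simp only [Int.cast_one, zero_add] at h3
  rw [← e2, h3, add_comm, e1]

theorem Function.Periodic.eVariationOn_comp {g G : ℝ → ℝ} (hg : Function.Periodic g 1)
    (hc : Continuous G) (hm : StrictMono G) (h1 : ∀ x, G (x + 1) = G x + 1) :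
    eVariationOn (fun x => g (G x)) (Icc 0 1) = eVariationOn g (Icc 0 1) := by
  have := eVariationOn.image_strictMono g hc hm zero_le_one
  rw [show G 1 = G 0 + 1 by simpa using h1 0, hg.eVariationOn_Icc] at this
  exact this

/-- By the fundamental theorem of calculus, increments of `f` are dominated by those of the monotone
function `x ↦ ∫ₐˣ |f'|`. -/
theorem AbsolutelyContinuousOnInterval.eVariationOn_le {f : ℝ → ℝ} {a b : ℝ} (hab : a ≤ b)
    (hf : AbsolutelyContinuousOnInterval f a b) :
    eVariationOn f (Icc a b) ≤ ∫⁻ x in Icc a b, ‖deriv f x‖ₑ := by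
  have hint := hf.intervalIntegrable_deriv
  set φ : ℝ → ℝ := fun x => ∫ t in a..x, ‖deriv f t‖ with hφ
  have hsub : ∀ x ∈ Icc a b, ∀ y ∈ Icc a b, IntervalIntegrable (deriv f) volume x y := by
    intro x hx y hy
    refine hint.mono_set ?_
    rw [uIcc_of_le hab]
    exact uIcc_subset_Icc hx hy
  have ha : a ∈ Icc a b := left_mem_Icc.2 hab
  have hdiff : ∀ x ∈ Icc a b, ∀ y ∈ Icc a b, φ y - φ x = ∫ t in x..y, ‖deriv f t‖ := by
    intro x hx y hy
    exact intervalIntegral.integral_interval_sub_left (hsub a ha y hy).norm (hsub a ha x hx).norm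
  have hle : ∀ x ∈ Icc a b, ∀ y ∈ Icc a b, x ≤ y → |f y - f x| ≤ φ y - φ x := by
    intro x hx y hy hxy
    have hsub' : uIcc x y ⊆ uIcc a b := by
      rw [uIcc_of_le hab]
      exact uIcc_subset_Icc hx hy
    rw [hdiff x hx y hy, ← AbsolutelyContinuousOnInterval.integral_deriv_eq_sub
      (AbsolutelyContinuousOnInterval.mono hf hsub')]
    exact intervalIntegral.norm_integral_le_integral_norm (f := deriv f) hxy
  have hmono : MonotoneOn φ (Icc a b) := fun x hx y hy hxy => by
    have := (abs_nonneg _).trans (hle x hx y hy hxy)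
    linarith
  have h1 : eVariationOn f (Icc a b) ≤ 1 * eVariationOn φ (Icc a b) := by
    refine eVariationOn.le_mul_of_edist_le fun x hx y hy => ?_
    rw [one_mul, edist_dist, edist_dist, Real.dist_eq, Real.dist_eq]
    refine ENNReal.ofReal_le_ofReal ?_
    rcases le_total x y with h | h
    · rw [abs_sub_comm, abs_sub_comm (φ x)]
      exact (hle x hx y hy h).trans (le_abs_self _)
    · exact (hle y hy x hx h).trans (le_abs_self _)
  have h2 := hmono.eVariationOn_eq ha (right_mem_Icc.2 hab)
  rw [inter_self, hdiff a ha b (right_mem_Icc.2 hab), intervalIntegral.integral_of_le hab] at h2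
  rw [one_mul] at h1
  refine h1.trans (h2.trans_le ?_)
  rw [ofReal_integral_norm_eq_lintegral_enorm ((intervalIntegrable_iff_integrableOn_Ioc_of_le
    hab).1 hint)]
  exact lintegral_mono_set Ioc_subset_Icc_self

/-- Almost everywhere `|f'|` is at most the derivative of the variation function, and by Fatou the
derivative of a monotone function integrates to at most its increment. This turns variation bounds
into bounds for the integral term of the `DiffAC` metric. -/
theorem AbsolutelyContinuousOnInterval.lintegral_enorm_deriv_le {f : ℝ → ℝ} {a b : ℝ}
    (hab : a ≤ b) (hf : AbsolutelyContinuousOnInterval f a b) :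
    ∫⁻ x in Icc a b, ‖deriv f x‖ₑ ≤ eVariationOn f (Icc a b) := by
  have hbv : BoundedVariationOn f (Icc a b) := by
    simpa [uIcc_of_le hab] using hf.boundedVariationOn
  have hl := hbv.locallyBoundedVariationOn
  have ha : a ∈ Icc a b := left_mem_Icc.2 hab
  set φ := variationOnFromTo f (Icc a b) a
  have hmono : MonotoneOn φ (Icc a b) := variationOnFromTo.monotoneOn hl ha
  have hle : ∀ x ∈ Icc a b, ∀ y ∈ Icc a b, |f y - f x| ≤ |φ y - φ x| := by
    intro x hx y hy
    rcases le_total x y with h | h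
    · exact (variationOnFromTo.abs_sub_le_sub_of_le hl ha hx hy h).trans (le_abs_self _)
    · rw [abs_sub_comm, abs_sub_comm (φ y)]
      exact (variationOnFromTo.abs_sub_le_sub_of_le hl ha hy hx h).trans (le_abs_self _)
  have hφval : ENNReal.ofReal (φ b - φ a) = eVariationOn f (Icc a b) := by
    simp only [φ, variationOnFromTo.self, sub_zero, variationOnFromTo.eq_of_le _ _ hab, inter_self]
    exact ENNReal.ofReal_toReal hbv
  obtain ⟨D, hD, hDm, hDl⟩ := hmono.exists_tendsto_deriv_liminf_lintegral_enorm_le hab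
  have hae : ∀ᵐ x ∂volume.restrict (Ioo a b), ‖deriv f x‖ₑ ≤ ‖deriv φ x‖ₑ := by
    rw [ae_restrict_iff' measurableSet_Ioo]
    filter_upwards [hf.ae_differentiableAt, hmono.ae_differentiableWithinAt_of_mem] with x h1 h2 hx
    have hxm : x ∈ Icc a b := Ioo_subset_Icc_self hx
    have h1 := (h1 (by rwa [uIcc_of_le hab])).hasDerivAt
    have h2 := ((h2 hxm).differentiableAt (Icc_mem_nhds hx.1 hx.2)).hasDerivAt
    have h1 := h1.tendsto_slope.norm
    have h2 := h2.tendsto_slope.norm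
    rw [enorm_le_iff_norm_le]
    refine le_of_tendsto_of_tendsto h1 h2 ?_
    filter_upwards [nhdsWithin_le_nhds (Icc_mem_nhds hx.1 hx.2)] with y hy
    rw [slope_def_field, slope_def_field, norm_div, norm_div]
    gcongr
    exact hle x hxm y hy
  calc ∫⁻ x in Icc a b, ‖deriv f x‖ₑ = ∫⁻ x in Ioo a b, ‖deriv f x‖ₑ := by
        rw [restrict_Ioo_eq_restrict_Icc]
    _ ≤ ∫⁻ x in Ioo a b, ‖deriv φ x‖ₑ := lintegral_mono_ae hae
    _ = ∫⁻ x in Icc a b, ‖deriv φ x‖ₑ := by rw [restrict_Ioo_eq_restrict_Icc]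
    _ ≤ eVariationOn f (Icc a b) :=
        (lintegral_enorm_le_liminf_of_tendsto hD fun n => (hDm n).aemeasurable.enorm).trans (hDl.trans_eq hφval)

end Variation

/-! ### Lifts -/

namespace IsLift

variable {F G : ℝ → ℝ} {f g : Equiv.Perm UnitAddCircle}

/-- The difference of the two lifts is continuous and integer-valued on a connected space. -/
theorem exists_eq_add_int (hF : IsLift F f) (hG : IsLift G f) : ∃ n : ℤ, ∀ x, F x = G x + n := by
  have h : ∀ x, ∃ n : ℤ, (n : ℝ) = F x - G x := fun x => by
    have : ((F x - G x : ℝ) : UnitAddCircle) = 0 := by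
      rw [AddCircle.coe_sub, ← hF.coe_apply, ← hG.coe_apply, sub_self]
    obtain ⟨n, hn⟩ := (AddCircle.coe_eq_zero_iff _).1 this
    exact ⟨n, by simpa using hn⟩
  choose n hn using h
  have hc : Continuous n := by
    rw [Int.isClosedEmbedding_coe_real.isInducing.continuous_iff]
    have : ((↑) : ℤ → ℝ) ∘ n = fun x => F x - G x := funext hn
    rw [this]
    exact hF.continuous.sub hG.continuous
  refine ⟨n 0, fun x => ?_⟩
  rw [PreconnectedSpace.constant inferInstance hc (x := 0) (y := x), hn]
  ring

theorem add_int (hF : IsLift F f) (n : ℤ) : IsLift (fun x => F x + n) f where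
  continuous := hF.continuous.add continuous_const
  map_add_one x := by rw [hF.map_add_one]; ring
  coe_apply x := by
    rw [hF.coe_apply, AddCircle.coe_add]
    have : ((n : ℝ) : UnitAddCircle) = 0 := (AddCircle.coe_eq_zero_iff _).2 ⟨n, by simp⟩
    rw [this, add_zero]

theorem unique (hf : IsLift F f) (hg : IsLift F g) : f = g := by
  ext x
  induction x using QuotientAddGroup.induction_on with
  | H x => exact (hf.coe_apply x).trans (hg.coe_apply x).symm

theorem isLift_circleLift (hF : IsLift F f) : IsLift (circleLift f) f :=
  Classical.epsilon_spec (p := fun F => IsLift F f) ⟨F, hF⟩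

theorem deriv_circleLift (hF : IsLift F f) : deriv (circleLift f) = deriv F := by
  obtain ⟨n, hn⟩ := hF.isLift_circleLift.exists_eq_add_int hF
  rw [funext hn]
  funext x
  exact deriv_add_const _

theorem iteratedDeriv_circleLift (hF : IsLift F f) {j : ℕ} (hj : 1 ≤ j) :
    iteratedDeriv j (circleLift f) = iteratedDeriv j F := by
  obtain ⟨i, rfl⟩ := Nat.exists_eq_add_of_le' hj
  rw [iteratedDeriv_succ', iteratedDeriv_succ', hF.deriv_circleLift]

theorem deriv_periodic (hF : IsLift F f) : Function.Periodic (deriv F) 1 := fun x => by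
  rw [← deriv_comp_add_const]
  simp only [hF.map_add_one]
  exact deriv_add_const _

theorem pow (hF : IsLift F f) (n : ℕ) : IsLift F^[n] (f ^ n) := by
  induction n with
  | zero => exact IsLift.one
  | succ n ih =>
    rw [Function.iterate_succ, pow_succ]
    exact ih.comp hF

theorem exists_perm (hc : Continuous F) (hm : StrictMono F) (h1 : ∀ x, F (x + 1) = F x + 1) :
    ∃ f, IsLift F f := by
  let c : CircleDeg1Lift := ⟨⟨F, hm.monotone⟩, h1⟩
  have hs : Function.Surjective F := hc.surjective c.tendsto_atTop c.tendsto_atBot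
  let o : ℝ ≃o ℝ := hm.orderIsoOfSurjective F hs
  have ho : ∀ x, o x = F x := fun _ => rfl
  have h1' : ∀ x, o.symm (x + 1) = o.symm x + 1 := fun x => by
    apply o.injective
    rw [o.apply_symm_apply, ho, h1, ← ho, o.apply_symm_apply]
  have hp : Function.Periodic (fun x => (F x : UnitAddCircle)) 1 := fun x => by
    simp only [h1, AddCircle.coe_add, AddCircle.coe_period, add_zero]
  have hp' : Function.Periodic (fun x => (o.symm x : UnitAddCircle)) 1 := fun x => by
    simp only [h1', AddCircle.coe_add, AddCircle.coe_period, add_zero]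
  refine ⟨⟨hp.lift, hp'.lift, fun x => ?_, fun x => ?_⟩, hc, h1, fun x => rfl⟩
  · induction x using QuotientAddGroup.induction_on with
    | H x =>
      change ((o.symm (F x) : ℝ) : UnitAddCircle) = x
      rw [← ho, o.symm_apply_apply]
  · induction x using QuotientAddGroup.induction_on with
    | H x =>
      change ((F (o.symm x) : ℝ) : UnitAddCircle) = x
      rw [← ho, o.apply_symm_apply]

theorem edist_apply_le {C : ℝ≥0∞} (hF : IsLift F f) (hG : IsLift G g)
    (h : ∀ x, edist (F x) (G x) ≤ C) : ⨆ x : UnitAddCircle, edist (f x) (g x) ≤ C := by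
  refine iSup_le fun x => ?_
  induction x using QuotientAddGroup.induction_on with
  | H x =>
    refine le_trans ?_ (h x)
    change edist (f (x : UnitAddCircle)) (g (x : UnitAddCircle)) ≤ _
    rw [hF.coe_apply, hG.coe_apply, edist_dist, edist_dist, dist_eq_norm, ← AddCircle.coe_sub,
      Real.dist_eq]
    exact ENNReal.ofReal_le_ofReal (by
      simpa using QuotientAddGroup.norm_mk_le_norm (S := AddSubgroup.zmultiples (1 : ℝ)) (m := F x - G x))

end IsLift

/-! ### Linear interpolation of lifts -/

/-- The lift `(1 - t) x + t F x`. -/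
def interp (F : ℝ → ℝ) (t x : ℝ) : ℝ := x + t * (F x - x)

section Interp

variable {F : ℝ → ℝ} {f : Equiv.Perm UnitAddCircle}

theorem hasDerivAt_interp (hF : ∀ x, DifferentiableAt ℝ F x) (t x : ℝ) :
    HasDerivAt (interp F t) (1 + t * (deriv F x - 1)) x :=
  (hasDerivAt_id x).add (((hF x).hasDerivAt.sub (hasDerivAt_id x)).const_mul t)

theorem deriv_interp (hF : ∀ x, DifferentiableAt ℝ F x) (t x : ℝ) :
    deriv (interp F t) x = 1 + t * (deriv F x - 1) :=
  (hasDerivAt_interp hF t x).deriv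

theorem interp_zero : interp F 0 = id := by funext x; simp [interp]

theorem interp_one : interp F 1 = F := by funext x; simp [interp]

theorem min_le_deriv_interp {m : ℝ} (hF : ∀ x, DifferentiableAt ℝ F x) (hm1 : m ≤ 1)
    (hm : ∀ x, m ≤ deriv F x) {t : ℝ} (ht : t ∈ Icc (0 : ℝ) 1) (x : ℝ) :
    m ≤ deriv (interp F t) x := by
  rw [deriv_interp hF]
  nlinarith [mul_le_mul_of_nonneg_left (hm x) ht.1, mul_le_mul_of_nonneg_left hm1 (sub_nonneg.2 ht.2)]

theorem deriv_interp_pos (hF : ∀ x, 0 < deriv F x) {t : ℝ} (ht : t ∈ Icc (0 : ℝ) 1) (x : ℝ) :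
    0 < deriv (interp F t) x := by
  rw [deriv_interp fun x => differentiableAt_of_deriv_ne_zero (hF x).ne']
  rcases ht.1.eq_or_lt with rfl | h
  · simp
  · nlinarith [mul_pos h (hF x), ht.2]

theorem IsLift.exists_interp (hF : IsLift F f) (hF' : ∀ x, 0 < deriv F x) {t : ℝ}
    (ht : t ∈ Icc (0 : ℝ) 1) : ∃ p, IsLift (interp F t) p := by
  refine IsLift.exists_perm ?_ (strictMono_of_deriv_pos (deriv_interp_pos hF' ht)) fun x => ?_
  · have := hF.continuous
    unfold interp
    fun_prop
  · simp only [interp, hF.map_add_one]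
    ring

theorem exists_add_int_mem_Ico (x : ℝ) : ∃ n : ℤ, x + n ∈ Ico (0 : ℝ) 1 :=
  ⟨-⌊x⌋, by
    push_cast
    exact ⟨by linarith [Int.floor_le x], by linarith [Int.lt_floor_add_one x]⟩⟩

/-- The displacement is periodic, and on one period monotonicity controls it. Normalising `F 0`
makes the bound uniform over all maps. -/
theorem IsLift.abs_sub_id_le (hF : IsLift F f) (hm : Monotone F) (h0 : F 0 ∈ Ico (0 : ℝ) 1)
    (x : ℝ) : |F x - x| ≤ 2 := by
  have hp : Function.Periodic (fun x => F x - x) 1 := fun x => by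
    simp only [hF.map_add_one]; ring
  obtain ⟨y, hy, hxy⟩ := hp.exists_mem_Ico₀ one_pos x
  rw [show F x - x = F y - y from hxy, abs_le]
  have h1 := hm hy.1
  have h2 := hm hy.2.le
  have h3 : F 1 = F 0 + 1 := by simpa using hF.map_add_one 0
  constructor <;> linarith [h0.1, h0.2, hy.1, hy.2]

end Interp

/-- The product of `N` increments in `W` lies in `W ^ N`. -/
theorem mem_pow_of_increments {G : Type*} [Group G] {W : Set G} {p : ℕ → G} (h0 : p 0 = 1) {N : ℕ}
    (h : ∀ i < N, p (i + 1) * (p i)⁻¹ ∈ W) : p N ∈ W ^ N := by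
  induction N with
  | zero => simp [h0]
  | succ N ih =>
    rw [pow_succ']
    exact ⟨_, h N (Nat.lt_succ_self N), _, ih fun i hi => h i (hi.trans (Nat.lt_succ_self N)),
      by simp⟩

/-- The path `interp F t` joins the identity to `F`; cutting it into `n` equal steps writes `g` as
the product of `n` increments. A family of maps whose increments are uniformly `O(1/n)`-close to `1`
is thus absorbed by a single power of `W`. -/
theorem IsLift.mem_pow_of_interp {F : ℝ → ℝ} {H : Subgroup (Equiv.Perm UnitAddCircle)} {W : Set H}
    {g : H} (hF : IsLift F g.1)
    (hex : ∀ t ∈ Icc (0 : ℝ) 1, ∃ P : H, IsLift (interp F t) P.1) {n : ℕ} (hn : 0 < n)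
    (hW : ∀ t ∈ Icc (0 : ℝ) 1, t + 1 / n ∈ Icc (0 : ℝ) 1 → ∀ P Q : H, IsLift (interp F t) P.1 →
      IsLift (interp F (t + 1 / n)) Q.1 → Q * P⁻¹ ∈ W) : g ∈ W ^ n := by
  have hn' : (0 : ℝ) < n := by exact_mod_cast hn
  have hmem : ∀ i : ℕ, i ≤ n → (i : ℝ) / n ∈ Icc (0 : ℝ) 1 := fun i hi =>
    ⟨by positivity, (div_le_one hn').2 (by exact_mod_cast hi)⟩
  have hex' : ∀ i : ℕ, ∃ P : H, i ≤ n → IsLift (interp F (i / n)) P.1 := fun i => by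
    by_cases hi : i ≤ n
    · obtain ⟨P, hP⟩ := hex _ (hmem i hi)
      exact ⟨P, fun _ => hP⟩
    · exact ⟨1, fun h => absurd h hi⟩
  choose P hP using hex'
  have h0 : P 0 = 1 := by
    have := hP 0 (Nat.zero_le n)
    rw [Nat.cast_zero, zero_div, interp_zero] at this
    exact Subtype.ext (this.unique IsLift.one)
  have h1 : P n = g := by
    have := hP n le_rfl
    rw [div_self hn'.ne', interp_one] at this
    exact Subtype.ext (this.unique hF)
  rw [← h1]
  refine mem_pow_of_increments h0 fun i hi => ?_
  have e1 : ((i + 1 : ℕ) : ℝ) / n = i / n + 1 / n := by push_cast; ring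
  exact hW _ (hmem i hi.le) (e1 ▸ hmem (i + 1) hi) _ _ (hP i hi.le) (e1 ▸ hP (i + 1) hi)

/-- For small `s`, a bound linear in `s` is smaller than a given positive quantity. -/
theorem exists_nat_ofReal_lt {ε : ENNReal} (hε : 0 < ε) (K : ℝ) :
    ∃ n : ℕ, 0 < n ∧ ENNReal.ofReal (1 / n * K) < ε := by
  have htend : Tendsto (fun n : ℕ => ENNReal.ofReal (1 / (n : ℝ) * K)) atTop (𝓝 0) := by
    have := (tendsto_one_div_atTop_nhds_zero_nat (𝕜 := ℝ)).mul_const K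
    rw [zero_mul] at this
    simpa using ENNReal.tendsto_ofReal this
  obtain ⟨n, hn, hn0⟩ := ((htend.eventually_lt_const hε).and (eventually_gt_atTop 0)).exists
  exact ⟨n, hn0, hn⟩

/-! ### Periodic functions -/

theorem Function.Periodic.exists_pos_le {g : ℝ → ℝ} (hg : Function.Periodic g 1)
    (hc : Continuous g) (h0 : ∀ x, 0 < g x) : ∃ m, 0 < m ∧ ∀ x, m ≤ g x := by
  obtain ⟨y, -, hy⟩ := isCompact_Icc.exists_isMinOn (nonempty_Icc.2 zero_le_one) hc.continuousOn
    (s := Icc (0 : ℝ) 1)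
  refine ⟨g y, h0 y, fun x => ?_⟩
  obtain ⟨z, hz, hxz⟩ := hg.exists_mem_Ico₀ one_pos x
  rw [hxz]
  exact hy ⟨hz.1, hz.2.le⟩

theorem Function.Periodic.exists_abs_le {g : ℝ → ℝ} (hg : Function.Periodic g 1)
    (hc : Continuous g) : ∃ M, ∀ x, |g x| ≤ M := by
  obtain ⟨M, hM⟩ := isCompact_Icc.exists_bound_of_continuousOn hc.continuousOn (s := Icc (0 : ℝ) 1)
  refine ⟨M, fun x => ?_⟩
  obtain ⟨z, hz, hxz⟩ := hg.exists_mem_Ico₀ one_pos x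
  rw [hxz]
  exact hM z ⟨hz.1, hz.2.le⟩

theorem Real.abs_log_sub_log_le {m u v : ℝ} (hm : 0 < m) (hu : m ≤ u) (hv : m ≤ v) :
    |Real.log u - Real.log v| ≤ m⁻¹ * |u - v| := by
  have key : ∀ u v : ℝ, m ≤ u → m ≤ v → Real.log u - Real.log v ≤ m⁻¹ * |u - v| := by
    intro u v hu hv
    have hu0 := hm.trans_le hu
    have hv0 := hm.trans_le hv
    rw [← Real.log_div hu0.ne' hv0.ne']
    calc Real.log (u / v) ≤ u / v - 1 := Real.log_le_sub_one_of_pos (by positivity)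
      _ = v⁻¹ * (u - v) := by field_simp
      _ ≤ v⁻¹ * |u - v| := by gcongr; exact le_abs_self _
      _ ≤ m⁻¹ * |u - v| := by gcongr
  rw [abs_sub_le_iff]
  exact ⟨key u v hu hv, abs_sub_comm u v ▸ key v u hv hu⟩

/-! ### The variation of the logarithm of the derivative -/

/-- The total variation of `log f'` over the circle. -/
noncomputable def logVar (f : Equiv.Perm UnitAddCircle) : ℝ≥0∞ :=
  eVariationOn (fun x => Real.log (deriv (circleLift f) x)) (Icc 0 1)

section LogVar

variable {F G : ℝ → ℝ} {f g : Equiv.Perm UnitAddCircle}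

theorem IsLift.logVar_eq (hF : IsLift F f) :
    logVar f = eVariationOn (fun x => Real.log (deriv F x)) (Icc 0 1) := by
  rw [logVar, hF.deriv_circleLift]

/-- By the chain rule `log (f g⁻¹)' = (log f' - log g') ∘ g⁻¹`, and an increasing change of variable
preserves the variation over a period. Symmetry, subadditivity and continuity of `logVar` are all
read off from this formula. -/
theorem IsLift.logVar_mul_inv (hF : IsLift F f) (hG : IsLift G g) (hF' : ∀ x, 0 < deriv F x)
    (hG' : ∀ x, 0 < deriv G x) :
    logVar (f * g⁻¹) =
      eVariationOn (fun x => Real.log (deriv F x) - Real.log (deriv G x)) (Icc 0 1) := by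
  obtain ⟨e, rfl, he⟩ := hG.exists_homeomorph (strictMono_of_deriv_pos hG')
  have he' : ∀ x, 0 < deriv e.symm x := fun x => by
    rw [deriv_homeomorph_symm e hG']
    exact inv_pos.2 (hG' _)
  have hp : Function.Periodic (fun x => Real.log (deriv F x) - Real.log (deriv e x)) 1 :=
    fun x => by simp only [hF.deriv_periodic x, hG.deriv_periodic x]
  rw [(hF.comp he).logVar_eq, ← hp.eVariationOn_comp he.continuous (strictMono_of_deriv_pos he')
    he.map_add_one]
  congr 1
  funext x
  rw [(deriv_comp_pos hF' he' x).1, deriv_homeomorph_symm e hG',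
    Real.log_mul (hF' _).ne' (inv_pos.2 (hG' _)).ne', Real.log_inv, sub_eq_add_neg]

theorem logVar_one : logVar 1 = 0 := by
  rw [IsLift.one.logVar_eq]
  simp only [deriv_id', Real.log_one]
  exact eVariationOn.constant_on (by
    rintro _ ⟨x, -, rfl⟩ _ ⟨y, -, rfl⟩
    rfl)

theorem IsLift.logVar_inv (hF : IsLift F f) (hF' : ∀ x, 0 < deriv F x) :
    logVar f⁻¹ = logVar f := by
  rw [← one_mul f⁻¹, IsLift.one.logVar_mul_inv hF (by simp) hF', hF.logVar_eq]
  simp only [deriv_id', Real.log_one, zero_sub]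
  exact eVariationOn.neg_eq _ _

theorem IsLift.exists_inv (hF : IsLift F f) (hF' : ∀ x, 0 < deriv F x) :
    ∃ G, IsLift G f⁻¹ ∧ ∀ x, 0 < deriv G x := by
  obtain ⟨e, rfl, he⟩ := hF.exists_homeomorph (strictMono_of_deriv_pos hF')
  refine ⟨e.symm, he, fun x => ?_⟩
  rw [deriv_homeomorph_symm e hF']
  exact inv_pos.2 (hF' _)

theorem IsLift.logVar_mul_le (hF : IsLift F f) (hG : IsLift G g) (hF' : ∀ x, 0 < deriv F x)
    (hG' : ∀ x, 0 < deriv G x) : logVar (f * g) ≤ logVar f + logVar g := by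
  obtain ⟨I, hI, hI'⟩ := hG.exists_inv hG'
  rw [← inv_inv g, hF.logVar_mul_inv hI hF' hI', hI.logVar_inv hI', hF.logVar_eq, hI.logVar_eq]
  simp only [sub_eq_add_neg]
  refine (eVariationOn.add_le _ _ _).trans ?_
  rw [eVariationOn.neg_eq]

theorem isLength_logVar {H : Subgroup (Equiv.Perm UnitAddCircle)}
    (hH : ∀ f ∈ H, ∃ F, IsLift F f ∧ ∀ x, 0 < deriv F x) (hfin : ∀ f ∈ H, logVar f ≠ ⊤) :
    IsLength fun f : H => (logVar f.1).toReal where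
  one := by simp [logVar_one]
  inv f := by
    obtain ⟨F, hF, hF'⟩ := hH f.1 f.2
    simp [hF.logVar_inv hF']
  mul_le f g := by
    obtain ⟨F, hF, hF'⟩ := hH f.1 f.2
    obtain ⟨G, hG, hG'⟩ := hH g.1 g.2
    rw [← ENNReal.toReal_add (hfin f.1 f.2) (hfin g.1 g.2)]
    exact ENNReal.toReal_mono (ENNReal.add_ne_top.2 ⟨hfin f.1 f.2, hfin g.1 g.2⟩)
      (hF.logVar_mul_le hG hF' hG')

end LogVar

/-! ### `Diff₊^{1+AC}(𝕊¹)` -/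

theorem isLift_circleLift_of_mem_DiffAC {f : Equiv.Perm UnitAddCircle} (hf : f ∈ DiffAC) :
    IsLift (circleLift f) f ∧ ContDiff ℝ 1 (circleLift f) ∧ (∀ x, 0 < deriv (circleLift f) x) ∧
      ∀ a b, AbsolutelyContinuousOnInterval (deriv (circleLift f)) a b := by
  obtain ⟨F, hF, hc, hpos, hac⟩ := hf
  obtain ⟨n, hn⟩ := hF.isLift_circleLift.exists_eq_add_int hF
  rw [hF.deriv_circleLift]
  refine ⟨hF.isLift_circleLift, ?_, hpos, hac⟩
  rw [funext hn]
  exact hc.add contDiff_const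

namespace DiffAC

variable (f g : DiffAC)

theorem isLift : IsLift (circleLift f.1) f.1 := (isLift_circleLift_of_mem_DiffAC f.2).1

theorem contDiff : ContDiff ℝ 1 (circleLift f.1) := (isLift_circleLift_of_mem_DiffAC f.2).2.1

theorem deriv_pos : ∀ x, 0 < deriv (circleLift f.1) x :=
  (isLift_circleLift_of_mem_DiffAC f.2).2.2.1

theorem absolutelyContinuous :
    ∀ a b, AbsolutelyContinuousOnInterval (deriv (circleLift f.1)) a b :=
  (isLift_circleLift_of_mem_DiffAC f.2).2.2.2

theorem exists_pos_le_deriv : ∃ m, 0 < m ∧ ∀ x, m ≤ deriv (circleLift f.1) x :=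
  (isLift f).deriv_periodic.exists_pos_le ((contDiff f).continuous_deriv le_rfl) (deriv_pos f)

theorem logVar_ne_top : logVar f.1 ≠ ⊤ := by
  obtain ⟨m, hm, hle⟩ := exists_pos_le_deriv f
  have hbv := (absolutelyContinuous f 0 1).boundedVariationOn
  rw [uIcc_of_le zero_le_one] at hbv
  refine ne_top_of_le_ne_top (ENNReal.mul_ne_top ENNReal.ofReal_ne_top hbv)
    (eVariationOn.le_mul_of_edist_le (A := ENNReal.ofReal m⁻¹) fun x _ y _ => ?_)
  rw [edist_dist, edist_dist, ← ENNReal.ofReal_mul (by positivity)]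
  exact ENNReal.ofReal_le_ofReal (Real.abs_log_sub_log_le hm (hle x) (hle y))

theorem isLength : IsLength fun f : DiffAC => (logVar f.1).toReal :=
  isLength_logVar (fun _ hf => ⟨_, (isLift_circleLift_of_mem_DiffAC hf).1,
    (isLift_circleLift_of_mem_DiffAC hf).2.2.1⟩) fun f hf => logVar_ne_top ⟨f, hf⟩

/-- Put `u = g'` and `v = g₀'`. Then `log u - log v = log (1 + (u - v) / v)`, and the choice `δ = m
/ 2` keeps the argument above `1 / 2`, where `log` is `2`-Lipschitz. The product bound for `(u - v)
* v⁻¹` involves only `sup |u - v|` and `V(u - v) ≤ ∫ |u' - v'|`, both controlled by the metric. -/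
theorem logVar_mul_inv_le (g₀ : DiffAC) : ∃ C : ℝ≥0∞, C ≠ ⊤ ∧ ∃ δ : ℝ≥0∞, 0 < δ ∧
    ∀ g : DiffAC, edist g g₀ < δ → logVar (g.1 * g₀.1⁻¹) ≤ C * edist g g₀ := by
  obtain ⟨m, hm, hle⟩ := exists_pos_le_deriv g₀
  have hinv : eVariationOn (fun x => (deriv (circleLift g₀.1) x)⁻¹) (Icc 0 1) ≠ ⊤ := by
    have := ((absolutelyContinuous g₀ 0 1).inv_of_pos (deriv_pos g₀)).boundedVariationOn
    rwa [uIcc_of_le zero_le_one] at this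
  refine ⟨2 * (ENNReal.ofReal m⁻¹ + eVariationOn (fun x => (deriv (circleLift g₀.1) x)⁻¹)
    (Icc 0 1)), ENNReal.mul_ne_top (by simp) (ENNReal.add_ne_top.2 ⟨ENNReal.ofReal_ne_top, hinv⟩),
    ENNReal.ofReal (m / 2), by simpa using hm, fun g hg => ?_⟩
  rw [(isLift g).logVar_mul_inv (isLift g₀) (deriv_pos g) (deriv_pos g₀)]
  have hEtop : edist g g₀ ≠ ⊤ := (hg.trans ENNReal.ofReal_lt_top).ne
  have hE : (edist g g₀).toReal ≤ m / 2 := ENNReal.toReal_le_of_le_ofReal (by positivity) hg.le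
  have hsup : ∀ x, |deriv (circleLift g.1) x - deriv (circleLift g₀.1) x| ≤
      (edist g g₀).toReal := fun x => by
    rw [← Real.dist_eq, dist_edist]
    refine ENNReal.toReal_mono hEtop ?_
    exact (le_iSup (fun x => edist (deriv (circleLift g.1) x) (deriv (circleLift g₀.1) x)) x).trans
      (le_add_self.trans le_self_add)
  have hint : ∫⁻ x in Icc (0 : ℝ) 1,
      edist (deriv (deriv (circleLift g.1)) x) (deriv (deriv (circleLift g₀.1)) x) ≤
      edist g g₀ := le_add_self
  set u := deriv (circleLift g.1) with hu
  set v := deriv (circleLift g₀.1) with hv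
  have hac : AbsolutelyContinuousOnInterval (u - v) 0 1 :=
    (absolutelyContinuous g 0 1).sub (absolutelyContinuous g₀ 0 1)
  have h1 : eVariationOn (u - v) (Icc 0 1) ≤ edist g g₀ := by
    refine (hac.eVariationOn_le zero_le_one).trans ((lintegral_mono_ae ?_).trans hint)
    rw [ae_restrict_iff' measurableSet_Icc]
    filter_upwards [(absolutelyContinuous g 0 1).ae_differentiableAt,
      (absolutelyContinuous g₀ 0 1).ae_differentiableAt] with x hx hx₀ hx1
    rw [← uIcc_of_le zero_le_one] at hx1
    rw [deriv_sub (hx hx1) (hx₀ hx1), ← edist_eq_enorm_sub]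
  have h2 := eVariationOn.mul_le (f := u - v) (g := fun x => (v x)⁻¹) (s := Icc 0 1)
    (A := (edist g g₀).toReal) (B := m⁻¹) (fun x _ => hsup x) (fun x _ => by
      rw [abs_inv, abs_of_pos (deriv_pos g₀ x)]
      exact inv_anti₀ hm (hle x))
  have hr : ∀ x, 1 / 2 ≤ 1 + (u - v) x * (v x)⁻¹ := fun x => by
    have h3 : |(u - v) x * (v x)⁻¹| ≤ 1 / 2 := by
      rw [abs_mul, abs_inv, abs_of_pos (deriv_pos g₀ x), ← div_eq_mul_inv,
        div_le_iff₀ (deriv_pos g₀ x)]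
      calc |(u - v) x| ≤ m / 2 := (hsup x).trans hE
        _ ≤ 1 / 2 * v x := by linarith [hle x]
    linarith [neg_abs_le ((u - v) x * (v x)⁻¹)]
  calc eVariationOn (fun x => Real.log (u x) - Real.log (v x)) (Icc 0 1)
      ≤ 2 * eVariationOn (fun x => (u - v) x * (v x)⁻¹) (Icc 0 1) := by
        refine eVariationOn.le_mul_of_edist_le fun x _ y _ => ?_
        have key : ∀ x, Real.log (u x) - Real.log (v x) =
            Real.log (1 + (u - v) x * (v x)⁻¹) := fun x => by
          have hv0 : v x ≠ 0 := (deriv_pos g₀ x).ne'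
          rw [← Real.log_div (deriv_pos g x).ne' hv0, Pi.sub_apply]
          change Real.log (u x / v x) = _
          congr 1
          field_simp
          ring
        rw [key, key, edist_dist, edist_dist, ← ENNReal.ofReal_ofNat,
          ← ENNReal.ofReal_mul (by norm_num)]
        refine ENNReal.ofReal_le_ofReal ?_
        have := Real.abs_log_sub_log_le (by norm_num) (hr x) (hr y)
        rw [add_sub_add_left_eq_sub] at this
        simpa [Real.dist_eq] using this
    _ ≤ 2 * (ENNReal.ofReal m⁻¹ * edist g g₀ + edist g g₀ *
          eVariationOn (fun x => (v x)⁻¹) (Icc 0 1)) := by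
        rw [ENNReal.ofReal_toReal hEtop] at h2
        exact mul_le_mul_right (h2.trans (by gcongr)) 2
    _ = _ := by ring

theorem tendsto_logVar (g₀ : DiffAC) :
    Tendsto (fun g : DiffAC => (logVar (g.1 * g₀.1⁻¹)).toReal) (𝓝 g₀) (𝓝 0) := by
  obtain ⟨C, hC, δ, hδ, H⟩ := logVar_mul_inv_le g₀
  have h1 : Tendsto (fun g : DiffAC => C * edist g g₀) (𝓝 g₀) (𝓝 0) := by
    have : Tendsto (fun g : DiffAC => edist g g₀) (𝓝 g₀) (𝓝 0) :=
      tendsto_iff_edist_tendsto_0.1 tendsto_id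
    simpa using ENNReal.Tendsto.const_mul this (Or.inr hC)
  have h2 : Tendsto (fun g : DiffAC => logVar (g.1 * g₀.1⁻¹)) (𝓝 g₀) (𝓝 0) := by
    refine tendsto_of_tendsto_of_tendsto_of_le_of_le' tendsto_const_nhds h1
      (Eventually.of_forall fun _ => zero_le) ?_
    filter_upwards [Metric.eball_mem_nhds g₀ hδ] with g hg using H g hg
  simpa [Function.comp_def] using (ENNReal.tendsto_toReal ENNReal.zero_ne_top).comp h2

/-- The variation of `log f'`, as a continuous right-invariant pseudometric. -/
theorem isContRightInv : IsContRightInv isLength.pseudoMetric :=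
  isLength.isContRightInv tendsto_logVar

end DiffAC

theorem IsLift.edist_diffAC_le {F G : ℝ → ℝ} {f g : DiffAC} (hF : IsLift F f.1)
    (hG : IsLift G g.1) : edist f g ≤ (⨆ x, edist (F x) (G x)) +
      (⨆ x, edist (deriv F x) (deriv G x)) +
      ∫⁻ x in Icc (0 : ℝ) 1, edist (deriv (deriv F) x) (deriv (deriv G) x) := by
  change (⨆ x : UnitAddCircle, edist (f.1 x) (g.1 x)) +
    (⨆ x : ℝ, edist (deriv (circleLift f.1) x) (deriv (circleLift g.1) x)) +
    ∫⁻ x in Icc (0 : ℝ) 1,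
      edist (deriv (deriv (circleLift f.1)) x) (deriv (deriv (circleLift g.1)) x) ≤ _
  rw [hF.deriv_circleLift, hG.deriv_circleLift]
  gcongr
  exact hF.edist_apply_le hG (le_iSup fun x => edist (F x) (G x))

/-- A map of the line with the derivative given by that of an interpolation between lifts. -/
theorem interp_comp_symm {F : ℝ → ℝ} {t s : ℝ} (hF' : ∀ x, 0 < deriv F x)
    (ht : t ∈ Icc (0 : ℝ) 1) (hts : t + s ∈ Icc (0 : ℝ) 1) (e : ℝ ≃ₜ ℝ) (he : (e : ℝ → ℝ) = interp F t)
    (x : ℝ) : (interp F (t + s) ∘ e.symm) x = x + s * (F (e.symm x) - e.symm x) ∧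
      deriv (interp F (t + s) ∘ e.symm) x = 1 + s * ((deriv F (e.symm x) - 1) *
        (1 + t * (deriv F (e.symm x) - 1))⁻¹) := by
  have hd : ∀ x, DifferentiableAt ℝ F x := fun x => differentiableAt_of_deriv_ne_zero (hF' x).ne'
  have hpos := deriv_interp_pos hF' ht
  have he' : ∀ x, 0 < deriv e x := by rwa [he]
  have hes : ∀ x, 0 < deriv e.symm x := fun x => by
    rw [deriv_homeomorph_symm e he']
    exact inv_pos.2 (he' _)
  constructor
  · have : x = interp F t (e.symm x) := by rw [← he, e.apply_symm_apply]
    conv_rhs => rw [this]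
    rw [← he]
    simp only [Function.comp_apply, e.symm_apply_apply]
    simp only [interp, he]
    ring
  · have h2 := hpos (e.symm x)
    rw [deriv_interp hd] at h2
    rw [(deriv_comp_pos (deriv_interp_pos hF' hts) hes x).1, deriv_homeomorph_symm e he', he,
      deriv_interp hd, deriv_interp hd]
    field_simp
    ring

namespace DiffAC

/-- `F` has mean slope `1` over a period, so `log F'` vanishes somewhere; elsewhere its size is at
most its variation. -/
theorem abs_log_deriv_le {F : ℝ → ℝ} {f : Equiv.Perm UnitAddCircle} (hF : IsLift F f)
    (hF' : ∀ x, 0 < deriv F x) {C : ℝ} (hC : 0 ≤ C) (hf : logVar f ≤ ENNReal.ofReal C) (x : ℝ) :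
    |Real.log (deriv F x)| ≤ C := by
  have hd : ∀ x, DifferentiableAt ℝ F x := fun x => differentiableAt_of_deriv_ne_zero (hF' x).ne'
  obtain ⟨ξ, hξ, hξ'⟩ := exists_deriv_eq_slope F zero_lt_one hF.continuous.continuousOn
    fun x _ => (hd x).differentiableWithinAt
  have h1 : F 1 = F 0 + 1 := by simpa using hF.map_add_one 0
  rw [h1] at hξ'
  norm_num at hξ'
  obtain ⟨y, hy, hxy⟩ := hF.deriv_periodic.exists_mem_Ico₀ one_pos x
  rw [hxy]
  have := (eVariationOn.edist_le (fun x => Real.log (deriv F x)) (s := Icc 0 1)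
    ⟨hy.1, hy.2.le⟩ ⟨hξ.1.le, hξ.2.le⟩).trans (hF.logVar_eq ▸ hf)
  rw [hξ', Real.log_one, edist_dist, Real.dist_eq, sub_zero] at this
  exact (ENNReal.ofReal_le_ofReal_iff hC).1 this

/-- The derivative of the increment is a Möbius function of `a = F' ∘ e.symm`, with divided
difference `s / ((1 + t(a - 1))(1 + t(b - 1)))`. The three summands bound the three terms of the
metric; in `exp (3 * C)`, two factors come from the denominators and one from passing from `F'` to
`log F'`. -/
theorem edist_one_le {F : ℝ → ℝ} {f : Equiv.Perm UnitAddCircle} (hF : IsLift F f)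
    (hF' : ∀ x, 0 < deriv F x) (h0 : F 0 ∈ Ico (0 : ℝ) 1) {C : ℝ} (hC : 0 ≤ C)
    (hf : logVar f ≤ ENNReal.ofReal C) {t s : ℝ} (hs : 0 ≤ s) (ht : t ∈ Icc (0 : ℝ) 1)
    (hts : t + s ∈ Icc (0 : ℝ) 1) {P Q : DiffAC} (hP : IsLift (interp F t) P.1)
    (hQ : IsLift (interp F (t + s)) Q.1) :
    edist (Q * P⁻¹) 1 ≤
      ENNReal.ofReal (s * (2 + (Real.exp C + 1) * Real.exp C + Real.exp (3 * C) * C)) := by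
  have hlog := abs_log_deriv_le hF hF' hC hf
  have hE : 1 ≤ Real.exp C := Real.one_le_exp hC
  have hub : ∀ x, deriv F x ≤ Real.exp C := fun x =>
    (Real.log_le_iff_le_exp (hF' x)).1 ((le_abs_self _).trans (hlog x))
  have hlb : ∀ x, (Real.exp C)⁻¹ ≤ deriv F x := fun x => by
    rw [← Real.exp_neg]
    exact (Real.le_log_iff_exp_le (hF' x)).1 (neg_le.1 ((neg_le_abs _).trans (hlog x)))
  have hd : ∀ x, DifferentiableAt ℝ F x := fun x => differentiableAt_of_deriv_ne_zero (hF' x).ne'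
  have hm : ∀ x, (Real.exp C)⁻¹ ≤ 1 + t * (deriv F x - 1) := fun x => by
    rw [← deriv_interp hd]
    exact min_le_deriv_interp hd (inv_le_one_of_one_le₀ hE) hlb ht x
  have hm' : ∀ x, (1 + t * (deriv F x - 1))⁻¹ ≤ Real.exp C := fun x =>
    inv_le_of_inv_le₀ (Real.exp_pos C) (hm x)
  have hm0 : ∀ x, 0 < 1 + t * (deriv F x - 1) := fun x =>
    (inv_pos.2 (Real.exp_pos C)).trans_le (hm x)
  obtain ⟨e, he, heL⟩ := hP.exists_homeomorph
    (strictMono_of_deriv_pos (deriv_interp_pos hF' ht))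
  have hH := interp_comp_symm hF' ht hts e he
  set H := interp F (t + s) ∘ e.symm with hHdef
  have hHL : IsLift H (Q * P⁻¹).1 := hQ.comp heL
  have hmono : StrictMono e.symm := by
    intro x y hxy
    by_contra! hle
    have := (strictMono_of_deriv_pos (deriv_interp_pos hF' ht)).monotone hle
    rw [← he, e.apply_symm_apply, e.apply_symm_apply] at this
    exact absurd hxy this.not_gt
  have hb1 : ⨆ x, edist (H x) (id x) ≤ ENNReal.ofReal (s * 2) := iSup_le fun x => by
    rw [edist_dist, Real.dist_eq, (hH x).1, id, add_sub_cancel_left, abs_mul, abs_of_nonneg hs]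
    refine ENNReal.ofReal_le_ofReal ?_
    gcongr
    exact hF.abs_sub_id_le (strictMono_of_deriv_pos hF').monotone h0 _
  have hb2 : ⨆ x, edist (deriv H x) (deriv id x) ≤
      ENNReal.ofReal (s * ((Real.exp C + 1) * Real.exp C)) := iSup_le fun x => by
    rw [edist_dist, Real.dist_eq, (hH x).2, deriv_id, add_sub_cancel_left, abs_mul,
      abs_of_nonneg hs, abs_mul, abs_of_pos (inv_pos.2 (hm0 _))]
    refine ENNReal.ofReal_le_ofReal ?_
    have := (inv_pos.2 (hm0 (e.symm x))).le
    gcongr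
    · rw [abs_le]
      constructor <;> linarith [hF' (e.symm x), hub (e.symm x)]
    · exact hm' _
  have hb3 : eVariationOn (deriv H) (Icc 0 1) ≤ ENNReal.ofReal (s * (Real.exp (3 * C) * C)) := by
    have hvar : eVariationOn (fun x => Real.log (deriv F (e.symm x))) (Icc 0 1) ≤
        ENNReal.ofReal C := by
      have hp : Function.Periodic (fun x => Real.log (deriv F x)) 1 := fun x => by
        simp only [hF.deriv_periodic x]
      rw [hp.eVariationOn_comp heL.continuous hmono heL.map_add_one, ← hF.logVar_eq]
      exact hf
    have : eVariationOn (deriv H) (Icc 0 1) ≤ ENNReal.ofReal (s * Real.exp (3 * C)) *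
        eVariationOn (fun x => Real.log (deriv F (e.symm x))) (Icc 0 1) := by
      refine eVariationOn.le_mul_of_edist_le fun x _ y _ => ?_
      rw [edist_dist, edist_dist, ← ENNReal.ofReal_mul (by positivity), Real.dist_eq, Real.dist_eq,
        (hH x).2, (hH y).2]
      refine ENNReal.ofReal_le_ofReal ?_
      have hx0 := hm0 (e.symm x)
      have hy0 := hm0 (e.symm y)
      have hx1 := hm' (e.symm x)
      have hy1 := hm' (e.symm y)
      have hux := hub (e.symm x)
      have huy := hub (e.symm y)
      have hux0 := hF' (e.symm x)
      have huy0 := hF' (e.symm y)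
      set a := deriv F (e.symm x)
      set b := deriv F (e.symm y)
      have hexp : |a - b| ≤ Real.exp C * |Real.log a - Real.log b| := by
        have key : ∀ a b : ℝ, 0 < a → 0 < b → a ≤ Real.exp C →
            a - b ≤ Real.exp C * |Real.log a - Real.log b| := by
          intro a b ha hb haC
          have h1 := Real.add_one_le_exp (Real.log b - Real.log a)
          rw [Real.exp_sub, Real.exp_log ha, Real.exp_log hb, le_div_iff₀ ha] at h1
          calc a - b ≤ a * (Real.log a - Real.log b) := by linarith
            _ ≤ a * |Real.log a - Real.log b| := by gcongr; exact le_abs_self _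
            _ ≤ _ := by gcongr
        rw [abs_sub_le_iff]
        exact ⟨key a b hux0 huy0 hux, abs_sub_comm (Real.log a) _ ▸ key b a huy0 hux0 huy⟩
      have e1 : 1 + s * ((a - 1) * (1 + t * (a - 1))⁻¹) - (1 + s * ((b - 1) * (1 + t * (b - 1))⁻¹))
          = s * ((1 + t * (a - 1))⁻¹ * (1 + t * (b - 1))⁻¹ * (a - b)) := by
        have e2 : ∀ X Y : ℝ, X ≠ 0 → Y ≠ 0 → X = 1 + t * (a - 1) → Y = 1 + t * (b - 1) →
            1 + s * ((a - 1) * X⁻¹) - (1 + s * ((b - 1) * Y⁻¹)) =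
              s * (X⁻¹ * Y⁻¹ * (a - b)) := by
          intro X Y hX hY h1 h2
          have h3 : (a - 1) * Y - (b - 1) * X = a - b := by rw [h1, h2]; ring
          rw [← h3]
          field_simp
          ring
        exact e2 _ _ hx0.ne' hy0.ne' rfl rfl
      rw [e1, abs_mul, abs_mul, abs_mul, abs_of_nonneg hs, abs_of_pos (inv_pos.2 hx0),
        abs_of_pos (inv_pos.2 hy0), mul_assoc s]
      have e3 : Real.exp (3 * C) = Real.exp C * Real.exp C * Real.exp C := by
        rw [← Real.exp_add, ← Real.exp_add]
        ring_nf
      rw [e3, mul_assoc (Real.exp C * Real.exp C)]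
      gcongr
    refine this.trans ?_
    rw [← mul_assoc s, ENNReal.ofReal_mul (p := s * Real.exp (3 * C)) (by positivity)]
    gcongr
  have hac : AbsolutelyContinuousOnInterval (deriv H) 0 1 := by
    rw [← hHL.deriv_circleLift]
    exact absolutelyContinuous _ 0 1
  have hb4 : ∫⁻ x in Icc (0 : ℝ) 1, edist (deriv (deriv H) x) (deriv (deriv id) x) ≤
      ENNReal.ofReal (s * (Real.exp (3 * C) * C)) := by
    refine le_trans (le_of_eq ?_) ((hac.lintegral_enorm_deriv_le zero_le_one).trans hb3)
    simp
  have := (hHL.edist_diffAC_le (g := 1) IsLift.one).trans (add_le_add (add_le_add hb1 hb2) hb4)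
  refine this.trans_eq ?_
  rw [← ENNReal.ofReal_add (by positivity) (by positivity),
    ← ENNReal.ofReal_add (by positivity) (by positivity)]
  congr 1
  ring

theorem exists_interp {F : ℝ → ℝ} {f : Equiv.Perm UnitAddCircle} (hF : IsLift F f)
    (hc : ContDiff ℝ 1 F) (hF' : ∀ x, 0 < deriv F x)
    (hac : ∀ a b, AbsolutelyContinuousOnInterval (deriv F) a b) {t : ℝ} (ht : t ∈ Icc (0 : ℝ) 1) :
    ∃ P : DiffAC, IsLift (interp F t) P.1 := by
  obtain ⟨p, hp⟩ := hF.exists_interp hF' ht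
  refine ⟨⟨p, interp F t, hp, ?_, deriv_interp_pos hF' ht, fun a b => ?_⟩, hp⟩
  · exact contDiff_id.add (contDiff_const.mul (hc.sub contDiff_id))
  · have : deriv (interp F t) = (fun _ => 1 - t) + fun x => t * deriv F x := by
      funext x
      rw [deriv_interp fun x => differentiableAt_of_deriv_ne_zero (hF' x).ne', Pi.add_apply]
      ring
    rw [this]
    exact ((LipschitzWith.const (1 - t)).lipschitzOnWith.absolutelyContinuousOnInterval).add
      ((hac a b).const_mul t)

/-- The constant of `edist_one_le` depends on `C` alone, so one number of steps serves every `g`. -/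
theorem exists_pow_of_logVar_le {W : Set DiffAC} (hW : W ∈ 𝓝 (1 : DiffAC)) {C : ℝ} (hC : 0 ≤ C) :
    ∃ n : ℕ, ∀ g : DiffAC, logVar g.1 ≤ ENNReal.ofReal C → g ∈ W ^ n := by
  obtain ⟨ε, hε, hball⟩ := EMetric.mem_nhds_iff.1 hW
  obtain ⟨n, hn0, hn⟩ := exists_nat_ofReal_lt hε
    (2 + (Real.exp C + 1) * Real.exp C + Real.exp (3 * C) * C)
  refine ⟨n, fun g hg => ?_⟩
  obtain ⟨k, hk⟩ := exists_add_int_mem_Ico (circleLift g.1 0)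
  set F : ℝ → ℝ := fun x => circleLift g.1 x + k with hFdef
  have hF : IsLift F g.1 := (isLift g).add_int k
  have hd : deriv F = deriv (circleLift g.1) := hF.deriv_circleLift.symm
  have hF' : ∀ x, 0 < deriv F x := by rw [hd]; exact deriv_pos g
  have hc : ContDiff ℝ 1 F := (contDiff g).add contDiff_const
  have hac : ∀ a b, AbsolutelyContinuousOnInterval (deriv F) a b := by
    rw [hd]; exact absolutelyContinuous g
  refine hF.mem_pow_of_interp (fun t ht => exists_interp hF hc hF' hac ht) hn0
    fun t ht hts P Q hP hQ => hball ?_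
  rw [Metric.mem_eball]
  exact (edist_one_le hF hF' hk hC hg (by positivity) ht hts hP hQ).trans_lt hn

theorem exists_isMaximalPseudometric :
    ∃ d : PseudoMetric DiffAC ℝ, IsMaximalPseudometric d := by
  refine _root_.exists_isMaximalPseudometric (fun f => (logVar f.1).toReal)
    isLength.nonneg isLength.inv tendsto_logVar (fun W hW g => ?_) fun W hW => ?_
  · obtain ⟨n, hn⟩ := exists_pow_of_logVar_le hW (C := (logVar g.1).toReal) ENNReal.toReal_nonneg
    exact ⟨n, hn g (ENNReal.ofReal_toReal (logVar_ne_top g)).ge⟩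
  · obtain ⟨n, hn⟩ := exists_pow_of_logVar_le hW zero_le_one
    refine ⟨n, fun g s hg hs => hn g ?_⟩
    -- The cost is itself subadditive, so a chain costs at least the `logVar` of its product.
    have key : (logVar g.1).toReal ≤ s := by
      clear hs
      induction hg with
      | one => simp [logVar_one]
      | mul _ _ ih => exact (isLength.mul_le _ _).trans (by linarith)
    rw [← ENNReal.ofReal_toReal (logVar_ne_top g)]
    exact ENNReal.ofReal_le_ofReal (key.trans hs.le)

end DiffAC

/-! ### Derivatives of compositions -/

/-- The derivatives of `φ` of orders `1, …, k` are bounded by `A`. -/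
def DerivBound (k : ℕ) (A : ℝ) (φ : ℝ → ℝ) : Prop :=
  ∀ i, 1 ≤ i → i ≤ k → ∀ x, |iteratedDeriv i φ x| ≤ A

/-- The derivatives of `H` of orders `1, …, k` are `δ`-close to those of the identity. -/
def NearId (k : ℕ) (δ : ℝ) (H : ℝ → ℝ) : Prop :=
  (∀ x, |deriv H x - 1| ≤ δ) ∧ ∀ i, 2 ≤ i → i ≤ k → ∀ x, |iteratedDeriv i H x| ≤ δ

theorem DerivBound.mono {k l : ℕ} {A B : ℝ} {φ : ℝ → ℝ} (h : DerivBound k A φ) (hl : l ≤ k)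
    (hA : A ≤ B) : DerivBound l B φ := fun i h1 h2 x => (h i h1 (h2.trans hl) x).trans hA

/-- A weak form of Faà di Bruno: apart from the leading term, each term of `(φ ∘ F)⁽ʲ⁾` contains a
derivative of `F` of order at least `2`, whence the factor `δ`, and is linear in derivatives of `φ`
of orders `1, …, j - 1`, whence `A`. The induction applies Leibniz to `(φ' ∘ F) * F'`. -/
theorem exists_abs_iteratedDeriv_comp_sub_le {R : ℝ} (hR : 0 ≤ R) (j : ℕ) :
    ∃ C, 0 ≤ C ∧ ∀ (φ F : ℝ → ℝ) (δ A : ℝ), ContDiff ℝ j φ → ContDiff ℝ j F → 0 ≤ δ → δ ≤ R →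
      0 ≤ A → (∀ x, |deriv F x| ≤ R) → (∀ i, 2 ≤ i → i ≤ j → ∀ x, |iteratedDeriv i F x| ≤ δ) →
      (∀ i, 1 ≤ i → i < j → ∀ y, |iteratedDeriv i φ y| ≤ A) → ∀ x,
      |iteratedDeriv j (φ ∘ F) x - iteratedDeriv j φ (F x) * deriv F x ^ j| ≤ C * δ * A := by
  induction j using Nat.strong_induction_on with
  | _ j ih =>
  rcases j with - | j
  · exact ⟨0, le_rfl, fun φ F δ A _ _ _ _ _ _ _ _ x => by simp⟩
  have ih' : ∀ i, ∃ C, 0 ≤ C ∧ (i < j + 1 → ∀ (φ F : ℝ → ℝ) (δ A : ℝ), ContDiff ℝ i φ →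
      ContDiff ℝ i F → 0 ≤ δ → δ ≤ R → 0 ≤ A → (∀ x, |deriv F x| ≤ R) →
      (∀ l, 2 ≤ l → l ≤ i → ∀ x, |iteratedDeriv l F x| ≤ δ) →
      (∀ l, 1 ≤ l → l < i → ∀ y, |iteratedDeriv l φ y| ≤ A) → ∀ x,
      |iteratedDeriv i (φ ∘ F) x - iteratedDeriv i φ (F x) * deriv F x ^ i| ≤ C * δ * A) := by
    intro i
    by_cases hi : i < j + 1
    · obtain ⟨C, h0, hC⟩ := ih i hi
      exact ⟨C, h0, fun _ => hC⟩
    · exact ⟨0, le_rfl, fun h => absurd h hi⟩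
  choose C hC0 hC using ih'
  refine ⟨C j * R + ∑ i ∈ Finset.range j, (j.choose i : ℝ) * (R ^ i + C i * R), ?_, ?_⟩
  · have := hC0 j
    have : 0 ≤ ∑ i ∈ Finset.range j, (j.choose i : ℝ) * (R ^ i + C i * R) :=
      Finset.sum_nonneg fun i _ => by have := hC0 i; positivity
    positivity
  intro φ F δ A hφ hF hδ hδR hA hF1 hF2 hφA x
  have hφd : ContDiff ℝ j (deriv φ) := ((contDiff_succ_iff_deriv (n := j)).1 hφ).2.2
  have hFd : ContDiff ℝ j (deriv F) := ((contDiff_succ_iff_deriv (n := j)).1 hF).2.2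
  have hφD : Differentiable ℝ φ := ((contDiff_succ_iff_deriv (n := j)).1 hφ).1
  have hFD : Differentiable ℝ F := ((contDiff_succ_iff_deriv (n := j)).1 hF).1
  have hFj : ContDiff ℝ j F := hF.of_le (by exact_mod_cast Nat.le_succ j)
  have hd : deriv (φ ∘ F) = (deriv φ ∘ F) * deriv F := by
    funext y
    exact deriv_comp y (hφD _) (hFD _)
  have hIH : ∀ i ≤ j, |iteratedDeriv i (deriv φ ∘ F) x -
      iteratedDeriv i (deriv φ) (F x) * deriv F x ^ i| ≤ C i * δ * A := by
    intro i hi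
    refine hC i (Nat.lt_succ_of_le hi) (deriv φ) F δ A
      (hφd.of_le (by exact_mod_cast hi)) (hFj.of_le (by exact_mod_cast hi)) hδ hδR hA hF1
      (fun l h1 h2 => hF2 l h1 (by lia)) (fun l h1 h2 y => ?_) x
    rw [← iteratedDeriv_succ']
    exact hφA (l + 1) (by lia) (by lia) y
  rw [iteratedDeriv_succ', hd, iteratedDeriv_mul ((hφd.comp hFj).contDiffAt) hFd.contDiffAt,
    Finset.sum_range_succ, Nat.choose_self, Nat.cast_one, one_mul, Nat.sub_self, iteratedDeriv_zero,
    iteratedDeriv_succ', pow_succ]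
  have h1 : |(iteratedDeriv j (deriv φ ∘ F) x - iteratedDeriv j (deriv φ) (F x) * deriv F x ^ j) *
      deriv F x| ≤ C j * δ * A * R := by
    rw [abs_mul]
    have := hIH j le_rfl
    have := hF1 x
    have := hC0 j
    gcongr
  have h2 : |∑ i ∈ Finset.range j, (j.choose i : ℝ) * iteratedDeriv i (deriv φ ∘ F) x *
      iteratedDeriv (j - i) (deriv F) x| ≤
      ∑ i ∈ Finset.range j, (j.choose i : ℝ) * ((R ^ i + C i * R) * A) * δ := by
    refine (Finset.abs_sum_le_sum_abs _ _).trans (Finset.sum_le_sum fun i hi => ?_)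
    rw [Finset.mem_range] at hi
    rw [abs_mul, abs_mul, Nat.abs_cast]
    have e1 : |iteratedDeriv (j - i) (deriv F) x| ≤ δ := by
      rw [← iteratedDeriv_succ']
      exact hF2 _ (by lia) (by lia) x
    have e2 : |iteratedDeriv i (deriv φ ∘ F) x| ≤ (R ^ i + C i * R) * A := by
      have h3 := hIH i hi.le
      have h4 : |iteratedDeriv i (deriv φ) (F x) * deriv F x ^ i| ≤ A * R ^ i := by
        rw [abs_mul, abs_pow, ← iteratedDeriv_succ']
        have := hφA (i + 1) (by lia) (by lia) (F x)
        have := hF1 x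
        gcongr
      have h5 : C i * δ * A ≤ C i * R * A := by
        have := hC0 i
        gcongr
      have h6 := abs_sub_abs_le_abs_sub (iteratedDeriv i (deriv φ ∘ F) x)
        (iteratedDeriv i (deriv φ) (F x) * deriv F x ^ i)
      linarith
    have := hC0 i
    gcongr
  calc _ = |∑ i ∈ Finset.range j, (j.choose i : ℝ) * iteratedDeriv i (deriv φ ∘ F) x *
      iteratedDeriv (j - i) (deriv F) x + (iteratedDeriv j (deriv φ ∘ F) x -
        iteratedDeriv j (deriv φ) (F x) * deriv F x ^ j) * deriv F x| := by congr 1; ring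
    _ ≤ _ := abs_add_le _ _
    _ ≤ _ := add_le_add h2 h1
    _ = _ := by
      rw [add_mul, add_mul, Finset.sum_mul, Finset.sum_mul, add_comm]
      congr 1
      · ring
      · exact Finset.sum_congr rfl fun i _ => by ring

/-- Bounds on the derivatives of `φ ∘ F` and `F` give bounds on the derivatives of `φ`. -/
theorem exists_derivBound_of_comp {R m : ℝ} (hR : 0 ≤ R) (hm : 0 < m) (k : ℕ) :
    ∃ C, 0 ≤ C ∧ ∀ (φ F : ℝ → ℝ) (A : ℝ), ContDiff ℝ k φ → ContDiff ℝ k F →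
      Function.Surjective F → 0 ≤ A → DerivBound k R F → (∀ x, m ≤ deriv F x) →
      DerivBound k A (φ ∘ F) → DerivBound k (C * A) φ := by
  induction k with
  | zero => exact ⟨0, le_rfl, fun φ F A _ _ _ _ _ _ _ i h1 h2 => by lia⟩
  | succ k ih =>
    obtain ⟨C, hC0, hC⟩ := ih
    obtain ⟨D, hD0, hD⟩ := exists_abs_iteratedDeriv_comp_sub_le hR (k + 1)
    refine ⟨C + (1 + D * R * C) / m ^ (k + 1), by positivity, fun φ F A hφ hF hs hA hFR hFm hφF => ?_⟩
    have hb := hC φ F A (hφ.of_le (by exact_mod_cast Nat.le_succ k))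
      (hF.of_le (by exact_mod_cast Nat.le_succ k)) hs hA (hFR.mono (Nat.le_succ k) le_rfl) hFm
      (hφF.mono (Nat.le_succ k) le_rfl)
    have hle : C * A ≤ (C + (1 + D * R * C) / m ^ (k + 1)) * A := by
      gcongr
      exact le_add_of_nonneg_right (by positivity)
    intro i h1 h2 y
    -- Only the top order is new. Removing the lower-order remainder isolates `φ⁽ᵏ⁺¹⁾(F) F'ᵏ⁺¹`,
    -- which is divided using `F' ≥ m`.
    rcases Nat.lt_or_ge k i with hi | hi
    · obtain rfl : i = k + 1 := by lia
      obtain ⟨x, rfl⟩ := hs y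
      have h3 := hD φ F R (C * A) hφ hF hR le_rfl (by positivity)
        (fun x => by simpa using hFR 1 le_rfl (by lia) x) (fun l hl1 hl2 => hFR l (by lia) hl2)
        (fun l hl1 hl2 => hb l hl1 (by lia)) x
      have h4 := hφF (k + 1) (by lia) le_rfl x
      have h5 : |iteratedDeriv (k + 1) φ (F x)| * m ^ (k + 1) ≤ A + D * R * (C * A) := by
        calc |iteratedDeriv (k + 1) φ (F x)| * m ^ (k + 1)
            ≤ |iteratedDeriv (k + 1) φ (F x)| * deriv F x ^ (k + 1) := by
              gcongr; exact hFm x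
          _ = |iteratedDeriv (k + 1) φ (F x) * deriv F x ^ (k + 1)| := by
              rw [abs_mul, abs_of_nonneg (pow_nonneg (hm.le.trans (hFm x)) _)]
          _ ≤ _ := by
              have := abs_sub_abs_le_abs_sub (iteratedDeriv (k + 1) φ (F x) * deriv F x ^ (k + 1))
                (iteratedDeriv (k + 1) (φ ∘ F) x)
              rw [abs_sub_comm] at this
              linarith
      rw [← le_div_iff₀ (by positivity)] at h5
      refine h5.trans ?_
      rw [add_mul, div_mul_eq_mul_div]
      have : 0 ≤ C * A := by positivity
      have e : A + D * R * (C * A) = (1 + D * R * C) * A := by ring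
      rw [e]
      linarith
    · exact (hb i h1 hi y).trans hle

theorem one_add_pow_le {δ : ℝ} (h0 : 0 ≤ δ) (h1 : δ ≤ 1) (n : ℕ) : (1 + δ) ^ n ≤ 1 + 3 ^ n * δ := by
  induction n with
  | zero => simpa using h0
  | succ n ih =>
    have h3 : (1 : ℝ) ≤ 3 ^ n := one_le_pow₀ (by norm_num)
    calc (1 + δ) ^ (n + 1) ≤ (1 + 3 ^ n * δ) * (1 + δ) := by rw [pow_succ]; gcongr
      _ = 1 + δ + 3 ^ n * δ + 3 ^ n * (δ * δ) := by ring
      _ ≤ 1 + 3 ^ n * δ + 3 ^ n * δ + 3 ^ n * (δ * 1) := by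
        gcongr
        exact le_mul_of_one_le_left h0 h3
      _ = _ := by ring

/-- A factor `1 + C * δ`, instead of a mere constant, is what makes the bound usable along chains of
any length: such factors multiply to at most the exponential of the sum of the `C * δ`. -/
theorem exists_derivBound_comp_nearId (k : ℕ) :
    ∃ C, 0 ≤ C ∧ ∀ (φ H : ℝ → ℝ) (δ A : ℝ), ContDiff ℝ k φ → ContDiff ℝ k H → 0 ≤ δ → δ ≤ 1 →
      0 ≤ A → NearId k δ H → DerivBound k A φ → DerivBound k ((1 + C * δ) * A) (φ ∘ H) := by
  choose D hD0 hD using fun j => exists_abs_iteratedDeriv_comp_sub_le (R := 2) (by norm_num) j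
  refine ⟨3 ^ k + ∑ j ∈ Finset.range (k + 1), D j, by
    have := Finset.sum_nonneg fun j (_ : j ∈ Finset.range (k + 1)) => hD0 j
    positivity, fun φ H δ A hφ hH h0 h1 hA hN hb i hi1 hi2 x => ?_⟩
  have hik : (i : WithTop ℕ∞) ≤ k := by exact_mod_cast hi2
  have hH1 : ∀ x, |deriv H x| ≤ 1 + δ := fun x => by
    have := abs_add_le (deriv H x - 1) 1
    rw [sub_add_cancel, abs_one] at this
    linarith [hN.1 x]
  have h3 := hD i φ H δ A (hφ.of_le hik) (hH.of_le hik) h0 (by linarith) hA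
    (fun x => (hH1 x).trans (by linarith)) (fun l hl1 hl2 => hN.2 l hl1 (hl2.trans hi2))
    (fun l hl1 hl2 => hb l hl1 (by lia)) x
  have h4 : |iteratedDeriv i φ (H x) * deriv H x ^ i| ≤ A * (1 + 3 ^ k * δ) := by
    rw [abs_mul, abs_pow]
    have h5 := hb i hi1 hi2 (H x)
    have h6 : |deriv H x| ^ i ≤ 1 + 3 ^ k * δ := by
      calc |deriv H x| ^ i ≤ (1 + δ) ^ i := by gcongr; exact hH1 x
        _ ≤ 1 + 3 ^ i * δ := one_add_pow_le h0 h1 i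
        _ ≤ _ := by gcongr; norm_num
    gcongr
  have h5 : D i * δ * A ≤ (∑ j ∈ Finset.range (k + 1), D j) * δ * A := by
    gcongr
    exact Finset.single_le_sum (f := D) (fun j _ => hD0 j) (Finset.mem_range.2 (by lia))
  have h6 := abs_sub_abs_le_abs_sub (iteratedDeriv i (φ ∘ H) x)
    (iteratedDeriv i φ (H x) * deriv H x ^ i)
  calc _ ≤ A * (1 + 3 ^ k * δ) + (∑ j ∈ Finset.range (k + 1), D j) * δ * A := by linarith
    _ = _ := by ring

/-- The counterpart for composition with `H⁻¹` when only `H` is known to be near the identity; the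
symmetrised cost of `h` may be small because of `h⁻¹` alone. The condition `2 ≤ C` turns `C * δ ≤ 1`
into `δ ≤ 1 / 2`, which keeps `1 - δ` away from `0`. -/
theorem exists_derivBound_of_comp_nearId (k : ℕ) :
    ∃ C, 2 ≤ C ∧ ∀ (φ H : ℝ → ℝ) (δ A : ℝ), ContDiff ℝ k φ → ContDiff ℝ k H →
      Function.Surjective H → 0 ≤ δ → C * δ ≤ 1 → 0 ≤ A → NearId k δ H →
      DerivBound k A (φ ∘ H) → DerivBound k ((1 + C * δ) * A) φ := by
  induction k with
  | zero => exact ⟨2, le_rfl, fun φ H δ A _ _ _ _ _ _ _ _ i h1 h2 => by lia⟩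
  | succ k ih =>
    obtain ⟨C, hC0, hC⟩ := ih
    obtain ⟨D, hD0, hD⟩ := exists_abs_iteratedDeriv_comp_sub_le (R := 2) (by norm_num) (k + 1)
    set T : ℝ := 3 ^ (k + 1) with hT
    have hT0 : 0 ≤ T := by positivity
    set C' := C + (2 * T + 2 * D + 4 * T * D) with hC'
    have hCC' : C ≤ C' := le_add_of_nonneg_right (by positivity)
    refine ⟨C', hC0.trans hCC', fun φ H δ A hφ hH hs h0 h1 hA hN hb => ?_⟩
    have hδ : C * δ ≤ 1 := (mul_le_mul_of_nonneg_right hCC' h0).trans h1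
    have hδ2 : 2 * δ ≤ 1 := (mul_le_mul_of_nonneg_right hC0 h0).trans hδ
    have hlow := hC φ H δ A (hφ.of_le (by exact_mod_cast Nat.le_succ k))
      (hH.of_le (by exact_mod_cast Nat.le_succ k)) hs h0 hδ hA
      ⟨hN.1, fun l hl1 hl2 => hN.2 l hl1 (by lia)⟩ (hb.mono (Nat.le_succ k) le_rfl)
    intro i hi1 hi2 y
    rcases Nat.lt_or_ge k i with hi | hi
    · obtain rfl : i = k + 1 := by lia
      obtain ⟨x, rfl⟩ := hs y
      have hd : 1 - δ ≤ deriv H x ∧ deriv H x ≤ 1 + δ := by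
        have := abs_le.1 (hN.1 x)
        constructor <;> linarith
      have h3 := hD φ H δ (2 * A) hφ hH h0 (by linarith) (by positivity)
        (fun x => by
          have := abs_le.1 (hN.1 x)
          rw [abs_le]
          constructor <;> linarith) (fun l hl1 hl2 => hN.2 l hl1 hl2)
        (fun l hl1 hl2 z => (hlow l hl1 (by lia) z).trans (by gcongr; linarith)) x
      have h4 := hb (k + 1) (by lia) le_rfl x
      have h5 : |iteratedDeriv (k + 1) φ (H x)| * (1 - δ) ^ (k + 1) ≤ (1 + 2 * D * δ) * A := by
        calc |iteratedDeriv (k + 1) φ (H x)| * (1 - δ) ^ (k + 1)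
            ≤ |iteratedDeriv (k + 1) φ (H x)| * deriv H x ^ (k + 1) := by
              gcongr
              · linarith
              · exact hd.1
          _ = |iteratedDeriv (k + 1) φ (H x) * deriv H x ^ (k + 1)| := by
              have hd0 : 0 ≤ deriv H x := by linarith [hd.1]
              rw [abs_mul, abs_of_nonneg (pow_nonneg hd0 _)]
          _ ≤ _ := by
              have := abs_sub_abs_le_abs_sub (iteratedDeriv (k + 1) φ (H x) * deriv H x ^ (k + 1))
                (iteratedDeriv (k + 1) (φ ∘ H) x)
              rw [abs_sub_comm] at this
              linarith
      -- For `0 ≤ δ ≤ 1 / 2` one has `(1 - δ)(1 + 2δ) ≥ 1`, so dividing by `(1 - δ)ᵏ⁺¹` costs at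
      -- most a factor `1 + 2Tδ`.
      have h6 : 1 ≤ (1 - δ) ^ (k + 1) * (1 + T * (2 * δ)) := by
        calc (1 : ℝ) ≤ ((1 - δ) * (1 + 2 * δ)) ^ (k + 1) := one_le_pow₀ (by nlinarith)
          _ = (1 - δ) ^ (k + 1) * (1 + 2 * δ) ^ (k + 1) := mul_pow _ _ _
          _ ≤ _ := by
            gcongr
            · exact pow_nonneg (by linarith) _
            · exact one_add_pow_le (by positivity) hδ2 _
      calc |iteratedDeriv (k + 1) φ (H x)|
          ≤ |iteratedDeriv (k + 1) φ (H x)| * ((1 - δ) ^ (k + 1) * (1 + T * (2 * δ))) :=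
            le_mul_of_one_le_right (abs_nonneg _) h6
        _ = |iteratedDeriv (k + 1) φ (H x)| * (1 - δ) ^ (k + 1) * (1 + T * (2 * δ)) := by ring
        _ ≤ (1 + 2 * D * δ) * A * (1 + T * (2 * δ)) := by gcongr
        _ = (1 + (2 * T + 2 * D + 4 * T * D * δ) * δ) * A := by ring
        _ ≤ (1 + (C + (2 * T + 2 * D + 4 * T * D * 1)) * δ) * A := by
          have h7 : 4 * T * D * δ ≤ 4 * T * D * 1 := by gcongr; linarith
          have h8 : 2 * T + 2 * D + 4 * T * D * δ ≤ C + (2 * T + 2 * D + 4 * T * D * 1) := by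
            linarith
          have := mul_le_mul_of_nonneg_right h8 h0
          gcongr ?_ * A
          linarith
        _ = _ := by rw [hC', mul_one]
    · refine (hlow i hi1 hi y).trans ?_
      gcongr

/-! ### `Diff₊ᵏ(𝕊¹)` -/

theorem isLift_circleLift_of_mem_DiffCk {k : ℕ} {f : Equiv.Perm UnitAddCircle}
    (hf : f ∈ DiffCk k) : IsLift (circleLift f) f ∧ ContDiff ℝ k (circleLift f) ∧
      ∀ x, 0 < deriv (circleLift f) x := by
  obtain ⟨F, hF, hc, hpos⟩ := hf
  obtain ⟨n, hn⟩ := hF.isLift_circleLift.exists_eq_add_int hF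
  rw [hF.deriv_circleLift]
  refine ⟨hF.isLift_circleLift, ?_, hpos⟩
  rw [funext hn]
  exact hc.add contDiff_const

theorem iteratedDeriv_id_eq {j : ℕ} (hj : 1 ≤ j) (x : ℝ) :
    iteratedDeriv j (id : ℝ → ℝ) x = if j = 1 then 1 else 0 := by
  obtain ⟨i, rfl⟩ := Nat.exists_eq_add_of_le' hj
  rw [iteratedDeriv_succ', deriv_id', iteratedDeriv_const]
  simp

namespace DiffCk

variable {k : ℕ}

theorem isLift (f : DiffCk k) : IsLift (circleLift f.1) f.1 :=
  (isLift_circleLift_of_mem_DiffCk f.2).1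

theorem contDiff (f : DiffCk k) : ContDiff ℝ k (circleLift f.1) :=
  (isLift_circleLift_of_mem_DiffCk f.2).2.1

theorem deriv_pos (f : DiffCk k) : ∀ x, 0 < deriv (circleLift f.1) x :=
  (isLift_circleLift_of_mem_DiffCk f.2).2.2

theorem edist_iteratedDeriv_le (f g : DiffCk k) {j : ℕ} (h1 : 1 ≤ j) (h2 : j ≤ k) (x : ℝ) :
    edist (iteratedDeriv j (circleLift f.1) x) (iteratedDeriv j (circleLift g.1) x) ≤
      edist f g := by
  refine (le_iSup (fun x => edist (iteratedDeriv j (circleLift f.1) x)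
    (iteratedDeriv j (circleLift g.1) x)) x).trans (le_trans ?_ le_add_self)
  exact Finset.single_le_sum (f := fun j => ⨆ x : ℝ,
    edist (iteratedDeriv j (circleLift f.1) x) (iteratedDeriv j (circleLift g.1) x))
    (fun _ _ => zero_le) (Finset.mem_Icc.2 ⟨h1, h2⟩)

theorem abs_iteratedDeriv_sub_le {f g : DiffCk k} (hfg : edist f g ≠ ⊤) {F G : ℝ → ℝ}
    (hF : IsLift F f.1) (hG : IsLift G g.1) {j : ℕ} (h1 : 1 ≤ j) (h2 : j ≤ k) (x : ℝ) :
    |iteratedDeriv j F x - iteratedDeriv j G x| ≤ (edist f g).toReal := by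
  rw [← hF.iteratedDeriv_circleLift h1, ← hG.iteratedDeriv_circleLift h1, ← Real.dist_eq,
    dist_edist]
  exact ENNReal.toReal_mono hfg (edist_iteratedDeriv_le f g h1 h2 x)

theorem nearId {h : DiffCk k} (hk : 1 ≤ k) (hh : edist h 1 ≠ ⊤) {H : ℝ → ℝ}
    (hH : IsLift H h.1) : NearId k (edist h 1).toReal H := by
  constructor
  · intro x
    have := abs_iteratedDeriv_sub_le (g := 1) hh hH IsLift.one le_rfl hk x
    rwa [iteratedDeriv_id_eq le_rfl, iteratedDeriv_one, if_pos rfl] at this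
  · intro i h1 h2 x
    have := abs_iteratedDeriv_sub_le (g := 1) hh hH IsLift.one (by lia : 1 ≤ i) h2 x
    rwa [iteratedDeriv_id_eq (by lia), if_neg (by lia), sub_zero] at this

theorem edist_one_le_of_derivBound {h : DiffCk k} {H φ : ℝ → ℝ} (hH : IsLift H h.1)
    (hφ : ContDiff ℝ k φ) (hHφ : ∀ x, H x = x + φ x) {E : ℝ≥0∞}
    (hE : ⨆ x : UnitAddCircle, edist (h.1 x) x ≤ E) {B : ℝ} (hB : DerivBound k B φ) :
    edist h 1 ≤ E + k * ENNReal.ofReal B := by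
  refine add_le_add hE ?_
  calc _ ≤ ∑ j ∈ Finset.Icc 1 k, ENNReal.ofReal B := Finset.sum_le_sum fun j hj => ?_
    _ = _ := by simp
  rw [Finset.mem_Icc] at hj
  refine iSup_le fun x => ?_
  have hone : IsLift id ((1 : DiffCk k) : Equiv.Perm UnitAddCircle) := IsLift.one
  rw [hH.iteratedDeriv_circleLift hj.1, hone.iteratedDeriv_circleLift hj.1, edist_dist,
    Real.dist_eq]
  refine ENNReal.ofReal_le_ofReal ?_
  have e : H = id + φ := funext hHφ
  rw [e, iteratedDeriv_add contDiff_id.contDiffAt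
    (hφ.of_le (by exact_mod_cast hj.2)).contDiffAt, add_sub_cancel_left]
  exact hB j hj.1 hj.2 x

theorem exists_pos_le_deriv (hk : 1 ≤ k) (f : DiffCk k) :
    ∃ m, 0 < m ∧ ∀ x, m ≤ deriv (circleLift f.1) x :=
  (isLift f).deriv_periodic.exists_pos_le ((contDiff f).continuous_deriv (by exact_mod_cast hk))
    (deriv_pos f)

theorem _root_.iteratedDeriv_periodic {F : ℝ → ℝ} {f : Equiv.Perm UnitAddCircle} (hF : IsLift F f)
    {j : ℕ} (hj : 1 ≤ j) : Function.Periodic (iteratedDeriv j F) 1 := fun x => by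
  obtain ⟨i, rfl⟩ := Nat.exists_eq_add_of_le' hj
  rw [iteratedDeriv_succ']
  have : (fun x => deriv F (x + 1)) = deriv F := funext hF.deriv_periodic
  conv_rhs => rw [← this, iteratedDeriv_comp_add_const]

theorem exists_derivBound (f : DiffCk k) : ∃ R, 0 ≤ R ∧ DerivBound k R (circleLift f.1) := by
  have h : ∀ j, ∃ M, 0 ≤ M ∧ (1 ≤ j → j ≤ k → ∀ x, |iteratedDeriv j (circleLift f.1) x| ≤ M) := by
    intro j
    by_cases hj : 1 ≤ j ∧ j ≤ k
    · obtain ⟨M, hM⟩ := (iteratedDeriv_periodic (isLift f) hj.1).exists_abs_le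
        ((contDiff f).continuous_iteratedDeriv j (by exact_mod_cast hj.2))
      exact ⟨M, (abs_nonneg _).trans (hM 0), fun _ _ => hM⟩
    · exact ⟨0, le_rfl, fun h1 h2 => absurd ⟨h1, h2⟩ hj⟩
  choose M hM0 hM using h
  refine ⟨∑ j ∈ Finset.range (k + 1), M j, Finset.sum_nonneg fun j _ => hM0 j,
    fun j h1 h2 x => (hM j h1 h2 x).trans ?_⟩
  exact Finset.single_le_sum (f := M) (fun j _ => hM0 j) (Finset.mem_range.2 (by lia))

theorem exists_homeomorph (f : DiffCk k) : ∃ e : ℝ ≃ₜ ℝ, (e : ℝ → ℝ) = circleLift f.1 ∧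
    IsLift e.symm f.1⁻¹ ∧ ContDiff ℝ k e.symm ∧ ∀ x, deriv e.symm x = (deriv e (e.symm x))⁻¹ := by
  obtain ⟨e, he, heL⟩ := (isLift f).exists_homeomorph (strictMono_of_deriv_pos (deriv_pos f))
  have hp : ∀ x, 0 < deriv e x := by rw [he]; exact deriv_pos f
  refine ⟨e, he, heL, e.contDiff_symm_deriv (fun x => (hp x).ne')
      (fun x => (differentiableAt_of_deriv_ne_zero (hp x).ne').hasDerivAt) (he ▸ contDiff f),
      deriv_homeomorph_symm e hp⟩

/-- On lifts `g g₀⁻¹ = id + φ` with `φ ∘ g₀ = g - g₀`, so `exists_derivBound_of_comp` transfers the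
bounds to `φ`. This is the continuity needed for the cost function. -/
theorem exists_edist_mul_inv_le (hk : 1 ≤ k) (g₀ : DiffCk k) : ∃ C : ℝ≥0∞, C ≠ ⊤ ∧
    ∀ g : DiffCk k, edist g g₀ < 1 → edist (g * g₀⁻¹) 1 ≤ C * edist g g₀ := by
  obtain ⟨m, hm, hle⟩ := exists_pos_le_deriv hk g₀
  obtain ⟨R, hR, hRb⟩ := exists_derivBound g₀
  obtain ⟨C, hC0, hC⟩ := exists_derivBound_of_comp hR hm k
  refine ⟨1 + k * ENNReal.ofReal C, by finiteness, fun g hg => ?_⟩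
  have htop : edist g g₀ ≠ ⊤ := (hg.trans ENNReal.one_lt_top).ne
  obtain ⟨e, he, heL, hec, -⟩ := exists_homeomorph g₀
  set φ : ℝ → ℝ := fun x => circleLift g.1 (e.symm x) - circleLift g₀.1 (e.symm x) with hφ
  have hφc : ContDiff ℝ k φ := ((contDiff g).comp hec).sub ((contDiff g₀).comp hec)
  have hφF : φ ∘ circleLift g₀.1 = circleLift g.1 - circleLift g₀.1 := by
    funext x
    simp only [hφ, ← he, Function.comp_apply, e.symm_apply_apply, Pi.sub_apply]
  have hb := hC φ (circleLift g₀.1) (edist g g₀).toReal hφc (contDiff g₀) (he ▸ e.surjective)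
    ENNReal.toReal_nonneg hRb hle (by
      rw [hφF]
      intro i h1 h2 x
      have hik : (i : WithTop ℕ∞) ≤ k := by exact_mod_cast h2
      rw [iteratedDeriv_sub ((contDiff g).of_le hik).contDiffAt
        ((contDiff g₀).of_le hik).contDiffAt]
      exact abs_iteratedDeriv_sub_le htop (isLift g) (isLift g₀) h1 h2 x)
  have hL : IsLift (circleLift g.1 ∘ e.symm) (g * g₀⁻¹).1 := (isLift g).comp heL
  refine (edist_one_le_of_derivBound hL hφc (fun x => ?_) (E := edist g g₀) ?_ hb).trans_eq ?_
  · simp only [hφ, ← he, Function.comp_apply, e.apply_symm_apply]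
    ring
  · refine iSup_le fun x => ?_
    have : edist ((g * g₀⁻¹).1 x) x = edist (g.1 (g₀.1⁻¹ x)) (g₀.1 (g₀.1⁻¹ x)) := by
      simp
    rw [this]
    exact (le_iSup (fun x => edist (g.1 x) (g₀.1 x)) _).trans le_self_add
  · rw [ENNReal.ofReal_mul hC0, ENNReal.ofReal_toReal htop]
    ring

/-- The distance to the identity, truncated at `1`. -/
noncomputable def truncDist (h : DiffCk k) : ℝ := (min (edist h 1) 1).toReal

theorem truncDist_nonneg (h : DiffCk k) : 0 ≤ truncDist h := ENNReal.toReal_nonneg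

/-- The truncation prevents `toReal` from sending an infinite distance to `0`, so a value below `1`
is genuine. -/
theorem edist_eq_of_truncDist_lt {h : DiffCk k} (hh : truncDist h < 1) :
    edist h 1 ≠ ⊤ ∧ truncDist h = (edist h 1).toReal := by
  unfold truncDist at *
  rcases le_total (edist h 1) 1 with h1 | h1
  · exact ⟨ne_top_of_le_ne_top ENNReal.one_ne_top h1, by rw [min_eq_left h1]⟩
  · rw [min_eq_right h1] at hh
    simp at hh

theorem tendsto_truncDist (hk : 1 ≤ k) (g₀ : DiffCk k) :
    Tendsto (fun g : DiffCk k => truncDist (g * g₀⁻¹)) (𝓝 g₀) (𝓝 0) := by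
  obtain ⟨C, hC, H⟩ := exists_edist_mul_inv_le hk g₀
  have h1 : Tendsto (fun g : DiffCk k => C * edist g g₀) (𝓝 g₀) (𝓝 0) := by
    have : Tendsto (fun g : DiffCk k => edist g g₀) (𝓝 g₀) (𝓝 0) :=
      tendsto_iff_edist_tendsto_0.1 tendsto_id
    simpa using ENNReal.Tendsto.const_mul this (Or.inr hC)
  have h2 : Tendsto (fun g : DiffCk k => min (edist (g * g₀⁻¹) 1) 1) (𝓝 g₀) (𝓝 0) := by
    refine tendsto_of_tendsto_of_tendsto_of_le_of_le' tendsto_const_nhds h1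
      (Eventually.of_forall fun _ => zero_le) ?_
    filter_upwards [Metric.eball_mem_nhds g₀ one_pos] with g hg
    exact (min_le_left _ _).trans (H g hg)
  simpa [Function.comp_def, truncDist] using (ENNReal.tendsto_toReal ENNReal.zero_ne_top).comp h2

/-- Right factors are absorbed one at a time, each multiplying the bound by at most `exp (Λ * δ)`,
so the total depends on the cost and not on the number of factors. The choice `Λ = C₁ + C₂` also
makes a cost below `1` imply the smallness of `δ` that both composition lemmas require. -/
theorem exists_derivBound_of_costChain (hk : 1 ≤ k) : ∃ Λ : ℝ, 0 < Λ ∧ ∀ (g : DiffCk k) (s : ℝ),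
    CostChain (fun h : DiffCk k => Λ * min (truncDist h) (truncDist h⁻¹)) g s →
      ∀ (φ : ℝ → ℝ) (A : ℝ), ContDiff ℝ k φ → 0 ≤ A → DerivBound k A φ →
        ∃ G, IsLift G g.1 ∧ ContDiff ℝ k G ∧ DerivBound k (Real.exp s * A) (φ ∘ G) := by
  obtain ⟨C₁, h1, hC₁⟩ := exists_derivBound_comp_nearId k
  obtain ⟨C₂, h2, hC₂⟩ := exists_derivBound_of_comp_nearId k
  have hΛ : 1 ≤ C₁ + C₂ := by linarith
  refine ⟨C₁ + C₂, by linarith, fun g s hg φ A hφ hA hb => ?_⟩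
  induction hg with
  | one => exact ⟨id, IsLift.one, contDiff_id, by simpa using hb⟩
  | @mul g h s hg hh ih =>
    obtain ⟨G, hG, hGc, hGb⟩ := ih
    have hw0 : 0 ≤ min (truncDist h) (truncDist h⁻¹) :=
      le_min (truncDist_nonneg _) (truncDist_nonneg _)
    have hw1 : min (truncDist h) (truncDist h⁻¹) < 1 :=
      (le_mul_of_one_le_left hw0 hΛ).trans_lt hh
    have hexp : ∀ {c δ : ℝ}, c ≤ C₁ + C₂ → 0 ≤ δ → (1 + c * δ) * (Real.exp s * A) ≤
        Real.exp (s + (C₁ + C₂) * δ) * A := fun {c δ} hc hδ => by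
      rw [Real.exp_add, mul_comm (Real.exp s) (Real.exp _), mul_assoc]
      have h3 := Real.add_one_le_exp ((C₁ + C₂) * δ)
      have h4 : c * δ ≤ (C₁ + C₂) * δ := by gcongr
      have : 1 + c * δ ≤ Real.exp ((C₁ + C₂) * δ) := by linarith
      gcongr
    have hA' : 0 ≤ Real.exp s * A := by positivity
    rcases le_total (truncDist h) (truncDist h⁻¹) with hle | hle
    · rw [min_eq_left hle] at hh hw1 ⊢
      obtain ⟨htop, hδ⟩ := edist_eq_of_truncDist_lt hw1
      have hN := nearId hk htop (isLift h)
      rw [← hδ] at hN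
      refine ⟨G ∘ circleLift h.1, hG.comp (isLift h), hGc.comp (contDiff h), ?_⟩
      exact (hC₁ (φ ∘ G) (circleLift h.1) _ _ (hφ.comp hGc) (contDiff h) (truncDist_nonneg h)
        hw1.le hA' hN hGb).mono le_rfl (hexp (by linarith) (truncDist_nonneg h))
    · rw [min_eq_right hle] at hh hw1 ⊢
      obtain ⟨htop, hδ⟩ := edist_eq_of_truncDist_lt hw1
      have hN := nearId hk htop (isLift h⁻¹)
      rw [← hδ] at hN
      obtain ⟨e, he, heL, hec, -⟩ := exists_homeomorph h⁻¹
      have heL' : IsLift e.symm h.1 := by simpa using heL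
      have hcomp : ((φ ∘ G) ∘ e.symm) ∘ circleLift h⁻¹.1 = φ ∘ G := by
        rw [← he]
        funext x
        simp
      refine ⟨G ∘ e.symm, hG.comp heL', hGc.comp hec, ?_⟩
      refine (hC₂ ((φ ∘ G) ∘ e.symm) (circleLift h⁻¹.1) _ _ ((hφ.comp hGc).comp hec)
        (contDiff h⁻¹) (he ▸ e.surjective) (truncDist_nonneg _) ?_ hA' hN
        (by rw [hcomp]; exact hGb)).mono le_rfl (hexp (by linarith) (truncDist_nonneg _))
      have : C₂ * truncDist h⁻¹ ≤ (C₁ + C₂) * truncDist h⁻¹ :=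
        mul_le_mul_of_nonneg_right (by linarith) (truncDist_nonneg _)
      exact this.trans hh.le

/-- Each increment is `id + s * ψ` with `ψ ∘ interp F t = F - id`, so its derivatives differ from
those of the identity by `O(s)`, with constants depending only on `k`, `R` and `m`. Both bounds
survive interpolation, up to replacing `R` by `R + 1`. -/
theorem exists_pow_of_derivBound {W : Set (DiffCk k)} (hW : W ∈ 𝓝 (1 : DiffCk k))
    {R m : ℝ} (hR : 0 ≤ R) (hm : 0 < m) (hm1 : m ≤ 1) : ∃ n : ℕ, ∀ g : DiffCk k,
      DerivBound k R (circleLift g.1) → (∀ x, m ≤ deriv (circleLift g.1) x) → g ∈ W ^ n := by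
  obtain ⟨ε, hε, hball⟩ := EMetric.mem_nhds_iff.1 hW
  obtain ⟨C, hC0, hC⟩ := exists_derivBound_of_comp (R := R + 1) (by positivity) hm k
  obtain ⟨n, hn0, hn⟩ := exists_nat_ofReal_lt hε (2 + k * (C * (R + 1)))
  refine ⟨n, fun g hgR hgm => ?_⟩
  obtain ⟨l, hl⟩ := exists_add_int_mem_Ico (circleLift g.1 0)
  set F : ℝ → ℝ := fun x => circleLift g.1 x + l with hFdef
  have hF : IsLift F g.1 := (isLift g).add_int l
  have hd : deriv F = deriv (circleLift g.1) := hF.deriv_circleLift.symm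
  have hF' : ∀ x, 0 < deriv F x := by rw [hd]; exact deriv_pos g
  have hFD : ∀ x, DifferentiableAt ℝ F x := fun x => differentiableAt_of_deriv_ne_zero (hF' x).ne'
  have hc : ContDiff ℝ k F := (contDiff g).add contDiff_const
  have hFR : DerivBound k R F := fun i h1 h2 x => by
    rw [← hF.iteratedDeriv_circleLift h1]
    exact hgR i h1 h2 x
  have hFm : ∀ x, m ≤ deriv F x := by rwa [hd]
  have hint : ∀ t, ContDiff ℝ k (interp F t) := fun t =>
    contDiff_id.add (contDiff_const.mul (hc.sub contDiff_id))
  have hid : ∀ (i : ℕ), 1 ≤ i → ∀ x : ℝ, |iteratedDeriv i id x| ≤ 1 := fun i h1 x => by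
    rw [iteratedDeriv_id_eq h1]
    split_ifs <;> simp
  have hsubR : DerivBound k (R + 1) (F - id) := fun i h1 h2 x => by
    have hik : (i : WithTop ℕ∞) ≤ k := by exact_mod_cast h2
    rw [iteratedDeriv_sub (hc.of_le hik).contDiffAt contDiff_id.contDiffAt]
    exact (abs_sub _ _).trans (add_le_add (hFR i h1 h2 x) (hid i h1 x))
  have hintR : ∀ t ∈ Icc (0 : ℝ) 1, DerivBound k (R + 1) (interp F t) := fun t ht i h1 h2 x => by
    have hik : (i : WithTop ℕ∞) ≤ k := by exact_mod_cast h2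
    have e : interp F t = (fun x => (1 - t) * id x) + fun x => t * F x := by
      funext x
      simp only [interp, Pi.add_apply, id]
      ring
    rw [e, iteratedDeriv_add (contDiff_const.mul contDiff_id).contDiffAt
      (contDiff_const.mul (hc.of_le hik)).contDiffAt, iteratedDeriv_const_mul_field,
      iteratedDeriv_const_mul_field]
    refine (abs_add_le _ _).trans ?_
    rw [abs_mul, abs_mul, abs_of_nonneg ht.1, abs_of_nonneg (sub_nonneg.2 ht.2), add_comm R]
    exact add_le_add ((mul_le_mul (by linarith [ht.1]) (hid i h1 x) (abs_nonneg _)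
      zero_le_one).trans_eq (one_mul 1)) ((mul_le_mul ht.2 (hFR i h1 h2 x) (abs_nonneg _)
      zero_le_one).trans_eq (one_mul R))
  refine hF.mem_pow_of_interp (fun t ht => ?_) hn0 fun t ht hts P Q hP hQ => hball ?_
  · obtain ⟨p, hp⟩ := hF.exists_interp hF' ht
    exact ⟨⟨p, interp F t, hp, hint t, deriv_interp_pos hF' ht⟩, hp⟩
  · rw [Metric.mem_eball]
    refine lt_of_le_of_lt ?_ hn
    have hpos := deriv_interp_pos hF' ht
    obtain ⟨e, he, heL⟩ := hP.exists_homeomorph (strictMono_of_deriv_pos hpos)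
    have hep : ∀ x, 0 < deriv e x := by rwa [he]
    have hec : ContDiff ℝ k e.symm := e.contDiff_symm_deriv (fun x => (hep x).ne')
      (fun x => (differentiableAt_of_deriv_ne_zero (hep x).ne').hasDerivAt) (he ▸ hint t)
    set s : ℝ := 1 / n with hs
    have hs0 : 0 ≤ s := by positivity
    have hL : IsLift (interp F (t + s) ∘ e.symm) (Q * P⁻¹).1 := hQ.comp heL
    have hH := interp_comp_symm hF' ht hts e he
    set ψ : ℝ → ℝ := (F - id) ∘ e.symm with hψ
    have hψc : ContDiff ℝ k ψ := (hc.sub contDiff_id).comp hec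
    have hψF : ψ ∘ interp F t = F - id := by
      rw [← he]
      funext x
      simp [hψ]
    have hψb := hC ψ (interp F t) (R + 1) hψc (hint t) (he ▸ e.surjective) (by positivity)
      (hintR t ht) (min_le_deriv_interp hFD hm1 hFm ht) (by rw [hψF]; exact hsubR)
    have hb : DerivBound k (s * (C * (R + 1))) (fun x => s * ψ x) := fun i h1 h2 x => by
      rw [iteratedDeriv_const_mul_field, abs_mul, abs_of_nonneg hs0]
      exact mul_le_mul_of_nonneg_left (hψb i h1 h2 x) hs0
    have hsup : ⨆ x : UnitAddCircle, edist ((Q * P⁻¹).1 x) ((1 : Equiv.Perm UnitAddCircle) x) ≤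
        ENNReal.ofReal (s * 2) := hL.edist_apply_le IsLift.one fun x => by
      rw [edist_dist, Real.dist_eq, (hH x).1, id, add_sub_cancel_left, abs_mul, abs_of_nonneg hs0]
      refine ENNReal.ofReal_le_ofReal ?_
      gcongr
      exact hF.abs_sub_id_le (strictMono_of_deriv_pos hF').monotone hl _
    refine (edist_one_le_of_derivBound hL (contDiff_const.mul hψc) (fun x => (hH x).1)
      hsup hb).trans_eq ?_
    · rw [← ENNReal.ofReal_natCast, ← ENNReal.ofReal_mul (by positivity),
        ← ENNReal.ofReal_add (by positivity) (by positivity)]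
      congr 1
      ring

theorem exists_isMaximalPseudometric (hk : 1 ≤ k) :
    ∃ d : PseudoMetric (DiffCk k) ℝ, IsMaximalPseudometric d := by
  obtain ⟨Λ, hΛ, H⟩ := exists_derivBound_of_costChain hk
  have hw : ∀ h : DiffCk k, 0 ≤ Λ * min (truncDist h) (truncDist h⁻¹) := fun h =>
    mul_nonneg hΛ.le (le_min (truncDist_nonneg _) (truncDist_nonneg _))
  have hwi : ∀ h : DiffCk k, Λ * min (truncDist h⁻¹) (truncDist h⁻¹⁻¹) =
      Λ * min (truncDist h) (truncDist h⁻¹) := fun h => by rw [inv_inv, min_comm]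
  refine _root_.exists_isMaximalPseudometric
    (fun h : DiffCk k => Λ * min (truncDist h) (truncDist h⁻¹)) hw hwi (fun g₀ => ?_)
    (fun W hW g => ?_) fun W hW => ?_
  · have := (tendsto_truncDist hk g₀).const_mul Λ
    rw [mul_zero] at this
    exact squeeze_zero (fun g => hw _)
      (fun g => mul_le_mul_of_nonneg_left (min_le_left _ _) hΛ.le) this
  · obtain ⟨R, hR, hRb⟩ := exists_derivBound g
    obtain ⟨m, hm, hmb⟩ := exists_pos_le_deriv hk g
    obtain ⟨n, hn⟩ := exists_pow_of_derivBound hW hR (lt_min hm one_pos) (min_le_right _ _)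
    exact ⟨n, hn g hRb fun x => (min_le_left _ _).trans (hmb x)⟩
  · obtain ⟨n, hn⟩ := exists_pow_of_derivBound hW (Real.exp_pos 1).le
      (inv_pos.2 (Real.exp_pos 1)) (inv_le_one_of_one_le₀ (Real.one_le_exp zero_le_one))
    have hid : DerivBound k 1 id := fun i h1 _ x => by
      rw [iteratedDeriv_id_eq h1]
      split_ifs <;> simp
    have key : ∀ g s, CostChain (fun h : DiffCk k => Λ * min (truncDist h) (truncDist h⁻¹)) g s →
        s < 1 → DerivBound k (Real.exp 1) (circleLift g.1) := by
      intro g s hg hs i h1 h2 x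
      obtain ⟨G, hG, -, hGb⟩ := H g s hg id 1 contDiff_id zero_le_one hid
      rw [hG.iteratedDeriv_circleLift h1]
      have := hGb i h1 h2 x
      rw [Function.id_comp, mul_one] at this
      exact this.trans (Real.exp_le_exp.2 hs.le)
    refine ⟨n, fun g s hg hs => hn g (key g s hg hs) fun x => ?_⟩
    -- The cost is symmetric, so the reversed chain bounds `(g⁻¹)'` by `e`, that is, `g'` from below
    -- by `e⁻¹`.
    have h1 := key g⁻¹ s (hg.inv hwi) hs
    obtain ⟨e, he, heL, -, hed⟩ := exists_homeomorph g
    have h2 := h1 1 le_rfl hk (e x)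
    have heL' : IsLift e.symm (g⁻¹).1 := heL
    rw [iteratedDeriv_one, heL'.deriv_circleLift, hed, e.symm_apply_apply, he, abs_inv,
      abs_of_pos (deriv_pos g x)] at h2
    exact inv_le_of_inv_le₀ (deriv_pos g x) h2

theorem le_DiffAC (hk : 2 ≤ k) : DiffCk k ≤ DiffAC := by
  rintro f ⟨F, hF, hc, hpos⟩
  refine ⟨F, hF, hc.of_le (by exact_mod_cast (by lia : 1 ≤ k)), hpos, fun a b => ?_⟩
  have h2 : ContDiff ℝ (1 + 1) F := hc.of_le (by exact_mod_cast hk)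
  exact (contDiff_succ_iff_deriv.1 h2).2.2.contDiffOn.absolutelyContinuousOnInterval

theorem edist_inclusion_le (hk : 2 ≤ k) (f g : DiffCk k) :
    edist (Subgroup.inclusion (le_DiffAC hk) f) (Subgroup.inclusion (le_DiffAC hk) g) ≤
      edist f g := by
  change (⨆ x : UnitAddCircle, edist (f.1 x) (g.1 x)) +
    (⨆ x : ℝ, edist (deriv (circleLift f.1) x) (deriv (circleLift g.1) x)) +
    ∫⁻ x in Icc (0 : ℝ) 1,
      edist (deriv (deriv (circleLift f.1)) x) (deriv (deriv (circleLift g.1)) x) ≤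
    (⨆ x : UnitAddCircle, edist (f.1 x) (g.1 x)) + ∑ j ∈ Finset.Icc 1 k, ⨆ x : ℝ,
      edist (iteratedDeriv j (circleLift f.1) x) (iteratedDeriv j (circleLift g.1) x)
  rw [add_assoc]
  gcongr
  have hsub : ({1, 2} : Finset ℕ) ⊆ Finset.Icc 1 k := by
    intro i hi
    simp only [Finset.mem_insert, Finset.mem_singleton] at hi
    rw [Finset.mem_Icc]
    lia
  refine le_trans ?_ (Finset.sum_le_sum_of_subset hsub)
  rw [Finset.sum_pair (by norm_num)]
  simp only [iteratedDeriv_one, iteratedDeriv_succ (n := 1)]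
  gcongr
  calc _ ≤ ∫⁻ x in Icc (0 : ℝ) 1, ⨆ y : ℝ,
        edist (deriv (deriv (circleLift f.1)) y) (deriv (deriv (circleLift g.1)) y) :=
      lintegral_mono fun x => le_iSup (fun y => edist (deriv (deriv (circleLift f.1)) y)
        (deriv (deriv (circleLift g.1)) y)) x
    _ = _ := by simp

theorem isLength (hk : 2 ≤ k) : IsLength fun f : DiffCk k => (logVar f.1).toReal :=
  isLength_logVar (fun _ hf => ⟨_, (isLift_circleLift_of_mem_DiffCk hf).1,
    (isLift_circleLift_of_mem_DiffCk hf).2.2⟩) fun f hf => DiffAC.logVar_ne_top ⟨f, le_DiffAC hk hf⟩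

theorem isContRightInv (hk : 2 ≤ k) : IsContRightInv (isLength hk).pseudoMetric := by
  refine (isLength hk).isContRightInv fun g₀ => ?_
  have hc : Continuous (Subgroup.inclusion (le_DiffAC hk)) :=
    (LipschitzWith.of_edist_le (edist_inclusion_le hk)).continuous
  have h1 := (DiffAC.tendsto_logVar (Subgroup.inclusion (le_DiffAC hk) g₀)).comp (hc.tendsto g₀)
  simpa only [Function.comp_def, Subgroup.coe_inclusion, Subgroup.coe_mul, Subgroup.coe_inv]
    using h1

end DiffCk

/-! ### Linear growth of the variation of `log (fⁿ)'` -/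

section Growth

variable {F : ℝ → ℝ}

theorem deriv_iterate_pos (hd : ∀ x, 0 < deriv F x) (n : ℕ) (x : ℝ) : 0 < deriv F^[n] x := by
  induction n generalizing x with
  | zero => simp
  | succ n ih =>
    rw [Function.iterate_succ']
    exact (deriv_comp_pos hd ih x).2

theorem log_deriv_iterate (hd : ∀ x, 0 < deriv F x) (n : ℕ) (x : ℝ) :
    Real.log (deriv F^[n] x) = birkhoffSum F (fun y => Real.log (deriv F y)) n x := by
  induction n with
  | zero => simp
  | succ n ih =>
    rw [Function.iterate_succ', (deriv_comp_pos hd (deriv_iterate_pos hd n) x).1,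
      Real.log_mul (hd _).ne' (deriv_iterate_pos hd n x).ne', ih, birkhoffSum_succ, add_comm]

/-- Bounded distortion along the orbit of a fundamental domain. -/
theorem abs_birkhoffSum_sub_le (hF : Monotone F) {ψ : ℝ → ℝ} {M : ℝ} (hM0 : 0 ≤ M)
    (hM : ∀ x y, |ψ x - ψ y| ≤ M * |x - y|) {b z : ℝ} (hz : z ∈ Icc b (F b)) (n : ℕ) :
    |birkhoffSum F ψ n z - birkhoffSum F ψ n b| ≤ M * (F^[n] b - b) := by
  induction n with
  | zero => simp
  | succ n ih =>
    rw [birkhoffSum_succ, birkhoffSum_succ, Function.iterate_succ_apply']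
    have h1 : F^[n] b ≤ F^[n] z := hF.iterate n hz.1
    have h2 : F^[n] z ≤ F (F^[n] b) := by
      rw [← Function.iterate_succ_apply' F, Function.iterate_succ_apply]
      exact hF.iterate n hz.2
    have h3 := hM (F^[n] z) (F^[n] b)
    rw [abs_of_nonneg (sub_nonneg.2 h1)] at h3
    -- The intervals `[Fⁿ b, Fⁿ⁺¹ b]` are adjacent, so these errors telescope.
    have h4 : M * (F^[n] z - F^[n] b) ≤ M * (F (F^[n] b) - F^[n] b) := by gcongr
    calc _ = |(birkhoffSum F ψ n z - birkhoffSum F ψ n b) + (ψ (F^[n] z) - ψ (F^[n] b))| := by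
          ring_nf
      _ ≤ _ := abs_add_le _ _
      _ ≤ M * (F (F^[n] b) - b) := by linarith

theorem mul_ofReal_le_eVariationOn {h : ℝ → ℝ} {B : ℕ → ℝ} (hB : Antitone B) {c : ℝ} {N : ℕ}
    (H : ∀ q < N, ∃ z ∈ Icc (B (q + 1)) (B q), c ≤ |h z - h (B (q + 1))|) :
    N * ENNReal.ofReal c ≤ eVariationOn h (Icc (B N) (B 0)) := by
  induction N with
  | zero => simp
  | succ N ih =>
    obtain ⟨z, hz, hc⟩ := H N N.lt_succ_self
    have h1 := eVariationOn.Icc_add_Icc h (s := univ) (hB N.le_succ) (hB N.zero_le) trivial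
    simp only [univ_inter] at h1
    rw [← h1, Nat.cast_succ, add_mul, one_mul, add_comm]
    refine add_le_add ?_ (ih fun q hq => H q (hq.trans N.lt_succ_self))
    refine le_trans ?_ (eVariationOn.edist_le h hz (left_mem_Icc.2 (hB N.le_succ)))
    rw [edist_dist, Real.dist_eq]
    exact ENNReal.ofReal_le_ofReal hc

variable {f : Equiv.Perm UnitAddCircle}

/-- By `hm`, the distortion of the segment of length `m` exceeds all that can be lost before `b` and
after `Fᵐ b`. Hence the excess `c` persists when the segment is extended to length `n` in any of `n
- m` ways, each giving an oscillation of `log (Fⁿ)'` on its own fundamental domain. -/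
theorem IsLift.exists_mul_sub_le_logVar_pow (hF : IsLift F f) (hd : ∀ x, 0 < deriv F x)
    (h0 : F 0 = 0) (hlt : ∀ x ∈ Ioo (0 : ℝ) 1, x < F x) {M : ℝ} (hM0 : 0 ≤ M)
    (hM : ∀ x y, |Real.log (deriv F x) - Real.log (deriv F y)| ≤ M * |x - y|) {b z : ℝ}
    (hb : b ∈ Ioo (0 : ℝ) 1) (hz : z ∈ Icc b (F b)) {m : ℕ}
    (hm : M * (1 - F^[m] b) + M * b <
      |birkhoffSum F (fun x => Real.log (deriv F x)) m z -
        birkhoffSum F (fun x => Real.log (deriv F x)) m b|) (hfin : ∀ n : ℕ, logVar (f ^ n) ≠ ⊤) :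
    ∃ c, 0 < c ∧ ∃ C, ∀ n : ℕ, c * n - C ≤ (logVar (f ^ n)).toReal := by
  set ψ : ℝ → ℝ := fun x => Real.log (deriv F x) with hψ
  have hmono := strictMono_of_deriv_pos hd
  obtain ⟨e, rfl, he⟩ := hF.exists_homeomorph hmono
  have hsm : StrictMono e.symm := fun x y hxy => by
    rw [← hmono.lt_iff_lt]
    simpa using hxy
  have h1 : e 1 = 1 := by simpa [h0] using hF.map_add_one 0
  have hs0 : e.symm 0 = 0 := by rw [Homeomorph.symm_apply_eq, h0]
  have hs1 : e.symm 1 = 1 := by rw [Homeomorph.symm_apply_eq, h1]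
  have hsI : ∀ x ∈ Ioo (0 : ℝ) 1, e.symm x ∈ Ioo (0 : ℝ) 1 := fun x hx =>
    ⟨by simpa [hs0] using hsm hx.1, by simpa [hs1] using hsm hx.2⟩
  have hI : ∀ x ∈ Ioo (0 : ℝ) 1, e x ∈ Ioo (0 : ℝ) 1 := fun x hx =>
    ⟨by simpa [h0] using hmono hx.1, by simpa [h1] using hmono hx.2⟩
  have hsI' : ∀ q, e.symm^[q] b ∈ Ioo (0 : ℝ) 1 := fun q => by
    induction q with
    | zero => exact hb
    | succ q ih => rw [Function.iterate_succ_apply']; exact hsI _ ih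
  have hinv : ∀ q x, e^[q] (e.symm^[q] x) = x := fun q x =>
    (Function.LeftInverse.iterate e.apply_symm_apply q) x
  set c : ℝ := |birkhoffSum e ψ m z - birkhoffSum e ψ m b| - (M * (1 - e^[m] b) + M * b) with hc
  have hc0 : 0 < c := sub_pos.2 hm
  -- the gap persists for longer orbit segments
  have key : ∀ q p : ℕ, c ≤ |birkhoffSum e ψ (q + m + p) (e.symm^[q] z) -
      birkhoffSum e ψ (q + m + p) (e.symm^[q] b)| := fun q p => by
    have hzq : e.symm^[q] z ∈ Icc (e.symm^[q] b) (e (e.symm^[q] b)) := by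
      refine ⟨hsm.monotone.iterate q hz.1, ?_⟩
      have : e (e.symm^[q] b) = e.symm^[q] (e b) :=
        (Function.Commute.iterate_right (f := e) (g := e.symm)
          (fun x => by simp) q) b
      rw [this]
      exact hsm.monotone.iterate q hz.2
    have hzm : e^[m] z ∈ Icc (e^[m] b) (e (e^[m] b)) := by
      refine ⟨hmono.monotone.iterate m hz.1, ?_⟩
      rw [← Function.iterate_succ_apply' e, Function.iterate_succ_apply]
      exact hmono.monotone.iterate m hz.2
    have t1 := abs_birkhoffSum_sub_le (ψ := ψ) hmono.monotone hM0 hM hzq q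
    have t2 := abs_birkhoffSum_sub_le (ψ := ψ) hmono.monotone hM0 hM hzm p
    rw [hinv] at t1
    have hb1 : e^[p] (e^[m] b) ≤ 1 := by
      have : ∀ k, e^[k] b ∈ Ioo (0 : ℝ) 1 := fun k => by
        induction k with
        | zero => exact hb
        | succ q ih => rw [Function.iterate_succ_apply']; exact hI _ ih
      rw [← Function.iterate_add_apply]
      exact (this _).2.le
    have e1 : M * (b - e.symm^[q] b) ≤ M * b := by
      gcongr
      linarith [(hsI' q).1]
    have e2 : M * (e^[p] (e^[m] b) - e^[m] b) ≤ M * (1 - e^[m] b) := by gcongr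
    have split : ∀ x, birkhoffSum e ψ (q + m + p) x = birkhoffSum e ψ q x +
        birkhoffSum e ψ m (e^[q] x) + birkhoffSum e ψ p (e^[m] (e^[q] x)) := fun x => by
      rw [birkhoffSum_add, birkhoffSum_add, add_comm q m, Function.iterate_add_apply]
    rw [split, split, hinv, hinv, hc]
    have t3 : |birkhoffSum e ψ m z - birkhoffSum e ψ m b| ≤ |(birkhoffSum e ψ q (e.symm^[q] z) +
        birkhoffSum e ψ m z + birkhoffSum e ψ p (e^[m] z)) - (birkhoffSum e ψ q (e.symm^[q] b) +
        birkhoffSum e ψ m b + birkhoffSum e ψ p (e^[m] b))| +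
        |birkhoffSum e ψ q (e.symm^[q] z) - birkhoffSum e ψ q (e.symm^[q] b)| +
        |birkhoffSum e ψ p (e^[m] z) - birkhoffSum e ψ p (e^[m] b)| := by
      refine le_trans (le_of_eq ?_) ((abs_sub _ _).trans (add_le_add_left (abs_sub _ _) _))
      congr 1
      ring
    linarith
  -- With `C = c * m` nothing has to be proved for `n < m`.
  refine ⟨c, hc0, c * m, fun n => ?_⟩
  rcases lt_or_ge n m with hn | hn
  · have : (n : ℝ) ≤ m := by exact_mod_cast hn.le
    have := mul_le_mul_of_nonneg_left this hc0.le
    exact (sub_nonpos.2 this).trans ENNReal.toReal_nonneg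
  -- Since `B 0 = e b`, the interval from `B (q + 1)` to `B q` is the fundamental domain starting at
  -- `e⁻ᵠ b`.
  let B : ℕ → ℝ := fun q => e.symm^[q] (e b)
  have hBs : ∀ q, B (q + 1) = e.symm^[q] b := fun q => by
    simp only [B, Function.iterate_succ_apply, Homeomorph.symm_apply_apply]
  have hB : Antitone B := by
    refine antitone_nat_of_succ_le fun q => ?_
    rw [hBs]
    exact hsm.monotone.iterate q (hlt b hb).le
  have hlog : (fun x => Real.log (deriv e^[n] x)) = birkhoffSum e ψ n :=
    funext fun x => log_deriv_iterate hd n x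
  have hle := mul_ofReal_le_eVariationOn (h := birkhoffSum e ψ n) hB (c := c) (N := n - m)
    fun q hq => ⟨e.symm^[q] z, by
      rw [hBs]
      exact ⟨hsm.monotone.iterate q hz.1, hsm.monotone.iterate q hz.2⟩, by
      rw [hBs]
      have := key q (n - m - q)
      rwa [show q + m + (n - m - q) = n by lia] at this⟩
  have hsub : Icc (B (n - m)) (B 0) ⊆ Icc (0 : ℝ) 1 := by
    refine Icc_subset_Icc ?_ (hI b hb).2.le
    cases n - m with
    | zero => exact (hI b hb).1.le
    | succ k => rw [hBs]; exact (hsI' k).1.le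
  have h2 := hle.trans (eVariationOn.mono _ hsub)
  rw [← hlog, ← (hF.pow n).logVar_eq] at h2
  have h3 := ENNReal.toReal_mono (hfin n) h2
  rw [ENNReal.toReal_mul, ENNReal.toReal_natCast, ENNReal.toReal_ofReal hc0.le,
    Nat.cast_sub hn] at h3
  linarith

/-- Fekete's lemma gives the limit, and linear growth bounds it below by `c`. -/
theorem IsLift.hasPosAsymptoticDistortion (hF : IsLift F f) (hd : ∀ x, 0 < deriv F x)
    (hfin : ∀ n : ℕ, logVar (f ^ n) ≠ ⊤) {c C : ℝ} (hc : 0 < c)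
    (h : ∀ n : ℕ, c * n - C ≤ (logVar (f ^ n)).toReal) : HasPosAsymptoticDistortion F 0 1 := by
  have hsub : Subadditive fun n => (logVar (f ^ n)).toReal := fun m n => by
    rw [← ENNReal.toReal_add (hfin m) (hfin n)]
    simp only [pow_add]
    exact ENNReal.toReal_mono (ENNReal.add_ne_top.2 ⟨hfin m, hfin n⟩)
      ((hF.pow m).logVar_mul_le (hF.pow n) (deriv_iterate_pos hd m) (deriv_iterate_pos hd n))
  have hlim := hsub.tendsto_lim ⟨0, by
    rintro _ ⟨n, rfl⟩
    exact div_nonneg ENNReal.toReal_nonneg n.cast_nonneg⟩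
  refine ⟨hsub.lim, hc.trans_le ?_, ?_⟩
  · have h1 : Tendsto (fun n : ℕ => c - C / n) atTop (𝓝 c) := by
      simpa using tendsto_const_nhds.sub (tendsto_const_div_atTop_nhds_zero_nat C)
    refine le_of_tendsto_of_tendsto h1 hlim ?_
    filter_upwards [eventually_gt_atTop 0] with n hn
    have hn' : (0 : ℝ) < n := by exact_mod_cast hn
    rw [le_div_iff₀ hn', sub_mul, div_mul_cancel₀ _ hn'.ne']
    exact h n
  · refine hlim.congr fun n => ?_
    rw [(hF.pow n).logVar_eq]

end Growth

/-! ### Circle maps `x ↦ x + ε R(cos 2πx)` -/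

/-- The lift `x + ε R(cos 2πx)`. -/
noncomputable def cosMap (ε : ℝ) (R : ℝ → ℝ) (x : ℝ) : ℝ := x + ε * R (Real.cos (2 * Real.pi * x))

theorem cosMap_add_one (ε : ℝ) (R : ℝ → ℝ) (x : ℝ) : cosMap ε R (x + 1) = cosMap ε R x + 1 := by
  rw [cosMap, cosMap, mul_add, mul_one, Real.cos_add_two_pi]
  ring

/-- `R`, with derivatives `R₁` and `R₂`, is of size comparable to `1` on `[-1, 1]`, is positive on
`[-1, 1)`, and vanishes to second order at `1`. -/
structure IsProfile (R R₁ R₂ : ℝ → ℝ) : Prop where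
  hasDerivAt : ∀ u, HasDerivAt R (R₁ u) u
  hasDerivAt' : ∀ u, HasDerivAt R₁ (R₂ u) u
  le : ∀ u ∈ Icc (-1 : ℝ) 1, |R u| ≤ 7
  le' : ∀ u ∈ Icc (-1 : ℝ) 1, |R₁ u| ≤ 10
  le'' : ∀ u ∈ Icc (-1 : ℝ) 1, |R₂ u| ≤ 13
  pos : ∀ u ∈ Ico (-1 : ℝ) 1, 0 < R u
  zero : R 1 = 0
  zero' : R₁ 1 = 0

/-- The constants come from the product rule with `|1 - u| ≤ 2`. The bound `3 / 4` keeps `1 + P`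
positive and leaves room to approximate a perturbation bounded by `1 / 2`. -/
theorem isProfile_of_perturbation {P P₁ P₂ : ℝ → ℝ} (h : ∀ u, HasDerivAt P (P₁ u) u)
    (h' : ∀ u, HasDerivAt P₁ (P₂ u) u)
    (hb : ∀ u ∈ Icc (-1 : ℝ) 1, |P u| ≤ 3 / 4 ∧ |P₁ u| ≤ 3 / 4 ∧ |P₂ u| ≤ 3 / 4) :
    IsProfile (fun u => (1 - u) ^ 2 * (1 + P u))
      (fun u => -2 * (1 - u) * (1 + P u) + (1 - u) ^ 2 * P₁ u)
      (fun u => 2 * (1 + P u) - 4 * (1 - u) * P₁ u + (1 - u) ^ 2 * P₂ u) := by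
  have hone : ∀ u : ℝ, HasDerivAt (fun u : ℝ => 1 - u) (-1) u := fun u =>
    (hasDerivAt_id u).const_sub 1
  have b1 : ∀ u ∈ Icc (-1 : ℝ) 1, |1 - u| ≤ 2 := fun u hu => by
    rw [abs_le]; constructor <;> linarith [hu.1, hu.2]
  have b2 : ∀ u ∈ Icc (-1 : ℝ) 1, |(1 - u) ^ 2| ≤ 4 := fun u hu => by
    rw [abs_pow]
    nlinarith [b1 u hu, abs_nonneg (1 - u)]
  have b3 : ∀ u ∈ Icc (-1 : ℝ) 1, |1 + P u| ≤ 7 / 4 := fun u hu => by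
    have := abs_le.1 (hb u hu).1
    rw [abs_le]; constructor <;> linarith [this.1, this.2]
  have mul_le : ∀ {x y a b : ℝ}, |x| ≤ a → |y| ≤ b → |x * y| ≤ a * b := fun {x y a b} hx hy => by
    rw [abs_mul]
    exact mul_le_mul hx hy (abs_nonneg _) ((abs_nonneg _).trans hx)
  refine ⟨fun u => ?_, fun u => ?_, fun u hu => ?_, fun u hu => ?_, fun u hu => ?_, fun u hu => ?_,
    by simp, by simp⟩
  · convert! ((hone u).pow 2).mul ((h u).const_add 1) using 1
    simp only [Pi.pow_apply]
    push_cast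
    ring
  · convert! (((hone u).const_mul (-2)).mul ((h u).const_add 1)).add
      (((hone u).pow 2).mul (h' u)) using 1
    simp only [Pi.pow_apply]
    push_cast
    ring
  · have := mul_le (b2 u hu) (b3 u hu)
    linarith
  · have h1 := mul_le (b1 u hu) (b3 u hu)
    have h2 := mul_le (b2 u hu) (hb u hu).2.1
    calc _ = |-2 * ((1 - u) * (1 + P u)) + (1 - u) ^ 2 * P₁ u| := by ring_nf
      _ ≤ |-2 * ((1 - u) * (1 + P u))| + |(1 - u) ^ 2 * P₁ u| := abs_add_le _ _
      _ = 2 * |(1 - u) * (1 + P u)| + |(1 - u) ^ 2 * P₁ u| := by rw [abs_mul (-2)]; norm_num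
      _ ≤ 10 := by linarith
  · have h0 := b3 u hu
    have h1 := mul_le (b1 u hu) (hb u hu).2.1
    have h2 := mul_le (b2 u hu) (hb u hu).2.2
    calc _ = |2 * (1 + P u) + -4 * ((1 - u) * P₁ u) + (1 - u) ^ 2 * P₂ u| := by ring_nf
      _ ≤ |2 * (1 + P u)| + |-4 * ((1 - u) * P₁ u)| + |(1 - u) ^ 2 * P₂ u| := abs_add_three _ _ _
      _ = 2 * |1 + P u| + 4 * |(1 - u) * P₁ u| + |(1 - u) ^ 2 * P₂ u| := by
        rw [abs_mul 2, abs_mul (-4)]; norm_num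
      _ ≤ 13 := by linarith
  · have h1 := (abs_le.1 (hb u ⟨hu.1, hu.2.le⟩).1).1
    have h2 : 0 < 1 - u := by linarith [hu.2]
    have h3 : 0 < 1 + P u := by linarith
    positivity

theorem cos_mem (x : ℝ) : Real.cos x ∈ Icc (-1 : ℝ) 1 := ⟨Real.neg_one_le_cos x, Real.cos_le_one x⟩

namespace IsProfile

variable {R R₁ R₂ : ℝ → ℝ} {ε : ℝ}

theorem hasDerivAt_cosMap (h : IsProfile R R₁ R₂) (ε x : ℝ) : HasDerivAt (cosMap ε R)
    (1 + ε * (R₁ (Real.cos (2 * Real.pi * x)) * (-(2 * Real.pi) * Real.sin (2 * Real.pi * x)))) x := by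
  have h1 : HasDerivAt (fun x : ℝ => 2 * Real.pi * x) (2 * Real.pi) x := by
    simpa using (hasDerivAt_id x).const_mul (2 * Real.pi)
  convert! (hasDerivAt_id x).add
    (((h.hasDerivAt (Real.cos (2 * Real.pi * x))).comp x h1.cos).const_mul ε) using 1
  ring

theorem deriv_cosMap (h : IsProfile R R₁ R₂) (ε : ℝ) : deriv (cosMap ε R) = fun x =>
    1 + ε * (R₁ (Real.cos (2 * Real.pi * x)) * (-(2 * Real.pi) * Real.sin (2 * Real.pi * x))) :=
  funext fun x => (h.hasDerivAt_cosMap ε x).deriv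

theorem hasDerivAt_deriv_cosMap (h : IsProfile R R₁ R₂) (ε x : ℝ) :
    HasDerivAt (deriv (cosMap ε R)) (ε * ((2 * Real.pi) ^ 2 *
      (R₂ (Real.cos (2 * Real.pi * x)) * Real.sin (2 * Real.pi * x) ^ 2 -
        R₁ (Real.cos (2 * Real.pi * x)) * Real.cos (2 * Real.pi * x)))) x := by
  have h1 : HasDerivAt (fun x : ℝ => 2 * Real.pi * x) (2 * Real.pi) x := by
    simpa using (hasDerivAt_id x).const_mul (2 * Real.pi)
  rw [h.deriv_cosMap]
  convert! ((((h.hasDerivAt' (Real.cos (2 * Real.pi * x))).comp x h1.cos).mul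
    (h1.sin.const_mul (-(2 * Real.pi)))).const_mul ε).const_add 1 using 1
  simp only [Function.comp_apply]
  ring

theorem deriv_deriv_cosMap (h : IsProfile R R₁ R₂) (ε x : ℝ) :
    deriv (deriv (cosMap ε R)) x = ε * ((2 * Real.pi) ^ 2 *
      (R₂ (Real.cos (2 * Real.pi * x)) * Real.sin (2 * Real.pi * x) ^ 2 -
        R₁ (Real.cos (2 * Real.pi * x)) * Real.cos (2 * Real.pi * x))) :=
  (h.hasDerivAt_deriv_cosMap ε x).deriv

theorem abs_cosMap_sub_le (h : IsProfile R R₁ R₂) (hε : 0 ≤ ε) (x : ℝ) :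
    |cosMap ε R x - x| ≤ 7 * ε := by
  rw [cosMap, add_sub_cancel_left, abs_mul, abs_of_nonneg hε, mul_comm]
  gcongr
  exact h.le _ (cos_mem _)

theorem abs_deriv_cosMap_sub_le (h : IsProfile R R₁ R₂) (hε : 0 ≤ ε) (x : ℝ) :
    |deriv (cosMap ε R) x - 1| ≤ 70 * ε := by
  rw [h.deriv_cosMap, add_sub_cancel_left, abs_mul, abs_of_nonneg hε, mul_comm, abs_mul, abs_mul,
    abs_neg, abs_of_pos (by positivity : 0 < 2 * Real.pi)]
  have h1 := h.le' _ (cos_mem (2 * Real.pi * x))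
  have h2 := Real.abs_sin_le_one (2 * Real.pi * x)
  have h3 := Real.pi_lt_d2
  have h4 : 2 * Real.pi * |Real.sin (2 * Real.pi * x)| ≤ 7 * 1 := by
    gcongr
    linarith
  have : |R₁ (Real.cos (2 * Real.pi * x))| * (2 * Real.pi * |Real.sin (2 * Real.pi * x)|) ≤
      10 * (7 * 1) := by gcongr
  have : |R₁ (Real.cos (2 * Real.pi * x))| * (2 * Real.pi * |Real.sin (2 * Real.pi * x)|) ≤ 70 := by
    linarith
  gcongr

theorem abs_deriv_deriv_cosMap_le (h : IsProfile R R₁ R₂) (hε : 0 ≤ ε) (x : ℝ) :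
    |deriv (deriv (cosMap ε R)) x| ≤ 1000 * ε := by
  rw [h.deriv_deriv_cosMap, abs_mul, abs_of_nonneg hε, mul_comm, abs_mul, abs_pow,
    abs_of_pos (by positivity : 0 < 2 * Real.pi)]
  have h1 := h.le' _ (cos_mem (2 * Real.pi * x))
  have h2 := h.le'' _ (cos_mem (2 * Real.pi * x))
  have h3 := Real.abs_sin_le_one (2 * Real.pi * x)
  have h4 := Real.abs_cos_le_one (2 * Real.pi * x)
  have h5 := Real.pi_lt_d2
  have h5' := Real.pi_pos
  have h6 : |R₂ (Real.cos (2 * Real.pi * x)) * Real.sin (2 * Real.pi * x) ^ 2 -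
      R₁ (Real.cos (2 * Real.pi * x)) * Real.cos (2 * Real.pi * x)| ≤ 13 * 1 ^ 2 + 10 * 1 := by
    refine (abs_sub _ _).trans ?_
    rw [abs_mul, abs_mul, abs_pow]
    gcongr
  have h7 : (2 * Real.pi) ^ 2 ≤ 40 := by nlinarith
  have : (2 * Real.pi) ^ 2 * |R₂ (Real.cos (2 * Real.pi * x)) * Real.sin (2 * Real.pi * x) ^ 2 -
      R₁ (Real.cos (2 * Real.pi * x)) * Real.cos (2 * Real.pi * x)| ≤ 40 * (13 * 1 ^ 2 + 10 * 1) := by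
    gcongr
  gcongr
  linarith

theorem half_le_deriv_cosMap (h : IsProfile R R₁ R₂) (hε : 0 ≤ ε) (hε' : ε ≤ 1 / 2000) (x : ℝ) :
    1 / 2 ≤ deriv (cosMap ε R) x := by
  have := (abs_le.1 (h.abs_deriv_cosMap_sub_le hε x)).1
  linarith

theorem deriv_cosMap_pos (h : IsProfile R R₁ R₂) (hε : 0 ≤ ε) (hε' : ε ≤ 1 / 2000) (x : ℝ) :
    0 < deriv (cosMap ε R) x := by
  linarith [h.half_le_deriv_cosMap hε hε' x]

theorem abs_deriv_cosMap_sub_deriv_le (h : IsProfile R R₁ R₂) (hε : 0 ≤ ε) (x y : ℝ) :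
    |deriv (cosMap ε R) x - deriv (cosMap ε R) y| ≤ 1000 * ε * |x - y| := by
  have := Convex.norm_image_sub_le_of_norm_deriv_le (f := deriv (cosMap ε R)) (s := univ)
    (fun x _ => (h.hasDerivAt_deriv_cosMap ε x).differentiableAt)
    (fun x _ => h.abs_deriv_deriv_cosMap_le hε x) convex_univ (mem_univ y) (mem_univ x)
  simpa using this

/-- This supplies the Lipschitz constant `M = 2000 * ε` of the distortion estimates: the derivative
stays above `1 / 2`, where `log` is `2`-Lipschitz. -/
theorem abs_log_deriv_cosMap_sub_le (h : IsProfile R R₁ R₂) (hε : 0 ≤ ε) (hε' : ε ≤ 1 / 2000)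
    (x y : ℝ) : |Real.log (deriv (cosMap ε R) x) - Real.log (deriv (cosMap ε R) y)| ≤
      2000 * ε * |x - y| := by
  refine (Real.abs_log_sub_log_le (by norm_num : (0 : ℝ) < 1 / 2) (h.half_le_deriv_cosMap hε hε' x)
    (h.half_le_deriv_cosMap hε hε' y)).trans ?_
  linarith [h.abs_deriv_cosMap_sub_deriv_le hε x y]

theorem cosMap_zero (h : IsProfile R R₁ R₂) : cosMap ε R 0 = 0 := by simp [cosMap, h.zero]

theorem deriv_cosMap_zero (h : IsProfile R R₁ R₂) : deriv (cosMap ε R) 0 = 1 := by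
  simp [h.deriv_cosMap]

theorem deriv_deriv_cosMap_zero (h : IsProfile R R₁ R₂) : deriv (deriv (cosMap ε R)) 0 = 0 := by
  simp [h.deriv_deriv_cosMap, h.zero']

theorem cosMap_eq_self_iff (h : IsProfile R R₁ R₂) (hε : 0 < ε) (x : ℝ) :
    cosMap ε R x = x ↔ ∃ n : ℤ, (n : ℝ) = x := by
  rw [cosMap, add_eq_left, mul_eq_zero, or_iff_right hε.ne']
  have hpi := Real.pi_pos
  have h1 : R (Real.cos (2 * Real.pi * x)) = 0 ↔ Real.cos (2 * Real.pi * x) = 1 := by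
    refine ⟨fun h0 => ?_, fun h0 => by rw [h0, h.zero]⟩
    by_contra hne
    exact (h.pos _ ⟨(cos_mem _).1, lt_of_le_of_ne (cos_mem _).2 hne⟩).ne' h0
  rw [h1, Real.cos_eq_one_iff]
  refine exists_congr fun n => ?_
  rw [mul_comm, mul_right_inj' (by positivity)]

theorem lt_cosMap (h : IsProfile R R₁ R₂) (hε : 0 < ε) (x : ℝ) (hx : x ∈ Ioo (0 : ℝ) 1) :
    x < cosMap ε R x := by
  have h1 : cosMap ε R x ≠ x := fun h0 => by
    obtain ⟨n, rfl⟩ := (h.cosMap_eq_self_iff hε x).1 h0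
    have h2 : (0 : ℤ) < n := by exact_mod_cast hx.1
    have h3 : n < (1 : ℤ) := by exact_mod_cast hx.2
    lia
  refine lt_of_le_of_ne ?_ h1.symm
  rw [cosMap, le_add_iff_nonneg_right]
  rcases eq_or_lt_of_le (Real.cos_le_one (2 * Real.pi * x)) with h0 | h0
  · simp [h0, h.zero]
  · exact (mul_pos hε (h.pos _ ⟨(cos_mem _).1, h0⟩)).le

theorem continuous_cosMap (h : IsProfile R R₁ R₂) : Continuous (cosMap ε R) :=
  continuous_iff_continuousAt.2 fun x => (h.hasDerivAt_cosMap ε x).continuousAt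

theorem contDiff_cosMap (h : IsProfile R R₁ R₂) : ContDiff ℝ 1 (cosMap ε R) := by
  rw [contDiff_one_iff_deriv]
  exact ⟨fun x => (h.hasDerivAt_cosMap ε x).differentiableAt, continuous_iff_continuousAt.2
    fun x => (h.hasDerivAt_deriv_cosMap ε x).continuousAt⟩

theorem exists_isLift (h : IsProfile R R₁ R₂) (hε : 0 ≤ ε) (hε' : ε ≤ 1 / 2000) :
    ∃ f : DiffAC, IsLift (cosMap ε R) f.1 := by
  obtain ⟨f, hf⟩ := IsLift.exists_perm h.continuous_cosMap
    (strictMono_of_deriv_pos (h.deriv_cosMap_pos hε hε')) (cosMap_add_one ε R)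
  have hlip : LipschitzWith (Real.toNNReal (1000 * ε)) (deriv (cosMap ε R)) :=
    LipschitzWith.of_dist_le_mul fun x y => by
      rw [Real.dist_eq, Real.dist_eq, Real.coe_toNNReal _ (by positivity)]
      exact h.abs_deriv_cosMap_sub_deriv_le hε x y
  exact ⟨⟨f, _, hf, h.contDiff_cosMap, h.deriv_cosMap_pos hε hε', fun a b =>
    hlip.lipschitzOnWith.absolutelyContinuousOnInterval⟩, hf⟩

theorem edist_one_le (h : IsProfile R R₁ R₂) (hε : 0 ≤ ε) {f : DiffAC}
    (hf : IsLift (cosMap ε R) f.1) : edist f 1 ≤ ENNReal.ofReal (1077 * ε) := by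
  refine (hf.edist_diffAC_le (g := 1) IsLift.one).trans ?_
  rw [show 1077 * ε = 7 * ε + 70 * ε + 1000 * ε by ring, ENNReal.ofReal_add (by positivity)
    (by positivity), ENNReal.ofReal_add (by positivity) (by positivity)]
  refine add_le_add (add_le_add (iSup_le fun x => ?_) (iSup_le fun x => ?_)) ?_
  · rw [edist_dist, Real.dist_eq]
    exact ENNReal.ofReal_le_ofReal (h.abs_cosMap_sub_le hε x)
  · rw [edist_dist, Real.dist_eq, deriv_id]
    exact ENNReal.ofReal_le_ofReal (h.abs_deriv_cosMap_sub_le hε x)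
  · refine (lintegral_mono (g := fun _ => ENNReal.ofReal (1000 * ε)) fun x => ?_).trans (by simp)
    rw [edist_dist, Real.dist_eq, deriv_id', deriv_const', sub_zero]
    exact ENNReal.ofReal_le_ofReal (h.abs_deriv_deriv_cosMap_le hε x)

end IsProfile

/-! ### Polynomial approximation in `C²` -/

theorem Polynomial.exists_derivative_eq (p : Polynomial ℝ) :
    ∃ q : Polynomial ℝ, Polynomial.derivative q = p := by
  induction p using Polynomial.induction_on' with
  | add p q hp hq =>
    obtain ⟨P, rfl⟩ := hp
    obtain ⟨Q, rfl⟩ := hq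
    exact ⟨P + Q, Polynomial.derivative_add⟩
  | monomial n a =>
    refine ⟨Polynomial.monomial (n + 1) (a / (n + 1)), ?_⟩
    rw [Polynomial.derivative_monomial, Nat.add_sub_cancel, Nat.cast_add, Nat.cast_one,
      div_mul_cancel₀ _ (by positivity)]

theorem Polynomial.exists_antiderivative_near {G G' : ℝ → ℝ} (hG : ∀ u, HasDerivAt G (G' u) u)
    {η : ℝ} {p : Polynomial ℝ} (hp : ∀ u ∈ Icc (-1 : ℝ) 1, |p.eval u - G' u| ≤ η) :
    ∃ q : Polynomial ℝ, Polynomial.derivative q = p ∧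
      ∀ u ∈ Icc (-1 : ℝ) 1, |q.eval u - G u| ≤ 2 * η := by
  obtain ⟨q, hq⟩ := p.exists_derivative_eq
  refine ⟨q + Polynomial.C (G (-1) - q.eval (-1)), by simp [hq], fun u hu => ?_⟩
  have h1 := Convex.norm_image_sub_le_of_norm_hasDerivWithin_le
    (f := fun u => q.eval u - G u) (f' := fun u => p.eval u - G' u) (s := Icc (-1 : ℝ) 1)
    (fun x _ => by
      have := (q.hasDerivAt x).sub (hG x)
      rw [hq] at this
      exact this.hasDerivWithinAt) hp (convex_Icc _ _) (left_mem_Icc.2 (by norm_num)) hu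
  have hη : 0 ≤ η := (abs_nonneg _).trans (hp u hu)
  rw [Real.norm_eq_abs, Real.norm_eq_abs, abs_of_nonneg (by linarith [hu.1] : 0 ≤ u - -1)] at h1
  calc _ = |q.eval u - G u - (q.eval (-1) - G (-1))| := by
        rw [Polynomial.eval_add, Polynomial.eval_C]
        ring_nf
    _ ≤ η * (u - -1) := h1
    _ ≤ 2 * η := by nlinarith [hu.2]

/-- Weierstrass approximation of the second derivative, integrated twice; each integration over an
interval of length `2` doubles the error, whence `δ / 4`. -/
theorem Polynomial.exists_near_of_hasDerivAt {P P₁ P₂ : ℝ → ℝ} (h : ∀ u, HasDerivAt P (P₁ u) u)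
    (h' : ∀ u, HasDerivAt P₁ (P₂ u) u) (hc : Continuous P₂) {δ : ℝ} (hδ : 0 < δ) :
    ∃ p : Polynomial ℝ, ∀ u ∈ Icc (-1 : ℝ) 1, |p.eval u - P u| ≤ δ ∧
      |(Polynomial.derivative p).eval u - P₁ u| ≤ δ ∧
      |(Polynomial.derivative (Polynomial.derivative p)).eval u - P₂ u| ≤ δ := by
  obtain ⟨p₂, h2⟩ := exists_polynomial_near_of_continuousOn (-1) 1 P₂ hc.continuousOn (δ / 4)
    (by positivity)
  obtain ⟨p₁, rfl, h1⟩ := Polynomial.exists_antiderivative_near h' fun u hu => (h2 u hu).le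
  obtain ⟨p, rfl, h0⟩ := Polynomial.exists_antiderivative_near h h1
  refine ⟨p, fun u hu => ⟨(h0 u hu).trans ?_, (h1 u hu).trans ?_, (h2 u hu).le.trans ?_⟩⟩ <;>
    linarith

/-! ### A `C²` function with prescribed support -/

theorem hasDerivAt_max_pow (n : ℕ) (t : ℝ) :
    HasDerivAt (fun t : ℝ => max 0 t ^ (n + 2)) ((n + 2) * max 0 t ^ (n + 1)) t := by
  have hn : ∀ s ≤ (0 : ℝ), HasDerivWithinAt (fun t : ℝ => max 0 t ^ (n + 2)) 0 (Iic 0) s :=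
    fun s hs => (hasDerivWithinAt_const s _ (0 : ℝ)).congr
      (fun x hx => by simp [max_eq_left (mem_Iic.1 hx)]) (by simp [max_eq_left hs])
  have hp : ∀ s, (0 : ℝ) ≤ s → HasDerivWithinAt (fun t : ℝ => max 0 t ^ (n + 2))
      ((n + 2) * s ^ (n + 1)) (Ici 0) s := fun s hs => by
    refine HasDerivWithinAt.congr ?_ (fun x hx => by rw [max_eq_right (mem_Ici.1 hx)])
      (by rw [max_eq_right hs])
    simpa using (hasDerivAt_pow (n + 2) s).hasDerivWithinAt
  rcases lt_trichotomy t 0 with ht | rfl | ht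
  · simpa [max_eq_left ht.le] using (hn t ht.le).hasDerivAt (Iic_mem_nhds ht)
  · have h1 := hp 0 le_rfl
    have h2 := hn 0 le_rfl
    simp only [max_self]
    rw [zero_pow (by lia), mul_zero] at h1 ⊢
    simpa using h2.union h1
  · simpa [max_eq_right ht.le] using (hp t ht.le).hasDerivAt (Ici_mem_nhds ht)

/-- The function is `(u₀ - u)₊³ (u - u₁) / 100`: the cube makes the cutoff `C²`, and the linear
factor gives a simple zero at `u₁`. On `[-1, 1]` the largest of the three bounds is `48 / 100`. -/
theorem exists_perturbation {u₀ u₁ : ℝ} (h₀ : u₀ ∈ Icc (-1 : ℝ) 1) (h₁ : u₁ ∈ Icc (-1 : ℝ) 1)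
    (h : u₁ < u₀) : ∃ P P₁ P₂ : ℝ → ℝ, (∀ u, HasDerivAt P (P₁ u) u) ∧
      (∀ u, HasDerivAt P₁ (P₂ u) u) ∧ Continuous P₂ ∧
      (∀ u ∈ Icc (-1 : ℝ) 1, |P u| ≤ 1 / 2 ∧ |P₁ u| ≤ 1 / 2 ∧ |P₂ u| ≤ 1 / 2) ∧
      (∀ u, u₀ ≤ u → P u = 0 ∧ P₁ u = 0) ∧ P u₁ = 0 ∧ P₁ u₁ ≠ 0 := by
  have hd : ∀ (n : ℕ) u, HasDerivAt (fun u => max 0 (u₀ - u) ^ (n + 2))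
      (-((n + 2) * max 0 (u₀ - u) ^ (n + 1))) u := fun n u => by
    simpa [Function.comp_def] using
      (hasDerivAt_max_pow n (u₀ - u)).comp u ((hasDerivAt_id u).const_sub u₀)
  have hl : ∀ u, HasDerivAt (fun u : ℝ => u - u₁) 1 u := fun u => (hasDerivAt_id u).sub_const u₁
  refine ⟨fun u => 1 / 100 * (max 0 (u₀ - u) ^ 3 * (u - u₁)),
    fun u => 1 / 100 * (-(3 * max 0 (u₀ - u) ^ 2) * (u - u₁) + max 0 (u₀ - u) ^ 3),
    fun u => 1 / 100 * (6 * max 0 (u₀ - u) * (u - u₁) - 6 * max 0 (u₀ - u) ^ 2),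
    fun u => ?_, fun u => ?_, by fun_prop, fun u hu => ?_, fun u hu => ?_, by simp, ?_⟩
  · convert! ((hd 1 u).mul (hl u)).const_mul (1 / 100) using 1
    push_cast
    ring
  · convert! ((((hd 0 u).const_mul (-3)).mul (hl u)).add (hd 1 u)).const_mul (1 / 100) using 1
    · ext u
      simp
    · push_cast
      ring
  · have m0 : 0 ≤ max 0 (u₀ - u) := le_max_left _ _
    have m2 : max 0 (u₀ - u) ≤ 2 := max_le (by norm_num) (by linarith [h₀.2, hu.1])
    have l1 : |u - u₁| ≤ 2 := abs_le.2 ⟨by linarith [h₁.2, hu.1], by linarith [h₁.1, hu.2]⟩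
    have p2 : max 0 (u₀ - u) ^ 2 ≤ 2 ^ 2 := by gcongr
    have p3 : max 0 (u₀ - u) ^ 3 ≤ 2 ^ 3 := by gcongr
    have a1 : max 0 (u₀ - u) * |u - u₁| ≤ 2 * 2 := by gcongr
    have a2 : max 0 (u₀ - u) ^ 2 * |u - u₁| ≤ 2 ^ 2 * 2 := by gcongr
    have a3 : max 0 (u₀ - u) ^ 3 * |u - u₁| ≤ 2 ^ 3 * 2 := by gcongr
    dsimp only
    generalize max 0 (u₀ - u) = w at *
    refine ⟨?_, ?_, ?_⟩
    · rw [abs_mul, abs_mul, abs_of_nonneg (pow_nonneg m0 3), abs_of_pos (by norm_num)]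
      linarith
    · rw [abs_mul, abs_of_pos (by norm_num)]
      have := abs_add_le (-(3 * w ^ 2) * (u - u₁)) (w ^ 3)
      rw [abs_mul, abs_neg, abs_of_nonneg (by positivity : 0 ≤ 3 * w ^ 2),
        abs_of_nonneg (pow_nonneg m0 3)] at this
      linarith
    · rw [abs_mul, abs_of_pos (by norm_num)]
      have := abs_sub (6 * w * (u - u₁)) (6 * w ^ 2)
      rw [abs_mul, abs_of_nonneg (by positivity : 0 ≤ 6 * w),
        abs_of_nonneg (by positivity : 0 ≤ 6 * w ^ 2)] at this
      linarith
  · have : max 0 (u₀ - u) = 0 := max_eq_left (by linarith)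
    simp [this]
  · have : 0 < max 0 (u₀ - u₁) := lt_max_of_lt_right (by linarith)
    simp [this.ne']

/-! ### Two maps that differ along one orbit -/

section Gap

theorem tendsto_iterate_of_lt {F : ℝ → ℝ} (hc : Continuous F)
    (hI : ∀ x ∈ Ioo (0 : ℝ) 1, F x ∈ Ioo (0 : ℝ) 1) (hlt : ∀ x ∈ Ioo (0 : ℝ) 1, x < F x) {a : ℝ}
    (ha : a ∈ Ioo (0 : ℝ) 1) : Tendsto (fun n => F^[n] a) atTop (𝓝 1) := by
  have hmem : ∀ n, F^[n] a ∈ Ioo (0 : ℝ) 1 := fun n => by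
    induction n with
    | zero => exact ha
    | succ n ih => rw [Function.iterate_succ_apply']; exact hI _ ih
  have hm : Monotone fun n => F^[n] a := monotone_nat_of_le_succ fun n => by
    rw [Function.iterate_succ_apply']
    exact (hlt _ (hmem n)).le
  have hlim := tendsto_atTop_ciSup hm ⟨1, by rintro _ ⟨n, rfl⟩; exact (hmem n).2.le⟩
  have hfix := isFixedPt_of_tendsto_iterate hlim hc.continuousAt
  have h1 := le_of_tendsto' hlim fun n => (hmem n).2.le
  have h2 : 0 < ⨆ n, F^[n] a := ha.1.trans_le (ge_of_tendsto' hlim fun n => hm n.zero_le)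
  rcases h1.eq_or_lt with h3 | h3
  · rwa [h3] at hlim
  · exact absurd hfix (hlt _ ⟨h2, h3⟩).ne'

theorem iterate_eq_of_forall_orbit {α : Type*} {F₀ F₁ : α → α} {x : α}
    (h : ∀ i, F₁ (F₀^[i] x) = F₀ (F₀^[i] x)) (n : ℕ) : F₁^[n] x = F₀^[n] x := by
  induction n with
  | zero => rfl
  | succ n ih => rw [Function.iterate_succ_apply', Function.iterate_succ_apply', ih, h]

theorem birkhoffSum_sub_eq_sum {α : Type*} {F₀ F₁ : α → α} {x : α} (ψ₀ ψ₁ : α → ℝ)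
    (h : ∀ i, F₁ (F₀^[i] x) = F₀ (F₀^[i] x)) (n : ℕ) :
    birkhoffSum F₁ ψ₁ n x - birkhoffSum F₀ ψ₀ n x =
      ∑ i ∈ Finset.range n, (ψ₁ (F₀^[i] x) - ψ₀ (F₀^[i] x)) := by
  simp only [birkhoffSum, iterate_eq_of_forall_orbit h, Finset.sum_sub_distrib]

/-- The maps differ only inside `(a, a')`, which lies in the fundamental domain starting at `a`, and
they agree at `y`. The orbits of `a` and `y` are therefore common to both maps, while the Birkhoff
sums along the orbit of `y` differ by `ψ₁ y - ψ₀ y`. The two distortions cannot both be small. -/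
theorem exists_gap (e : ℝ ≃o ℝ) (h0 : e 0 = 0) (h1 : e 1 = 1)
    (hlt : ∀ x ∈ Ioo (0 : ℝ) 1, x < e x) {F : ℝ → ℝ} {ψ₀ ψ₁ : ℝ → ℝ} {a y a' M : ℝ} (hM : 0 ≤ M)
    (ha : 0 < a) (hay : a < y) (hya : y < a') (ha' : a' ≤ e a) (ha1 : a' < 1)
    (hl : ∀ x ∈ Icc 0 a, F x = e x ∧ ψ₁ x = ψ₀ x) (hr : ∀ x ∈ Icc a' 1, F x = e x ∧ ψ₁ x = ψ₀ x)
    (hy : F y = e y) (hψ : ψ₁ y ≠ ψ₀ y) :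
    ∃ b ∈ Ioo (0 : ℝ) 1, ∃ z, b < z ∧ ∃ m,
      (z < e b ∧ M * (1 - e^[m] b) + M * b < |birkhoffSum e ψ₀ m z - birkhoffSum e ψ₀ m b|) ∨
      (z < F b ∧ M * (1 - F^[m] b) + M * b < |birkhoffSum F ψ₁ m z - birkhoffSum F ψ₁ m b|) := by
  have hI : ∀ x ∈ Ioo (0 : ℝ) 1, e x ∈ Ioo (0 : ℝ) 1 := fun x hx =>
    ⟨by simpa [h0] using e.strictMono hx.1, by simpa [h1] using e.strictMono hx.2⟩
  have hs0 : e.symm 0 = 0 := by rw [OrderIso.symm_apply_eq, h0]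
  have hs1 : e.symm 1 = 1 := by rw [OrderIso.symm_apply_eq, h1]
  have hsI : ∀ x ∈ Ioo (0 : ℝ) 1, e.symm x ∈ Ioo (0 : ℝ) 1 := fun x hx =>
    ⟨by simpa [hs0] using e.symm.strictMono hx.1, by simpa [hs1] using e.symm.strictMono hx.2⟩
  have haI : a ∈ Ioo (0 : ℝ) 1 := ⟨ha, by linarith⟩
  have hyI : y ∈ Ioo (0 : ℝ) 1 := ⟨by linarith, by linarith⟩
  have hsIn : ∀ x ∈ Ioo (0 : ℝ) 1, ∀ n, e.symm^[n] x ∈ Ioo (0 : ℝ) 1 := fun x hx n => by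
    induction n with
    | zero => exact hx
    | succ n ih => rw [Function.iterate_succ_apply']; exact hsI _ ih
  have hIn : ∀ x ∈ Ioo (0 : ℝ) 1, ∀ n, e^[n] x ∈ Ioo (0 : ℝ) 1 := fun x hx n => by
    induction n with
    | zero => exact hx
    | succ n ih => rw [Function.iterate_succ_apply']; exact hI _ ih
  have hmono : ∀ x ∈ Ioo (0 : ℝ) 1, Monotone fun n => e^[n] x := fun x hx =>
    monotone_nat_of_le_succ fun n => by
      rw [Function.iterate_succ_apply']
      exact (hlt _ (hIn x hx n)).le
  have hinv : ∀ n x, e^[n] (e.symm^[n] x) = x := fun n x =>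
    (Function.LeftInverse.iterate e.apply_symm_apply n) x
  have t1 : Tendsto (fun n => e^[n] a) atTop (𝓝 1) :=
    tendsto_iterate_of_lt e.continuous hI hlt haI
  have t2 : Tendsto (fun n => e.symm^[n] a) atTop (𝓝 0) := by
    -- Conjugation by `x ↦ 1 - x` turns the inverse map into one that moves points to the right.
    have hconj : ∀ n x, (fun x => 1 - e.symm (1 - x))^[n] (1 - x) = 1 - e.symm^[n] x := fun n x => by
      induction n with
      | zero => rfl
      | succ n ih =>
        rw [Function.iterate_succ_apply', Function.iterate_succ_apply', ih, sub_sub_cancel]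
    have := tendsto_iterate_of_lt (F := fun x => 1 - e.symm (1 - x)) (a := 1 - a)
      (continuous_const.sub (e.symm.continuous.comp (continuous_const.sub continuous_id)))
      (fun x hx => by
        have := hsI (1 - x) ⟨by linarith [hx.2], by linarith [hx.1]⟩
        exact ⟨by linarith [this.2], by linarith [this.1]⟩)
      (fun x hx => by
        have h2 : (1 - x) ∈ Ioo (0 : ℝ) 1 := ⟨by linarith [hx.2], by linarith [hx.1]⟩
        have h3 := hlt _ (hsI _ h2)
        rw [e.apply_symm_apply] at h3
        linarith) ⟨by linarith [haI.2], by linarith⟩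
    simp only [hconj] at this
    simpa using this.const_sub 1
  have t3 : Tendsto (fun n => M * (1 - e^[n] a) + M * e.symm^[n] a) atTop (𝓝 0) := by
    simpa using ((t1.const_sub 1).const_mul M).add (t2.const_mul M)
  have hκ : 0 < |ψ₁ y - ψ₀ y| := abs_pos.2 (sub_ne_zero.2 hψ)
  -- Starting `n` steps before `a` and ending at least `n` steps after it brings the endpoints of
  -- the orbit so close to `0` and `1` that the error terms fall below half the discrepancy at `y`.
  obtain ⟨n, hn⟩ := (t3.eventually_lt_const (half_pos hκ)).exists
  have hbI := hsIn a haI n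
  have hzI := hsIn y hyI n
  set b := e.symm^[n] a with hb
  set z := e.symm^[n] y with hz
  have hnb : e^[n] b = a := hinv n a
  have hnz : e^[n] z = y := hinv n y
  -- both orbits avoid the region where the maps differ, except for `y`
  have horb : ∀ i, e^[i] b ∈ Icc 0 a ∨ e^[i] b ∈ Icc a' 1 := fun i => by
    rcases le_or_gt i n with hi | hi
    · exact Or.inl ⟨(hIn b hbI i).1.le, hnb ▸ hmono b hbI hi⟩
    · refine Or.inr ⟨ha'.trans ?_, (hIn b hbI i).2.le⟩
      have : e^[n + 1] b ≤ e^[i] b := hmono b hbI hi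
      rwa [Function.iterate_succ_apply', hnb] at this
  have horbz : ∀ i, i ≠ n → e^[i] z ∈ Icc 0 a ∨ e^[i] z ∈ Icc a' 1 := fun i hin => by
    rcases lt_or_gt_of_ne hin with hi | hi
    · refine Or.inl ⟨(hIn z hzI i).1.le, ?_⟩
      have h2 : e^[i + 1] z ≤ e^[n] z := hmono z hzI hi
      rw [Function.iterate_succ_apply', hnz] at h2
      exact e.le_iff_le.1 (h2.trans (hya.le.trans ha'))
    · refine Or.inr ⟨ha'.trans ?_, (hIn z hzI i).2.le⟩
      have h2 : e^[n + 1] z ≤ e^[i] z := hmono z hzI hi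
      rw [Function.iterate_succ_apply', hnz] at h2
      exact (e.monotone hay.le).trans h2
  have hgood : ∀ x, x ∈ Icc 0 a ∨ x ∈ Icc a' 1 → F x = e x ∧ ψ₁ x = ψ₀ x := fun x hx =>
    hx.elim (hl x) (hr x)
  have hFb : ∀ i, F (e^[i] b) = e (e^[i] b) := fun i => (hgood _ (horb i)).1
  have hFz : ∀ i, F (e^[i] z) = e (e^[i] z) := fun i => by
    by_cases hi : i = n
    · rw [hi, hnz, hy]
    · exact (hgood _ (horbz i hi)).1
  have hm : e^[n + n] b = e^[n] a := by rw [Function.iterate_add_apply, hnb]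
  have hbz : b < z := e.symm.strictMono.iterate n hay
  have hzb : z < e b := by
    refine (e.strictMono.iterate n).lt_iff_lt.1 ?_
    rw [hnz, ← Function.iterate_succ_apply, Function.iterate_succ_apply', hnb]
    exact hya.trans_le ha'
  have hdb := birkhoffSum_sub_eq_sum ψ₀ ψ₁ hFb (n + n + 1)
  rw [Finset.sum_eq_zero fun i _ => by rw [(hgood _ (horb i)).2, sub_self]] at hdb
  have hdz := birkhoffSum_sub_eq_sum ψ₀ ψ₁ hFz (n + n + 1)
  rw [Finset.sum_eq_single n (fun i _ hi => by rw [(hgood _ (horbz i hi)).2, sub_self])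
    (fun h => absurd (Finset.mem_range.2 (by lia)) h), hnz] at hdz
  have hmle : e^[n] a ≤ e^[n + n + 1] b := hm ▸ hmono b hbI (Nat.le_succ _)
  have hs : M * (1 - e^[n + n + 1] b) + M * b < |ψ₁ y - ψ₀ y| / 2 := by
    refine lt_of_le_of_lt ?_ hn
    gcongr
  refine ⟨b, hbI, z, hbz, n + n + 1, ?_⟩
  have hFb0 : F b = e b := hFb 0
  rw [iterate_eq_of_forall_orbit hFb, hFb0]
  -- If both distortions were below the error terms, their difference `ψ₁ y - ψ₀ y` would be smaller
  -- than itself in absolute value.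
  by_contra! hcon
  have c1 := hcon.1 hzb
  have c2 := hcon.2 hzb
  have c3 := abs_sub (birkhoffSum F ψ₁ (n + n + 1) z - birkhoffSum F ψ₁ (n + n + 1) b)
    (birkhoffSum e ψ₀ (n + n + 1) z - birkhoffSum e ψ₀ (n + n + 1) b)
  rw [show birkhoffSum F ψ₁ (n + n + 1) z - birkhoffSum F ψ₁ (n + n + 1) b -
    (birkhoffSum e ψ₀ (n + n + 1) z - birkhoffSum e ψ₀ (n + n + 1) b) = ψ₁ y - ψ₀ y by linarith] at c3
  linarith

end Gap

/-! ### An analytic example -/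

section Convergence

/-- Convergence along convergent sequences is stable under iteration. It makes a gap at a fixed time
`m` an open condition. -/
theorem tendsto_birkhoffSum {F : ℝ → ℝ} {ψ : ℝ → ℝ} {Fs ψs : ℕ → ℝ → ℝ}
    (hF : ∀ (u : ℕ → ℝ) x, Tendsto u atTop (𝓝 x) → Tendsto (fun n => Fs n (u n)) atTop (𝓝 (F x)))
    (hψ : ∀ (u : ℕ → ℝ) x, Tendsto u atTop (𝓝 x) → Tendsto (fun n => ψs n (u n)) atTop (𝓝 (ψ x)))
    (m : ℕ) (x : ℝ) : Tendsto (fun n => (Fs n)^[m] x) atTop (𝓝 (F^[m] x)) ∧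
      Tendsto (fun n => birkhoffSum (Fs n) (ψs n) m x) atTop (𝓝 (birkhoffSum F ψ m x)) := by
  induction m with
  | zero => simp
  | succ m ih =>
    simp only [Function.iterate_succ_apply', birkhoffSum_succ]
    exact ⟨hF _ _ ih.1, ih.2.add (hψ _ _ ih.1)⟩

theorem tendsto_apply_of_abs_sub_le {G : ℝ → ℝ} (hG : Continuous G) {Gs : ℕ → ℝ → ℝ} {δ : ℕ → ℝ}
    (hδ : Tendsto δ atTop (𝓝 0)) {s : Set ℝ} (h : ∀ n, ∀ u ∈ s, |Gs n u - G u| ≤ δ n) {v : ℕ → ℝ}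
    {x : ℝ} (hv : Tendsto v atTop (𝓝 x)) (hs : ∀ n, v n ∈ s) :
    Tendsto (fun n => Gs n (v n)) atTop (𝓝 (G x)) := by
  have h1 : Tendsto (fun n => Gs n (v n) - G (v n)) atTop (𝓝 0) :=
    squeeze_zero_norm (fun n => h n _ (hs n)) hδ
  simpa using h1.add ((hG.tendsto x).comp hv)

end Convergence

/-- The variation of `log (cosMap ε R)'` accumulated along an orbit segment of length `m` exceeds
the distortion bound for the rest of the orbit. -/
def HasDistortionGap (ε : ℝ) (R : ℝ → ℝ) : Prop :=
  ∃ b ∈ Ioo (0 : ℝ) 1, ∃ z, b < z ∧ z < cosMap ε R b ∧ ∃ m,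
    2000 * ε * (1 - (cosMap ε R)^[m] b) + 2000 * ε * b <
      |birkhoffSum (cosMap ε R) (fun x => Real.log (deriv (cosMap ε R) x)) m z -
        birkhoffSum (cosMap ε R) (fun x => Real.log (deriv (cosMap ε R) x)) m b|

theorem exists_hasDistortionGap {ε : ℝ} (hε : 0 < ε) (hε' : ε ≤ 1 / 2000) :
    ∃ P P₁ P₂ : ℝ → ℝ, (∀ u, HasDerivAt P (P₁ u) u) ∧ (∀ u, HasDerivAt P₁ (P₂ u) u) ∧
      Continuous P₂ ∧ (∀ u ∈ Icc (-1 : ℝ) 1, |P u| ≤ 1 / 2 ∧ |P₁ u| ≤ 1 / 2 ∧ |P₂ u| ≤ 1 / 2) ∧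
      HasDistortionGap ε fun u => (1 - u) ^ 2 * (1 + P u) := by
  have hpi := Real.pi_pos
  -- The maps differ only in `(a, 1 - a)`, of length `ε`, and the unperturbed map moves `a` by `ε (1
  -- - cos 2πa)² ≥ ε`, so this interval fits in one fundamental domain. The point `y` is off the
  -- centre `1 / 2` so that `sin 2πy ≠ 0` and a change in `P₁` is seen by the derivative.
  set a : ℝ := 1 / 2 - ε / 2 with ha
  set y : ℝ := 1 / 2 + ε / 4 with hy
  have hcos : ∀ x, 1 - a ≤ x → Real.cos (2 * Real.pi * x) = Real.cos (2 * Real.pi * (1 - x)) :=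
    fun x _ => by rw [← Real.cos_two_pi_sub]; ring_nf
  have hsym : ∀ x ∈ Icc 0 a,
      Real.cos (2 * Real.pi * a) ≤ Real.cos (2 * Real.pi * x) := fun x hx =>
    Real.cos_le_cos_of_nonneg_of_le_pi (by have := hx.1; positivity)
      (by nlinarith) (by have := hx.2; gcongr)
  have hsym' : ∀ x ∈ Icc (1 - a) 1,
      Real.cos (2 * Real.pi * a) ≤ Real.cos (2 * Real.pi * x) := fun x hx => by
    rw [hcos x hx.1]
    exact hsym _ ⟨by linarith [hx.2], by linarith [hx.1]⟩
  have hya : Real.cos (2 * Real.pi * y) < Real.cos (2 * Real.pi * a) := by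
    rw [← Real.cos_two_pi_sub]
    exact Real.cos_lt_cos_of_nonneg_of_le_pi (by have : 0 < a := by linarith
                                                 positivity)
      (by nlinarith) (by nlinarith)
  obtain ⟨P, P₁, P₂, hP, hP₁, hP₂, hb, hsupp, hPy, hPy₁⟩ :=
    exists_perturbation (cos_mem (2 * Real.pi * a)) (cos_mem (2 * Real.pi * y)) hya
  have prof₀ := isProfile_of_perturbation (P := fun _ => 0) (P₁ := fun _ => 0) (P₂ := fun _ => 0)
    (fun u => hasDerivAt_const u 0) (fun u => hasDerivAt_const u 0) (fun u _ => by norm_num)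
  have prof₁ := isProfile_of_perturbation hP hP₁ fun u hu =>
    ⟨(hb u hu).1.trans (by norm_num), (hb u hu).2.1.trans (by norm_num),
      (hb u hu).2.2.trans (by norm_num)⟩
  obtain ⟨f, hf⟩ := prof₀.exists_isLift hε.le hε'
  have hmono := strictMono_of_deriv_pos (prof₀.deriv_cosMap_pos hε.le hε')
  obtain ⟨e', he', -⟩ := hf.exists_homeomorph hmono
  set R₀ : ℝ → ℝ := fun u => (1 - u) ^ 2 * (1 + 0) with hR₀
  set R : ℝ → ℝ := fun u => (1 - u) ^ 2 * (1 + P u) with hR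
  let e : ℝ ≃o ℝ := hmono.orderIsoOfSurjective _ (he' ▸ e'.surjective)
  have he : (e : ℝ → ℝ) = cosMap ε R₀ := rfl
  have h0 : cosMap ε R₀ 0 = 0 := prof₀.cosMap_zero
  have h1 : cosMap ε R₀ 1 = 1 := by
    have := cosMap_add_one ε R₀ 0
    rwa [h0, zero_add] at this
  have hagree : ∀ x, Real.cos (2 * Real.pi * a) ≤ Real.cos (2 * Real.pi * x) →
      cosMap ε R x = cosMap ε R₀ x ∧
        Real.log (deriv (cosMap ε R) x) = Real.log (deriv (cosMap ε R₀) x) := fun x hx => by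
    refine ⟨by simp [cosMap, hR, hR₀, (hsupp _ hx).1], ?_⟩
    rw [prof₀.deriv_cosMap, prof₁.deriv_cosMap]
    simp [(hsupp _ hx).1, (hsupp _ hx).2]
  obtain ⟨b, hbI, z, hbz, m, hm⟩ := exists_gap e h0 h1 (prof₀.lt_cosMap hε)
    (F := cosMap ε R) (ψ₀ := fun x => Real.log (deriv (cosMap ε R₀) x))
    (ψ₁ := fun x => Real.log (deriv (cosMap ε R) x)) (a := a) (y := y) (a' := 1 - a)
    (M := 2000 * ε) (by positivity) (by linarith) (by linarith) (by linarith)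
    (by
      have hc : Real.cos (2 * Real.pi * a) ≤ 0 :=
        Real.cos_nonpos_of_pi_div_two_le_of_le (by nlinarith) (by nlinarith)
      rw [he, cosMap, hR₀]
      nlinarith [mul_le_mul_of_nonneg_left hc hε.le,
        mul_nonneg hε.le (sq_nonneg (Real.cos (2 * Real.pi * a)))])
    (by linarith) (fun x hx => hagree x (hsym x hx)) (fun x hx => hagree x (hsym' x hx))
    (by simp [he, cosMap, hR, hR₀, hPy])
    (fun heq => by
      have h2 := Real.log_injOn_pos (prof₁.deriv_cosMap_pos hε.le hε' y)
        (prof₀.deriv_cosMap_pos hε.le hε' y) heq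
      have hs : Real.sin (2 * Real.pi * y) ≠ 0 := by
        rw [← neg_ne_zero, ← Real.sin_two_pi_sub]
        exact (Real.sin_pos_of_pos_of_lt_pi (by nlinarith) (by nlinarith)).ne'
      have hu : 1 - Real.cos (2 * Real.pi * y) ≠ 0 := by
        linarith [Real.cos_le_one (2 * Real.pi * a)]
      rw [prof₀.deriv_cosMap, prof₁.deriv_cosMap] at h2
      simp only [hPy, add_right_inj, mul_eq_mul_left_iff, hε.ne', or_false, mul_eq_mul_right_iff,
        mul_eq_zero, neg_eq_zero, hs, hpi.ne', add_zero, mul_zero] at h2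
      simp [hPy₁, hu] at h2)
  -- Which of the two profiles has the gap is not determined; either one serves.
  rcases hm with ⟨hz, hm⟩ | ⟨hz, hm⟩
  · exact ⟨fun _ => 0, fun _ => 0, fun _ => 0, fun u => hasDerivAt_const u 0,
      fun u => hasDerivAt_const u 0, continuous_const, fun u _ => by norm_num,
      b, hbI, z, hbz, hz, m, hm⟩
  · exact ⟨P, P₁, P₂, hP, hP₁, hP₂, hb, b, hbI, z, hbz, hz, m, hm⟩

/-- The gap consists of strict inequalities involving finitely many values of the map and its
derivative, so polynomials close to `P` in `C²` inherit it together with the profile bounds. -/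
theorem exists_polynomial_hasDistortionGap {ε : ℝ} (hε : 0 < ε) (hε' : ε ≤ 1 / 2000) :
    ∃ (p : Polynomial ℝ) (R₁ R₂ : ℝ → ℝ),
      IsProfile (fun u => (1 - u) ^ 2 * (1 + p.eval u)) R₁ R₂ ∧
      HasDistortionGap ε fun u => (1 - u) ^ 2 * (1 + p.eval u) := by
  obtain ⟨P, P₁, P₂, hP, hP₁, hP₂, hb, b, hbI, z, hbz, hz, m, hm⟩ :=
    exists_hasDistortionGap hε hε'
  have hδ0 : ∀ n : ℕ, 0 < 1 / ((n : ℝ) + 4) := fun n => by positivity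
  have hδ : Tendsto (fun n : ℕ => 1 / ((n : ℝ) + 4)) atTop (𝓝 0) :=
    tendsto_const_nhds.div_atTop
      (tendsto_atTop_add_const_right _ _ tendsto_natCast_atTop_atTop)
  choose p hp using fun n => Polynomial.exists_near_of_hasDerivAt hP hP₁ hP₂ (hδ0 n)
  have hδ4 : ∀ n : ℕ, 1 / ((n : ℝ) + 4) ≤ 1 / 4 := fun n => by
    gcongr
    linarith [n.cast_nonneg (α := ℝ)]
  have hclose : ∀ {x y δ : ℝ}, |x - y| ≤ δ → δ ≤ 1 / 4 → |y| ≤ 1 / 2 → |x| ≤ 3 / 4 :=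
    fun {x y δ} h1 h2 h3 => by
      have := abs_add_le (x - y) y
      rw [sub_add_cancel] at this
      linarith
  have prof : IsProfile (fun u => (1 - u) ^ 2 * (1 + P u)) _ _ :=
    isProfile_of_perturbation hP hP₁ fun u hu =>
      ⟨(hb u hu).1.trans (by norm_num), (hb u hu).2.1.trans (by norm_num),
        (hb u hu).2.2.trans (by norm_num)⟩
  have profs : ∀ n, IsProfile (fun u => (1 - u) ^ 2 * (1 + (p n).eval u)) _ _ := fun n =>
    isProfile_of_perturbation (fun u => (p n).hasDerivAt u)
      (fun u => (Polynomial.derivative (p n)).hasDerivAt u) fun u hu =>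
      ⟨hclose (hp n u hu).1 (hδ4 n) (hb u hu).1, hclose (hp n u hu).2.1 (hδ4 n) (hb u hu).2.1,
        hclose (hp n u hu).2.2 (hδ4 n) (hb u hu).2.2⟩
  have hcos : ∀ {u : ℕ → ℝ} {x}, Tendsto u atTop (𝓝 x) →
      Tendsto (fun n => Real.cos (2 * Real.pi * u n)) atTop (𝓝 (Real.cos (2 * Real.pi * x))) :=
    fun hu => (Real.continuous_cos.tendsto _).comp (hu.const_mul _)
  have hsin : ∀ {u : ℕ → ℝ} {x}, Tendsto u atTop (𝓝 x) →
      Tendsto (fun n => Real.sin (2 * Real.pi * u n)) atTop (𝓝 (Real.sin (2 * Real.pi * x))) :=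
    fun hu => (Real.continuous_sin.tendsto _).comp (hu.const_mul _)
  have hcP : Continuous P := continuous_iff_continuousAt.2 fun u => (hP u).continuousAt
  have hcP₁ : Continuous P₁ := continuous_iff_continuousAt.2 fun u => (hP₁ u).continuousAt
  have tP : ∀ {u : ℕ → ℝ} {x}, Tendsto u atTop (𝓝 x) →
      Tendsto (fun n => (p n).eval (Real.cos (2 * Real.pi * u n))) atTop
        (𝓝 (P (Real.cos (2 * Real.pi * x)))) := fun hu =>
    tendsto_apply_of_abs_sub_le hcP hδ (Gs := fun n u => (p n).eval u)
      (fun n u hu => (hp n u hu).1) (hcos hu) fun n => cos_mem _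
  have tP₁ : ∀ {u : ℕ → ℝ} {x}, Tendsto u atTop (𝓝 x) →
      Tendsto (fun n => (Polynomial.derivative (p n)).eval (Real.cos (2 * Real.pi * u n))) atTop
        (𝓝 (P₁ (Real.cos (2 * Real.pi * x)))) := fun hu =>
    tendsto_apply_of_abs_sub_le hcP₁ hδ (Gs := fun n u => (Polynomial.derivative (p n)).eval u)
      (fun n u hu => (hp n u hu).2.1) (hcos hu) fun n => cos_mem _
  set F : ℝ → ℝ := cosMap ε fun u => (1 - u) ^ 2 * (1 + P u) with hF
  set Fs : ℕ → ℝ → ℝ := fun n => cosMap ε fun u => (1 - u) ^ 2 * (1 + (p n).eval u) with hFs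
  have tF : ∀ (u : ℕ → ℝ) x, Tendsto u atTop (𝓝 x) →
      Tendsto (fun n => Fs n (u n)) atTop (𝓝 (F x)) := fun u x hu =>
    hu.add (((((hcos hu).const_sub 1).pow 2).mul ((tP hu).const_add 1)).const_mul ε)
  have tψ : ∀ (u : ℕ → ℝ) x, Tendsto u atTop (𝓝 x) →
      Tendsto (fun n => Real.log (deriv (Fs n) (u n))) atTop (𝓝 (Real.log (deriv F x))) :=
    fun u x hu => by
      refine Tendsto.log ?_ (prof.deriv_cosMap_pos hε.le hε' x).ne'
      simp only [hFs, hF, (profs _).deriv_cosMap, prof.deriv_cosMap]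
      exact ((((((hcos hu).const_sub 1).const_mul (-2)).mul ((tP hu).const_add 1)).add
        ((((hcos hu).const_sub 1).pow 2).mul (tP₁ hu))).mul
          ((hsin hu).const_mul (-(2 * Real.pi)))).const_mul ε |>.const_add 1
  have tb := tendsto_birkhoffSum (ψs := fun n x => Real.log (deriv (Fs n) x))
    (ψ := fun x => Real.log (deriv F x)) tF tψ m b
  have tz := tendsto_birkhoffSum (ψs := fun n x => Real.log (deriv (Fs n) x))
    (ψ := fun x => Real.log (deriv F x)) tF tψ m z
  have e1 := (tF _ _ tendsto_const_nhds).eventually_const_lt hz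
  have e2 := (((tb.1.const_sub 1).const_mul (2000 * ε)).add_const (2000 * ε * b)).eventually_lt
    (tz.2.sub tb.2).abs hm
  obtain ⟨n, hn1, hn2⟩ := (e1.and e2).exists
  exact ⟨p n, _, _, profs n, b, hbI, z, hbz, hn1, m, hn2⟩

theorem analyticOnNhd_cosMap (ε : ℝ) (p : Polynomial ℝ) :
    AnalyticOnNhd ℝ (cosMap ε fun u => (1 - u) ^ 2 * (1 + p.eval u)) univ := by
  have h : AnalyticOnNhd ℝ (fun x : ℝ => Real.cos (2 * Real.pi * x)) univ := fun x _ => by fun_prop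
  have h1 := AnalyticOnNhd.aeval_polynomial h p
  simp only [Polynomial.coe_aeval_eq_eval] at h1
  intro x hx
  have := h1 x hx
  unfold cosMap
  fun_prop

/-! ### The main theorem -/

theorem theorem3 (K : ℝ) (hK0 : 0 < K) (hK2 : K ≤ 2) (U : Set DiffAC) (hU : U ∈ 𝓝 (1 : DiffAC)) :
    ∃ f : DiffAC, f ∈ U ∧ ∃ (F : ℝ → ℝ) (x₀ : ℝ),
      -- `f` is an analytic diffeomorphism of the circle
      IsLift F f.1 ∧ AnalyticOnNhd ℝ F univ ∧ (∀ x, 0 < deriv F x) ∧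
      -- `x₀` is the only fixed point of `f` on the circle, and it is parabolic with `f'' = 0`
      F x₀ = x₀ ∧ (∀ p : UnitAddCircle, f.1 p = p ↔ p = (x₀ : UnitAddCircle)) ∧
      deriv F x₀ = 1 ∧ deriv (deriv F) x₀ = 0 ∧
      (∫ x in (0 : ℝ)..1, |deriv (deriv F) x|) ≤ 2 * K ∧
      IsUndistorted f ∧
      (∀ k : ℕ, 2 ≤ k → ∃ hf : f.1 ∈ DiffCk k, IsUndistorted (⟨f.1, hf⟩ : DiffCk k)) ∧
      HasPosAsymptoticDistortion F x₀ (x₀ + 1) := by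
  obtain ⟨r, hr, hrU⟩ := EMetric.mem_nhds_iff.1 hU
  -- The bound `1 / 2000` keeps the derivative above `1 / 2`, `K / 500` controls the integral of
  -- `|f''|`, and the last condition places `f` in `U`.
  obtain ⟨ε, hε, hε', hεK, hεr⟩ : ∃ ε : ℝ, 0 < ε ∧ ε ≤ 1 / 2000 ∧ 1000 * ε ≤ 2 * K ∧
      ENNReal.ofReal (1077 * ε) < r := by
    have t : Tendsto (fun ε : ℝ => ENNReal.ofReal (1077 * ε)) (𝓝[>] 0) (𝓝 0) := by
      have : Continuous fun ε : ℝ => ENNReal.ofReal (1077 * ε) :=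
        ENNReal.continuous_ofReal.comp (continuous_const.mul continuous_id)
      simpa using this.tendsto 0 |>.mono_left nhdsWithin_le_nhds
    obtain ⟨ε, h3, h1, h2⟩ := ((t.eventually_lt_const hr).and (Ioc_mem_nhdsGT
      (show (0 : ℝ) < min (1 / 2000) (K / 500) by positivity))).exists
    have := h2.trans (min_le_right _ _)
    exact ⟨ε, h1, h2.trans (min_le_left _ _), by linarith, h3⟩
  obtain ⟨p, R₁, R₂, prof, b, hb, z, hbz, hz, m, hm⟩ := exists_polynomial_hasDistortionGap hε hε'
  obtain ⟨f, hf⟩ := prof.exists_isLift hε.le hε'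
  have han := analyticOnNhd_cosMap ε p
  have hpos := prof.deriv_cosMap_pos hε.le hε'
  have hfin : ∀ n : ℕ, logVar (f.1 ^ n) ≠ ⊤ := fun n => DiffAC.logVar_ne_top (f ^ n)
  obtain ⟨c, hc, C, hgrow⟩ := hf.exists_mul_sub_le_logVar_pow hpos prof.cosMap_zero
    (prof.lt_cosMap hε) (by positivity : 0 ≤ 2000 * ε)
    (prof.abs_log_deriv_cosMap_sub_le hε.le hε') hb ⟨hbz.le, hz.le⟩ hm hfin
  refine ⟨f, hrU ((prof.edist_one_le hε.le hf).trans_lt hεr), _, 0, hf, han, hpos,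
    prof.cosMap_zero, fun x => ?_, prof.deriv_cosMap_zero, prof.deriv_deriv_cosMap_zero, ?_, ?_,
    fun k hk => ⟨⟨_, hf, han.contDiff, hpos⟩, ?_⟩, ?_⟩
  · induction x using QuotientAddGroup.induction_on with
    | H x =>
      change f.1 (x : UnitAddCircle) = (x : UnitAddCircle) ↔ (x : UnitAddCircle) = _
      rw [hf.coe_apply, ← sub_eq_zero, ← AddCircle.coe_sub, AddCircle.coe_eq_zero_iff,
        AddCircle.coe_zero, AddCircle.coe_eq_zero_iff]
      simp only [zsmul_eq_mul, mul_one]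
      rw [← prof.cosMap_eq_self_iff hε x]
      -- The displacement is at most `7 * ε < 1`, so a fixed point on the circle is a fixed point of
      -- the lift and not merely one up to an integer.
      refine ⟨fun ⟨n, hn⟩ => ?_, fun h => ⟨0, by rw [h]; simp⟩⟩
      have h1 := prof.abs_cosMap_sub_le hε.le x
      rw [← hn] at h1
      have h2 : |(n : ℝ)| < 1 := by linarith
      have h3 : n = 0 := Int.abs_lt_one_iff.1 (by exact_mod_cast h2)
      rw [h3, Int.cast_zero] at hn
      linarith
  · have := intervalIntegral.norm_integral_le_of_norm_le_const (a := (0 : ℝ)) (b := 1)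
      (f := fun x => |deriv (deriv (cosMap ε fun u => (1 - u) ^ 2 * (1 + p.eval u))) x|)
      (C := 1000 * ε) fun x _ => by
        rw [Real.norm_eq_abs, abs_abs]
        exact prof.abs_deriv_deriv_cosMap_le hε.le x
    rw [sub_zero, abs_one, mul_one] at this
    exact (le_abs_self _).trans (this.trans hεK)
  · obtain ⟨d, hd⟩ := DiffAC.exists_isMaximalPseudometric
    refine hd.isUndistorted DiffAC.isContRightInv hc (C := C) fun n => ?_
    rw [IsLength.pseudoMetric_apply, inv_one, mul_one]
    exact hgrow n
  · obtain ⟨d, hd⟩ := DiffCk.exists_isMaximalPseudometric (by lia : 1 ≤ k)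
    refine hd.isUndistorted (DiffCk.isContRightInv hk) hc (C := C) fun n => ?_
    rw [IsLength.pseudoMetric_apply, inv_one, mul_one]
    exact hgrow n
  · rw [zero_add]
    exact hf.hasPosAsymptoticDistortion hpos hfin hc hgrow
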